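/- Let the sojourn times $\tau_1,\tau_2,\dots>0$ be i.i.d. with probability density $\psi$ and distribution function $\Psi$, let the jumps $J_1,J_2,\dots>0$ be i.i.d. with probability density $h$, all these variables being mutually independent. Put $t_0=0$, $t_n=\tau_1+\dots+\tau_n$, $S_t=\sum_{n\ge1}J_n\mathbf 1_{\{t_n\le t\}}$, $N_t=\#\{n\ge 1:t_n\le t\}$, and let $E_r=t_{N_r+1}-r$ be the excess life at time $r\ge0$, with distribution function $\Phi(\cdot|r)$. For a drift $v>0$, a level $b>0$ and $x\in(0,b)$, the walk which is at $x$ at time $\rho$ is $X_{\rho+t}=x+vt+S_{\rho+t}-S_\rho$. Let $T_b(x,r)$ be the mean of the time elapsed from the deterministic time $\rho=r\ge0$ to the first exit of this walk from $(0,b)$ (nothing but the position being known at time $r$), and let $\mathcal T_b(x)$ be the same mean for $\rho=t_n$, i.e. when $x$ is the position just after the $n$-th jump time, $n\ge 0$. Write $\hat g(s)=\int_0^\infty g(y)e^{-sy}\,dy$. Then the following hold. 1. For every $r\ge0$, $E_r$ has a density $\phi(\cdot|r)$, and $\partial_t\Phi(t|r)=\phi(t|r)$ for almost every $t$. 2.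 For every $v>0$ the integral equation $$F(y)=\int_0^{y/v}[1-\Psi(l)]\,dl+\frac1v\int_0^y\psi\Big(\frac{y-z}v\Big)\int_0^z h(u)F(z-u)\,du\,dz\qquad(y\ge0)$$ has exactly one locally integrable solution $F$ on $[0,\infty)$. For all $0<x<b$ and $n\ge0$, $\mathcal T_b(x)=F(b-x)$, independently of $n$. 3. Define, for $r,y\ge0$, $$J(y|r)=\int_0^{y/v}[1-\Phi(l|r)]\,dl+\frac1v\int_0^y\phi\Big(\frac{y-z}v\Big|r\Big)\int_0^z h(u)F(z-u)\,du\,dz .$$ Then $T_b(x,r)=J(b-x|r)$ for all $0<x<b$ (that is, $J(y|r)=T_b(b-y,r)$ for $0<y<b$). 4. For every complex $s$ with $\operatorname{Re}s>0$ and every $r\ge 0$, the Laplace integrals of $F$ and $J(\cdot|r)$ at $s$ converge absolutely, $1-\hat\psi(sv)\hat h(s)\neq0$, and $$\hat F(s)=\frac1{vs^2}\,\frac{1-\hat\psi(sv)}{1-\hat\psi(sv)\hat h(s)},\qquad \hat J(s|r)=\hat F(s)-\frac{1-\hat h(s)}{vs^2[1-\hat\psi(sv)\hat h(s)]}\big[\hat\phi(sv|r)-\hat\psi(sv)\big].$$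 5. (Small drift.) Fix $r\ge0$ and $s$ with $\operatorname{Re}s>0$. Let $\mu=\mathbb E[\tau_1]$ and $\mu_r=\mathbb E[E_r]$. If $\mu<\infty$, then $\mu_r<\infty$ and $\hat J(s|r)-\hat F(s)\to-(\mu-\mu_r)/s$ as $v\to0^+$. If $\mathbb E[\tau_1^3]<\infty$, then $\mathbb E[E_r^3]<\infty$, $\hat h(s)\ne1$, and, as $v\to0^+$, $$\hat J(s|r)=\hat F(s)-\frac{\mu-\mu_r}{s}+\left[\frac{\hat h(s)}{1-\hat h(s)}(\mu-\mu_r)\mu+\frac{\mathbb E[\tau_1^2]-\mathbb E[E_r^2]}2\right]v+O(v^2).$$ 6. (Stationary limit.) Suppose $\mu=\mathbb E[\tau_1]<\infty$. Then $\mu>0$, and for $\operatorname{Re}s\ge0$, $s\ne0$, $\hat\phi(s|r)\to\hat\phi(s|\infty)=\dfrac{1-\hat\psi(s)}{s\mu}$ as $r\to\infty$. For every $v>0$ and every $y\ge0$ the limit $J(y|\infty)=\lim_{r\to\infty}J(y|r)$ exists, and for $\operatorname{Re}s>0$ its Laplace integral converges absolutely, $\hat J(s|r)\to\hat J(s|\infty)$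 as $r\to\infty$, and $$\hat J(s|\infty)=\hat F(s)-\frac{1-\hat h(s)}{v^2s^3\mu}\,\frac{1-(1+sv\mu)\hat\psi(sv)}{1-\hat\psi(sv)\hat h(s)} .$$ -/

import Mathlib

open MeasureTheory ProbabilityTheory Filter Topology Set Asymptotics

noncomputable section

namespace CTRW

/-- `g` is a probability density function carried by the nonnegative half-line. -/
structure IsHalfLineDensity (g : ℝ → ℝ) : Prop where
  measurable : Measurable g
  nonneg : ∀ t, 0 ≤ g t
  eq_zero_of_neg : ∀ t, t < 0 → g t = 0
  lintegral_eq_one : ∫⁻ t, ENNReal.ofReal (g t) = 1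

/-- The probabilistic data of a continuous-time random walk with positive jumps: the sojourn times
`τ 0, τ 1, …` have common density `ψ`, the jump magnitudes `J 0, J 1, …` have common density `h`,
and all these variables are mutually independent. The index is shifted by one: `τ n` is the
`(n+1)`-st sojourn time and `J n` the `(n+1)`-st jump. -/
structure IsWalk {Ω : Type*} [MeasurableSpace Ω] (P : Measure Ω)
    (τ J : ℕ → Ω → ℝ) (ψ h : ℝ → ℝ) : Prop where
  density_wait : IsHalfLineDensity ψ
  density_jump : IsHalfLineDensity h
  measurable_wait : ∀ n, Measurable (τ n)
  measurable_jump : ∀ n, Measurable (J n)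
  law_wait : ∀ n, P.map (τ n) = volume.withDensity (fun t => ENNReal.ofReal (ψ t))
  law_jump : ∀ n, P.map (J n) = volume.withDensity (fun u => ENNReal.ofReal (h u))
  indep : iIndepFun (fun i : ℕ ⊕ ℕ => Sum.elim τ J i) P

section WalkFunctionals

variable {Ω : Type*}

/-- The jump times `t_n = τ_1 + ⋯ + τ_n`, with `t_0 = 0`. -/
def jumpTime (τ : ℕ → Ω → ℝ) (n : ℕ) (ω : Ω) : ℝ := ∑ i ∈ Finset.range n, τ i ω

/-- The pure-jump part `S_t = ∑_{n ≥ 1} J_n θ(t - t_n)`, where `θ(u) = 1` for `u ≥ 0`. -/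
def jumpPart (τ J : ℕ → Ω → ℝ) (t : ℝ) (ω : Ω) : ℝ :=
  ∑' n : ℕ, if jumpTime τ (n + 1) ω ≤ t then J n ω else 0

/-- The number `N_t` of jumps up to time `t` (almost surely finite). -/
def jumpCount (τ : ℕ → Ω → ℝ) (t : ℝ) (ω : Ω) : ℕ :=
  {n : ℕ | jumpTime τ (n + 1) ω ≤ t}.ncard

/-- The excess life `E_r = t_{N_r + 1} - r`. -/
def excessLife (τ : ℕ → Ω → ℝ) (r : ℝ) (ω : Ω) : ℝ :=
  jumpTime τ (jumpCount τ r ω + 1) ω - r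

/-- The position `X_{ρ+t}` of the drifting walk which is at `x` at the instant `ρ`:
`X_{ρ+t} = x + v t + (S_{ρ+t} - S_ρ)`. -/
def position (τ J : ℕ → Ω → ℝ) (v x ρ : ℝ) (t : ℝ) (ω : Ω) : ℝ :=
  x + v * t + (jumpPart τ J (ρ + t) ω - jumpPart τ J ρ ω)

/-- The time elapsed from the instant `ρ`, at which the walk is at `x`, until its first exit from
`(0, b)`. (For `v > 0` and positive jumps the set is almost surely nonempty.) -/
def exitTime (τ J : ℕ → Ω → ℝ) (v b x ρ : ℝ) (ω : Ω) : ℝ :=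
  sInf {t : ℝ | 0 ≤ t ∧ position τ J v x ρ t ω ∉ Ioo 0 b}

/-- The mean exit time `T_b(x, r)` past the deterministic time `r`, the position at `r` being `x`
and nothing else being known about the walk at that time. -/
def meanExit [MeasurableSpace Ω] (P : Measure Ω) (τ J : ℕ → Ω → ℝ) (v b x r : ℝ) : ℝ :=
  ∫ ω, exitTime τ J v b x r ω ∂P

/-- The mean exit time `𝒯_b(x)` past the `n`-th jump time `t_n`, the position just after this jump
being `x`. -/
def meanExitAfterJump [MeasurableSpace Ω] (P : Measure Ω) (τ J : ℕ → Ω → ℝ) (v b x : ℝ)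
    (n : ℕ) : ℝ :=
  ∫ ω, exitTime τ J v b x (jumpTime τ n ω) ω ∂P

/-- The distribution function `Φ(t|r)` of the excess life. -/
def excessCdf [MeasurableSpace Ω] (P : Measure Ω) (τ : ℕ → Ω → ℝ) (r t : ℝ) : ℝ :=
  P.real {ω | excessLife τ r ω ≤ t}

/-- The density `φ(t|r)` of the excess life. -/
def excessPdf [MeasurableSpace Ω] (P : Measure Ω) (τ : ℕ → Ω → ℝ) (r t : ℝ) : ℝ :=
  (pdf (excessLife τ r) P volume t).toReal

end WalkFunctionals

/-- The Laplace transform `ĝ(s) = ∫_0^∞ g(y) e^{-s y} dy`. -/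
def laplace (g : ℝ → ℝ) (s : ℂ) : ℂ :=
  ∫ y in Ioi (0 : ℝ), (g y : ℂ) * Complex.exp (-s * (y : ℂ))

/-- The Laplace integral of `g` at `s` converges absolutely. -/
def LaplaceConverges (g : ℝ → ℝ) (s : ℂ) : Prop :=
  IntegrableOn (fun y : ℝ => (g y : ℂ) * Complex.exp (-s * (y : ℂ))) (Ioi (0 : ℝ))

/-- The distribution function `Ψ(t) = ∫_0^t ψ` of the waiting times. -/
def waitCdf (ψ : ℝ → ℝ) (t : ℝ) : ℝ := ∫ t' in (0 : ℝ)..t, ψ t'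

/-- `F` is a (locally integrable) solution on `[0, ∞)` of the integral equation
`F(y) = ∫_0^{y/v} [1 - Ψ(l)] dl + (1/v) ∫_0^y ψ((y - z)/v) ∫_0^z h(u) F(z - u) du dz`. -/
structure SolvesRenewal (ψ h : ℝ → ℝ) (v : ℝ) (F : ℝ → ℝ) : Prop where
  locInt : ∀ Y : ℝ, IntegrableOn F (Icc 0 Y)
  eqn : ∀ y : ℝ, 0 ≤ y →
    F y = (∫ l in (0 : ℝ)..(y / v), (1 - waitCdf ψ l))
      + (1 / v) * ∫ z in (0 : ℝ)..y, ψ ((y - z) / v) * ∫ u in (0 : ℝ)..z, h u * F (z - u)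

/-- The function `J(y|r)` given, for every `y ≥ 0`, by
`∫_0^{y/v} [1 - Φ(l|r)] dl + (1/v) ∫_0^y φ((y - z)/v | r) ∫_0^z h(u) F(z - u) du dz`. -/
def meanExitFrom {Ω : Type*} [MeasurableSpace Ω] (P : Measure Ω) (τ : ℕ → Ω → ℝ) (h : ℝ → ℝ)
    (v : ℝ) (F : ℝ → ℝ) (r y : ℝ) : ℝ :=
  (∫ l in (0 : ℝ)..(y / v), (1 - excessCdf P τ r l))
    + (1 / v) * ∫ z in (0 : ℝ)..y,
        excessPdf P τ r ((y - z) / v) * ∫ u in (0 : ℝ)..z, h u * F (z - u)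

end CTRW

end

noncomputable section

open scoped ENNReal Convolution

/-! The walk only moves upwards, so leaving (0, b) from x means travelling the distance y = b - x,
and the exit time is the sum over the successive sojourns of the time spent below the level
(`exitTime_eq_passageTime`). Such a sum splits off its first sojourn (`passageTime_seqCons`) and is
at most y / v, the time the drift alone would need (`passageTime_le`). That bound supplies
integrability, domination and convergence of the Laplace integrals.

What follows the next jump is an independent copy of the walk (`lintegral_residual`), so the past
matters only through the law κ of the time to that jump. The mean passage time is therefore one
functional `passageMeanLaw` of κ, linear in κ: κ = ψ dt gives F, κ = law of E_r gives J(·|r), and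
the stationary law gives J(·|∞). Conditioning on the residual time e and the next jump gives the
mean of min(e, y/v) plus the mean of F(y - v e - u); after the substitution z = y - v e these are
the stated quadratures.

Taking Laplace transforms, κ enters only through its transform at sv. The case κ = ψ dt closes into
a linear equation for F̂, solvable because |ψ̂(sv) ĥ(s)| < 1, and the other cases follow by
elimination (`laplace_passageMeanLaw'`). Uniqueness is a contraction: after truncation to [0, Y] and
multiplication by e^{-x}, the kernel h has L¹ norm below one (`ae_eq_zero_of_abs_le_conv`). The
small-drift expansions come from Taylor expanding ψ̂(sv) and φ̂(sv|r), with remainders controlled by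
moments; moments of E_r are finite because E_r is at most the sojourn time covering r.

The limit r → ∞ rests on a key renewal theorem (`IsRenewal.tendsto`). Let L be the limsup of the
convolution term W. Along a sequence realising L, the renewal equation forces W → L also after a
shift by any point of the support of ψ dt, hence by any point of the semigroup the support
generates. The support has positive Lebesgue measure, so by Steinhaus this semigroup is eventually
as dense as desired, and uniform continuity of W keeps Z near L at every sufficiently large shift.
The balance identity `integral_mul_tail_eq` then bounds L by its expected value, and applying the
same to -Z gives the limit. -/

namespace CTRW

/-! ### Passage times of deterministic paths -/

/-- The sequence `e, t 0, t 1, …`. -/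
def seqCons (e : ℝ) (t : ℕ → ℝ) : ℕ → ℝ
  | 0 => e
  | n + 1 => t n

/-- The partial sums of a real sequence. -/
def psum (a : ℕ → ℝ) (n : ℕ) : ℝ := ∑ i ∈ Finset.range n, a i

@[simp] lemma psum_zero (a : ℕ → ℝ) : psum a 0 = 0 := by simp [psum]

lemma psum_succ (a : ℕ → ℝ) (n : ℕ) : psum a (n + 1) = psum a n + a n := by
  simp [psum, Finset.sum_range_succ]

lemma psum_succ' (a : ℕ → ℝ) (n : ℕ) : psum a (n + 1) = a 0 + psum (fun k => a (k + 1)) n := by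
  simp [psum, Finset.sum_range_succ', add_comm]

lemma psum_strictMono {a : ℕ → ℝ} (ha : ∀ k, 0 < a k) : StrictMono (psum a) :=
  strictMono_nat_of_lt_succ fun n => by rw [psum_succ]; linarith [ha n]

lemma psum_add (a : ℕ → ℝ) (n k : ℕ) :
    psum a (n + k) = psum a n + psum (fun i => a (n + i)) k := by
  simp [psum, Finset.sum_range_add]

lemma jumpTime_eq_psum {Ω : Type*} (τ : ℕ → Ω → ℝ) (n : ℕ) (ω : Ω) :
    jumpTime τ n ω = psum (fun k => τ k ω) n := rfl

/-- The time at which a walk with sojourn times `a`, jumps `c` and drift `v` has travelled the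
distance `y`, as the sum of the times spent below `y` during the successive sojourns. -/
def passageTime (v y : ℝ) (a c : ℕ → ℝ) : ℝ≥0∞ :=
  ∑' k, ENNReal.ofReal (min (a k) ((y - v * psum a k - psum c k) / v))

/-- First-step decomposition: after one sojourn and one jump the same sum restarts over the distance
that is left. No summability or sign condition is needed, the sums being in `ℝ≥0∞`. -/
lemma passageTime_seqCons (v y e : ℝ) (t c : ℕ → ℝ) :
    passageTime v y (seqCons e t) c = ENNReal.ofReal (min e (y / v))
      + passageTime v (y - v * e - c 0) t (fun k => c (k + 1)) := by
  unfold passageTime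
  rw [tsum_eq_zero_add' ENNReal.summable]
  congr 1
  · simp [seqCons]
  · refine tsum_congr fun k => ?_
    rw [psum_succ', psum_succ' c]
    simp only [seqCons]
    congr 3
    ring

lemma seqCons_eta (a : ℕ → ℝ) : seqCons (a 0) (fun k => a (k + 1)) = a := by
  funext n; cases n <;> rfl

/-- The drift alone covers the distance in time `y / v`, and the jumps only shorten it. The
induction runs over the number of sojourns, peeling off the first one, hence with `y` and both
sequences generalised. -/
lemma passageTime_le {v : ℝ} (hv : 0 < v) (y : ℝ) {a c : ℕ → ℝ} (ha : ∀ k, 0 ≤ a k)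
    (hc : ∀ k, 0 ≤ c k) : passageTime v y a c ≤ ENNReal.ofReal (y / v) := by
  unfold passageTime
  refine ENNReal.tsum_le_of_sum_range_le fun K => ?_
  induction K generalizing y a c with
  | zero => simp
  | succ K ih =>
    rw [Finset.sum_range_succ']
    have h1 := ih (y - v * a 0 - c 0) (a := fun k => a (k + 1)) (c := fun k => c (k + 1))
      (fun k => ha _) (fun k => hc _)
    have h2 : ∀ k, y - v * psum a (k + 1) - psum c (k + 1)
        = y - v * a 0 - c 0 - v * psum (fun k => a (k + 1)) k - psum (fun k => c (k + 1)) k := by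
      intro k; rw [psum_succ', psum_succ' c]; ring
    simp only [h2]
    refine (add_le_add_left h1 _).trans ?_
    simp only [psum_zero, mul_zero, sub_zero]
    have e1 : (y - v * a 0 - c 0) / v = y / v - a 0 - c 0 / v := by field_simp
    rw [e1]
    have h3 : 0 ≤ c 0 / v := div_nonneg (hc 0) hv.le
    have h4 := ha 0
    rcases le_total (y / v) (a 0) with h | h
    · rw [min_eq_right h, ENNReal.ofReal_of_nonpos (by linarith), zero_add]
    · rw [min_eq_left h]
      rcases le_total (y / v - a 0 - c 0 / v) 0 with h5 | h5
      · rw [ENNReal.ofReal_of_nonpos h5, zero_add]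
        exact ENNReal.ofReal_le_ofReal h
      · rw [← ENNReal.ofReal_add h5 h4]
        exact ENNReal.ofReal_le_ofReal (by linarith)

lemma finite_psum_le {a : ℕ → ℝ} (hA : Tendsto (psum a) atTop atTop) (t : ℝ) :
    {k : ℕ | psum a (k + 1) ≤ t}.Finite := by
  have h := (hA.comp (tendsto_add_atTop_nat 1)).eventually_gt_atTop t
  obtain ⟨N, hN⟩ := eventually_atTop.1 h
  refine (Set.finite_lt_nat N).subset fun k hk => ?_
  by_contra hcon
  exact absurd hk (not_le.2 (hN k (not_lt.1 hcon)))

lemma summable_jumps {a : ℕ → ℝ} (hA : Tendsto (psum a) atTop atTop) (c : ℕ → ℝ) (t : ℝ) :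
    Summable fun k => if psum a (k + 1) ≤ t then c k else 0 := by
  refine summable_of_hasFiniteSupport ((finite_psum_le hA t).subset fun k hk => ?_)
  by_contra hcon
  exact hk (if_neg hcon)

/-- With `m + 1` the first index at which the post-jump position is at least `y`, the level is
reached either by drift during sojourn `m` or by the jump that ends it. Both cases are covered by
the time `psum a m + d`. -/
lemma exists_isLeast_passage {v y : ℝ} (hv : 0 < v) (hy : 0 < y) {a c : ℕ → ℝ}
    (ha : ∀ k, 0 < a k) (hc : ∀ k, 0 < c k) (hA : Tendsto (psum a) atTop atTop) :
    ∃ t, IsLeast {t : ℝ | 0 ≤ t ∧ y ≤ v * t + ∑' k, if psum a (k + 1) ≤ t then c k else 0} t ∧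
      passageTime v y a c = ENNReal.ofReal t := by
  have hAm := psum_strictMono ha
  have hCm := psum_strictMono hc
  have hA0 : ∀ k, 0 ≤ psum a k := fun k => by
    simpa using hAm.monotone (Nat.zero_le k)
  have hC0 : ∀ k, 0 ≤ psum c k := fun k => by
    simpa using hCm.monotone (Nat.zero_le k)
  set W : ℕ → ℝ := fun k => v * psum a k + psum c k with hW
  have hWm : StrictMono W := fun i j hij =>
    add_lt_add (mul_lt_mul_of_pos_left (hAm hij) hv) (hCm hij)
  have hex : ∃ k, y ≤ W k := by
    obtain ⟨k, hk⟩ := (hA.eventually_ge_atTop (y / v)).exists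
    refine ⟨k, ?_⟩
    have := (div_le_iff₀' hv).1 hk
    simp only [hW]; linarith [hC0 k]
  classical
  -- The first such index is not zero, because the walk starts at `W 0 = 0 < y`.
  obtain ⟨m, hm⟩ : ∃ m, Nat.find hex = m + 1 := by
    refine Nat.exists_eq_succ_of_ne_zero fun h0 => ?_
    have := Nat.find_spec hex
    rw [h0] at this
    simp [hW] at this
    linarith
  have hm1 : y ≤ W (m + 1) := hm ▸ Nat.find_spec hex
  have hm0 : W m < y := not_le.1 (Nat.find_min hex (by omega))
  have hWm1 : W (m + 1) = W m + v * a m + c m := by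
    simp only [hW, psum_succ]; ring
  -- The part of sojourn `m` spent below the level: all of it when the crossing is made by a jump.
  set d : ℝ := min (a m) ((y - W m) / v) with hd
  have hd0 : 0 < d := lt_min (ha m) (div_pos (by linarith) hv)
  have hda : d ≤ a m := min_le_left _ _
  have hdv : v * d ≤ y - W m := by
    have : d ≤ (y - W m) / v := min_le_right _ _
    rwa [le_div_iff₀' hv] at this
  refine ⟨psum a m + d, ⟨⟨by linarith [hA0 m], ?_⟩, ?_⟩, ?_⟩
  · have key : ∀ j, psum a j ≤ psum a m + d →
        psum c j ≤ ∑' k, if psum a (k + 1) ≤ psum a m + d then c k else 0 := by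
      intro j hj
      refine le_trans (le_of_eq ?_) ((summable_jumps hA c _).sum_le_tsum (Finset.range j) ?_)
      · refine Finset.sum_congr rfl fun k hk => ?_
        rw [if_pos]
        exact (hAm.monotone (by simpa using hk)).trans hj
      · intro k _
        split_ifs
        exacts [(hc k).le, le_rfl]
    rcases le_total (a m) ((y - W m) / v) with h | h
    · have hd' : d = a m := min_eq_left h
      have := key (m + 1) (by rw [psum_succ, hd'])
      simp only [hW] at hm1
      rw [psum_succ] at hm1
      rw [hd'] at this ⊢
      linarith
    · have hd' : v * d = y - W m := by
        rw [hd, min_eq_right h]; field_simp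
      have := key m (by linarith)
      simp only [hW] at hd'
      linarith
  · rintro t ⟨ht0, ht⟩
    by_contra hlt
    push Not at hlt
    have hS : (∑' k, if psum a (k + 1) ≤ t then c k else 0) ≤ psum c m := by
      rw [tsum_eq_sum (s := Finset.range m)]
      · refine Finset.sum_le_sum fun k _ => ?_
        split_ifs
        exacts [le_rfl, (hc k).le]
      · intro k hk
        rw [if_neg]
        have : psum a (m + 1) ≤ psum a (k + 1) := hAm.monotone (by simpa using hk)
        rw [psum_succ] at this
        push Not
        linarith
    have : v * t < v * (psum a m + d) := mul_lt_mul_of_pos_left hlt hv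
    simp only [hW] at hdv
    linarith
  · unfold passageTime
    rw [tsum_eq_sum (s := Finset.range (m + 1))]
    swap
    · intro k hk
      refine ENNReal.ofReal_of_nonpos ((min_le_right _ _).trans
        (div_nonpos_of_nonpos_of_nonneg ?_ hv.le))
      have := hWm.monotone (show m + 1 ≤ k by simpa using hk)
      simp only [hW] at this hm1
      linarith
    rw [Finset.sum_range_succ, ENNReal.ofReal_add (hA0 m) hd0.le]
    congr 1
    · rw [psum, ENNReal.ofReal_sum_of_nonneg fun k _ => (ha k).le]
      refine Finset.sum_congr rfl fun k hk => ?_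
      rw [min_eq_left]
      have h1 : W (k + 1) ≤ W m := hWm.monotone (by simpa using hk)
      have h2 : W (k + 1) = W k + v * a k + c k := by
        simp only [hW, psum_succ]; ring
      rw [le_div_iff₀' hv]
      simp only [hW] at h1 h2 hm0
      linarith [hc k]
    · rw [hd]
      congr 3
      simp only [hW]; ring

/-! ### Exit time and excess life along a sample path -/

section Paths

variable {Ω : Type*} {τ J : ℕ → Ω → ℝ} {ω : Ω}

lemma psum_seqCons_residual (a : ℕ → ℝ) (ρ : ℝ) (n k : ℕ) :
    psum (seqCons (psum a (n + 1) - ρ) fun i => a (n + 1 + i)) (k + 1)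
      = psum a (n + k + 1) - ρ := by
  rw [psum_succ', show n + k + 1 = n + 1 + k by omega, psum_add a (n + 1)]
  simp only [seqCons]
  ring

/-- The exit time past an instant `ρ` between two successive jump times is the passage time of the
walk whose first sojourn time is the residual one. -/
lemma exitTime_eq_passageTime {v b x ρ : ℝ} {n : ℕ} (hv : 0 < v) (hx : 0 < x) (hxb : x < b)
    (hτ : ∀ k, 0 < τ k ω) (hJ : ∀ k, 0 < J k ω)
    (hA : Tendsto (fun n => jumpTime τ n ω) atTop atTop)
    (h1 : jumpTime τ n ω ≤ ρ) (h2 : ρ < jumpTime τ (n + 1) ω) :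
    exitTime τ J v b x ρ ω = (passageTime v (b - x)
      (seqCons (jumpTime τ (n + 1) ω - ρ) fun k => τ (n + 1 + k) ω)
        fun k => J (n + k) ω).toReal := by
  set A : ℕ → ℝ := fun k => τ k ω with hAdef
  set a := seqCons (jumpTime τ (n + 1) ω - ρ) fun k => τ (n + 1 + k) ω with ha
  set c := fun k => J (n + k) ω with hc
  have hsum : ∀ k, psum a (k + 1) = psum A (n + k + 1) - ρ := fun k =>
    psum_seqCons_residual A ρ n k
  have hapos : ∀ k, 0 < a k := by
    intro k
    cases k with
    | zero => simpa [a, seqCons] using h2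
    | succ k => exact hτ _
  have hAa : Tendsto (psum a) atTop atTop := by
    rw [← tendsto_add_atTop_iff_nat 1]
    simp only [hsum]
    refine tendsto_atTop_add_const_right _ _ ?_
    refine hA.comp (tendsto_atTop_mono (fun k => ?_) tendsto_id)
    simp only [id]; omega
  obtain ⟨t, ht, hpt⟩ := exists_isLeast_passage hv (sub_pos.2 hxb) hapos (c := c)
    (fun k => hJ _) hAa
  rw [hpt, ENNReal.toReal_ofReal ht.1.1, exitTime, ← ht.csInf_eq]
  congr 1
  ext u
  simp only [mem_ofPred_eq]
  refine and_congr_right fun hu => ?_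
  have hAmono := psum_strictMono (a := A) hτ
  -- The first `n` jumps have occurred by time `ρ` and cancel in the increment of the jump part.
  -- Since `J i` occurs at `jumpTime τ (i + 1)`, the jump `J (n + k)` falls at the partial sum of
  -- index `k + 1` of the residual sequence.
  have split : ∀ w, ρ ≤ w → jumpPart τ J w ω = (∑ k ∈ Finset.range n, J k ω)
      + ∑' k, if psum a (k + 1) ≤ w - ρ then c k else 0 := by
    intro w hw
    unfold jumpPart
    have hs : Summable fun k => if jumpTime τ (k + 1) ω ≤ w then J k ω else 0 :=
      summable_jumps (a := A) hA (fun k => J k ω) w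
    rw [← hs.sum_add_tsum_nat_add n]
    congr 1
    · refine Finset.sum_congr rfl fun k hk => if_pos ?_
      have : psum A (k + 1) ≤ psum A n := hAmono.monotone (by simpa using hk)
      exact this.trans (le_trans h1 hw)
    · refine tsum_congr fun k => ?_
      rw [hsum, add_comm k n]
      simp only [sub_le_sub_iff_right]
      rfl
  -- No later jump has happened at the instant `ρ` itself, because the residual time is strictly
  -- positive.
  have h0 : (∑' k, if psum a (k + 1) ≤ ρ - ρ then c k else 0) = 0 := by
    rw [sub_self]
    refine (tsum_congr fun k => if_neg ?_).trans tsum_zero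
    have : psum a 1 ≤ psum a (k + 1) := (psum_strictMono hapos).monotone (by omega)
    have h : psum a 1 = a 0 := by simp [psum]
    linarith [hapos 0]
  have hpos : position τ J v x ρ u ω
      = x + (v * u + ∑' k, if psum a (k + 1) ≤ u then c k else 0) := by
    rw [position, split (ρ + u) (by linarith), split ρ le_rfl, h0, add_sub_cancel_left]
    ring
  have hnn : 0 ≤ ∑' k, if psum a (k + 1) ≤ u then c k else 0 :=
    tsum_nonneg fun k => by split_ifs; exacts [(hJ _).le, le_rfl]
  have hvu : 0 ≤ v * u := mul_nonneg hv.le hu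
  -- The position never falls below `x > 0`, so the lower end of the interval plays no role.
  rw [hpos, mem_Ioo, not_and, not_lt]
  constructor
  · intro h
    linarith [h (by linarith)]
  · intro h _
    linarith

lemma exists_jumpTime_le_lt (hA : Tendsto (fun n => jumpTime τ n ω) atTop atTop)
    {r : ℝ} (hr : 0 ≤ r) : ∃ n, jumpTime τ n ω ≤ r ∧ r < jumpTime τ (n + 1) ω := by
  classical
  have hex : ∃ n, r < jumpTime τ n ω := (hA.eventually_gt_atTop r).exists
  obtain ⟨m, hm⟩ : ∃ m, Nat.find hex = m + 1 := by
    refine Nat.exists_eq_succ_of_ne_zero fun h0 => ?_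
    have := Nat.find_spec hex
    rw [h0, jumpTime_eq_psum, psum_zero] at this
    linarith
  exact ⟨m, not_lt.1 (Nat.find_min hex (by omega)), hm ▸ Nat.find_spec hex⟩

lemma jumpCount_eq (hτ : ∀ k, 0 < τ k ω) {r : ℝ} {n : ℕ}
    (h1 : jumpTime τ n ω ≤ r) (h2 : r < jumpTime τ (n + 1) ω) : jumpCount τ r ω = n := by
  have hmono := psum_strictMono hτ
  have : {k : ℕ | jumpTime τ (k + 1) ω ≤ r} = Set.Iio n := by
    ext k
    simp only [mem_ofPred_eq, mem_Iio]
    constructor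
    · intro h
      have : psum (fun k => τ k ω) (k + 1) < psum (fun k => τ k ω) (n + 1) := lt_of_le_of_lt h h2
      have := hmono.lt_iff_lt.1 this
      omega
    · intro h
      exact (hmono.monotone (show k + 1 ≤ n by omega)).trans h1
  rw [jumpCount, this, Set.ncard_eq_toFinset_card']
  simp

lemma excessLife_eq (hτ : ∀ k, 0 < τ k ω) {r : ℝ} {n : ℕ}
    (h1 : jumpTime τ n ω ≤ r) (h2 : r < jumpTime τ (n + 1) ω) :
    excessLife τ r ω = jumpTime τ (n + 1) ω - r := by
  rw [excessLife, jumpCount_eq hτ h1 h2]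

lemma excessLife_of_lt (hτ : ∀ k, 0 < τ k ω) {r : ℝ} (hr : 0 ≤ r) (h : r < τ 0 ω) :
    excessLife τ r ω = τ 0 ω - r := by
  rw [excessLife_eq hτ (n := 0)] <;> simp [jumpTime, hr, h]

/-- The renewal property of the excess life at the first jump time. -/
lemma excessLife_of_le (hτ : ∀ k, 0 < τ k ω)
    (hA : Tendsto (fun n => jumpTime τ n ω) atTop atTop) {r : ℝ} (h : τ 0 ω ≤ r) :
    excessLife τ r ω = excessLife (fun k => τ (k + 1)) (r - τ 0 ω) ω := by
  have hs : ∀ n, jumpTime τ (n + 1) ω = τ 0 ω + jumpTime (fun k => τ (k + 1)) n ω := fun n =>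
    psum_succ' (fun k => τ k ω) n
  have hA' : Tendsto (fun n => jumpTime (fun k => τ (k + 1)) n ω) atTop atTop := by
    have := tendsto_atTop_add_const_right atTop (-τ 0 ω) (hA.comp (tendsto_add_atTop_nat 1))
    refine this.congr fun n => ?_
    simp only [Function.comp, hs]; ring
  obtain ⟨n, h1, h2⟩ := exists_jumpTime_le_lt hA' (sub_nonneg.2 h)
  rw [excessLife_eq (fun k => hτ (k + 1)) h1 h2, excessLife_eq hτ (n := n + 1), hs]
  · ring
  · rw [hs]; linarith
  · rw [hs]; linarith

end Paths

/-! ### Laws carried by the positive half-line -/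

/-- The law on the line with density `g`. -/
def halfLaw (g : ℝ → ℝ) : Measure ℝ := volume.withDensity fun t => ENNReal.ofReal (g t)

namespace IsHalfLineDensity

variable {g : ℝ → ℝ}

lemma isProbabilityMeasure (hg : IsHalfLineDensity g) : IsProbabilityMeasure (halfLaw g) :=
  ⟨by rw [halfLaw, withDensity_apply _ MeasurableSet.univ, Measure.restrict_univ,
    hg.lintegral_eq_one]⟩

lemma absolutelyContinuous (g : ℝ → ℝ) : halfLaw g ≪ volume :=
  withDensity_absolutelyContinuous _ _

lemma ae_pos (hg : IsHalfLineDensity g) : ∀ᵐ x ∂halfLaw g, 0 < x := by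
  have h0 : ∀ᵐ x ∂halfLaw g, x ≠ 0 :=
    (absolutelyContinuous g).ae_le (Measure.ae_ne volume 0)
  have h1 : ∀ᵐ x ∂halfLaw g, 0 ≤ x := by
    rw [halfLaw, ae_withDensity_iff (by have := hg.measurable; fun_prop)]
    refine ae_of_all _ fun x hx => ?_
    by_contra hneg
    exact hx (by rw [hg.eq_zero_of_neg x (not_le.1 hneg), ENNReal.ofReal_zero])
  filter_upwards [h0, h1] with x hx0 hx1
  exact lt_of_le_of_ne hx1 (Ne.symm hx0)

lemma integrable (hg : IsHalfLineDensity g) : Integrable g := by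
  refine ⟨hg.measurable.aestronglyMeasurable, ?_⟩
  rw [hasFiniteIntegral_iff_ofReal (ae_of_all _ hg.nonneg), hg.lintegral_eq_one]
  exact ENNReal.one_lt_top

end IsHalfLineDensity

lemma integrable_exp_neg {κ : Measure ℝ} [IsProbabilityMeasure κ] (hκ : ∀ᵐ x ∂κ, 0 < x) {σ : ℝ}
    (hσ : 0 ≤ σ) : Integrable (fun x => Real.exp (-σ * x)) κ := by
  refine Integrable.of_bound (by fun_prop) 1 ?_
  filter_upwards [hκ] with x hx
  rw [Real.norm_eq_abs, abs_of_pos (Real.exp_pos _), Real.exp_le_one_iff]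
  nlinarith

/-- Strictness comes from the absence of mass at 0. It has three uses: divergence of the jump times,
non-vanishing of the Laplace denominators, and the contraction behind uniqueness. -/
lemma integral_exp_neg_lt_one {κ : Measure ℝ} [IsProbabilityMeasure κ] (hκ : ∀ᵐ x ∂κ, 0 < x)
    {σ : ℝ} (hσ : 0 < σ) : ∫ x, Real.exp (-σ * x) ∂κ < 1 := by
  have hi := integrable_exp_neg hκ hσ.le
  have hpos : 0 < ∫ x, (1 - Real.exp (-σ * x)) ∂κ := by
    rw [integral_pos_iff_support_of_nonneg_ae]
    · have : (Function.support fun x => 1 - Real.exp (-σ * x)) =ᵐ[κ] univ := by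
        filter_upwards [hκ] with x hx
        refine eq_iff_iff.2 (iff_of_true (show _ ≠ _ from ?_) trivial)
        have : Real.exp (-σ * x) < 1 := Real.exp_lt_one_iff.2 (by nlinarith)
        exact (sub_pos.2 this).ne'
      rw [measure_congr this]
      simp
    · filter_upwards [hκ] with x hx
      have : Real.exp (-σ * x) < 1 := Real.exp_lt_one_iff.2 (by nlinarith)
      simpa using this.le
    · exact (integrable_const _).sub hi
  rw [integral_sub (integrable_const _) hi] at hpos
  simp at hpos
  simpa using hpos

/-! ### Independence, restarting the walk, and divergence of the jump times -/

section Indep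

variable {Ω β γ : Type*} [MeasurableSpace Ω] {P : Measure Ω} [IsProbabilityMeasure P]
  [MeasurableSpace β] [MeasurableSpace γ]

/-- Fubini on the product law. Allowing a copy `g'` in place of `g` is what turns the walk after a
jump back into the original walk. -/
lemma lintegral_indepFun {f : Ω → β} {g g' : Ω → γ} (hf : Measurable f) (hg : Measurable g)
    (hg' : Measurable g') (hind : IndepFun f g P) (hlaw : P.map g = P.map g')
    {Φ : β → γ → ℝ≥0∞} (hΦ : Measurable (Function.uncurry Φ)) :
    ∫⁻ ω, Φ (f ω) (g ω) ∂P = ∫⁻ ω, ∫⁻ ω', Φ (f ω) (g' ω') ∂P ∂P := by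
  have h := (indepFun_iff_map_prod_eq_prod_map_map hf.aemeasurable hg.aemeasurable).1 hind
  have : ∫⁻ ω, Φ (f ω) (g ω) ∂P
      = ∫⁻ p, Function.uncurry Φ p ∂(P.map fun ω => (f ω, g ω)) :=
    (lintegral_map hΦ (hf.prodMk hg)).symm
  rw [this, h, hlaw, lintegral_prod _ hΦ.aemeasurable,
    lintegral_map hΦ.lintegral_prod_right' hf]
  refine lintegral_congr fun ω => ?_
  rw [lintegral_map (by fun_prop) hg']
  rfl

lemma integral_indepFun {f : Ω → β} {g g' : Ω → γ} (hf : Measurable f) (hg : Measurable g)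
    (hg' : Measurable g') (hind : IndepFun f g P) (hlaw : P.map g = P.map g')
    {Φ : β → γ → ℝ} (hΦ : Measurable (Function.uncurry Φ)) {B : ℝ} (hB : ∀ x y, |Φ x y| ≤ B) :
    ∫ ω, Φ (f ω) (g ω) ∂P = ∫ ω, ∫ ω', Φ (f ω) (g' ω') ∂P ∂P := by
  have h := (indepFun_iff_map_prod_eq_prod_map_map hf.aemeasurable hg.aemeasurable).1 hind
  have e0 : ∫ ω, Φ (f ω) (g ω) ∂P
      = ∫ p, Function.uncurry Φ p ∂(P.map fun ω => (f ω, g ω)) :=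
    (integral_map (hf.prodMk hg).aemeasurable hΦ.aestronglyMeasurable).symm
  have := Measure.isProbabilityMeasure_map (μ := P) hf.aemeasurable
  have := Measure.isProbabilityMeasure_map (μ := P) hg'.aemeasurable
  rw [e0, h, hlaw, integral_prod, integral_map hf.aemeasurable]
  · refine integral_congr_ae (ae_of_all _ fun ω => ?_)
    simp only
    rw [integral_map hg'.aemeasurable]
    · rfl
    · exact (hΦ.comp measurable_prodMk_left).aestronglyMeasurable
  · exact hΦ.stronglyMeasurable.integral_prod_right'.aestronglyMeasurable
  · exact Integrable.of_bound hΦ.aestronglyMeasurable B (ae_of_all _ fun p => hB _ _)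

end Indep

namespace IsWalk

variable {Ω : Type*} [MeasurableSpace Ω] {P : Measure Ω} {τ J : ℕ → Ω → ℝ} {ψ h : ℝ → ℝ}

lemma measurable_elim (hw : IsWalk P τ J ψ h) (i : ℕ ⊕ ℕ) : Measurable (Sum.elim τ J i) := by
  cases i
  exacts [hw.measurable_wait _, hw.measurable_jump _]

lemma map_elim (hw : IsWalk P τ J ψ h) (i : ℕ ⊕ ℕ) :
    P.map (Sum.elim τ J i) = Sum.elim (fun _ : ℕ => halfLaw ψ) (fun _ : ℕ => halfLaw h) i := by
  cases i
  exacts [hw.law_wait _, hw.law_jump _]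

lemma shift (hw : IsWalk P τ J ψ h) (n m : ℕ) :
    IsWalk P (fun k => τ (n + k)) (fun k => J (m + k)) ψ h where
  density_wait := hw.density_wait
  density_jump := hw.density_jump
  measurable_wait _ := hw.measurable_wait _
  measurable_jump _ := hw.measurable_jump _
  law_wait _ := hw.law_wait _
  law_jump _ := hw.law_jump _
  indep := by
    have := hw.indep.precomp (g := Sum.map (fun k => n + k) (fun k => m + k))
      (Sum.map_injective.2 ⟨add_right_injective n, add_right_injective m⟩)
    convert! this using 2 with i
    cases i <;> rfl

/-- The sojourn times and the jumps, as a pair of random sequences. -/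
def seqPair (τ J : ℕ → Ω → ℝ) (ω : Ω) : (ℕ → ℝ) × (ℕ → ℝ) := (fun k => τ k ω, fun k => J k ω)

lemma measurable_seqPair (hw : IsWalk P τ J ψ h) : Measurable (seqPair τ J) :=
  (measurable_pi_lambda _ hw.measurable_wait).prodMk (measurable_pi_lambda _ hw.measurable_jump)

/-- By independence the joint law is the infinite product of the marginals, hence depends on `ψ` and
`h` only; in particular a shifted walk has the same law as the unshifted one. -/
lemma map_seqPair_congr {τ' J' : ℕ → Ω → ℝ} (hw : IsWalk P τ J ψ h) (hw' : IsWalk P τ' J' ψ h) :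
    P.map (seqPair τ J) = P.map (seqPair τ' J') := by
  set Q : (ℕ ⊕ ℕ → ℝ) → (ℕ → ℝ) × (ℕ → ℝ) := fun x => (fun k => x (.inl k), fun k => x (.inr k))
  have hQ : Measurable Q := by fun_prop
  have key : ∀ {σ K : ℕ → Ω → ℝ}, IsWalk P σ K ψ h → P.map (seqPair σ K)
      = (Measure.infinitePi fun i : ℕ ⊕ ℕ =>
          Sum.elim (fun _ : ℕ => halfLaw ψ) (fun _ : ℕ => halfLaw h) i).map Q := by
    intro σ K hs
    have h1 := hs.indep.map_fun_eq_infinitePi_map hs.measurable_elim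
    simp only [hs.map_elim] at h1
    rw [← h1, Measure.map_map hQ (measurable_pi_lambda _ hs.measurable_elim)]
    rfl
  rw [key hw, key hw']

/-- The variables with index in `S`, the others being replaced by `0`. -/
def masked (τ J : ℕ → Ω → ℝ) (S : Set (ℕ ⊕ ℕ)) (ω : Ω) : ℕ ⊕ ℕ → ℝ :=
  S.indicator fun i => Sum.elim τ J i ω

/-- Disjoint blocks of an independent family generate independent σ-algebras. Masking by 0 gives all
blocks one codomain, so any functional of a block is obtained by composing with a measurable map on
`ℕ ⊕ ℕ → ℝ`. -/
lemma indepFun_masked (hw : IsWalk P τ J ψ h) {S T : Set (ℕ ⊕ ℕ)} (hST : Disjoint S T) :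
    IndepFun (masked τ J S) (masked τ J T) P := by
  rw [IndepFun_iff_Indep]
  have hle : ∀ i : ℕ ⊕ ℕ, MeasurableSpace.comap (Sum.elim τ J i) inferInstance ≤ ‹_› :=
    fun i => (hw.measurable_elim i).comap_le
  have hcomap : ∀ S : Set (ℕ ⊕ ℕ), MeasurableSpace.comap (masked τ J S) MeasurableSpace.pi
      ≤ ⨆ i ∈ S, MeasurableSpace.comap (Sum.elim τ J i) inferInstance := by
    intro S
    rw [← measurable_iff_comap_le, @measurable_pi_iff]
    intro i
    by_cases hi : i ∈ S
    · have : (fun ω => masked τ J S ω i) = Sum.elim τ J i := by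
        funext ω; simp [masked, hi]
      rw [this, measurable_iff_comap_le]
      exact le_iSup₂ (f := fun i (_ : i ∈ S) =>
        MeasurableSpace.comap (Sum.elim τ J i) inferInstance) i hi
    · have : (fun ω => masked τ J S ω i) = fun _ => 0 := by
        funext ω; simp [masked, hi]
      rw [this]
      exact @measurable_const _ _ _ (_) _
  exact indep_of_indep_of_le_left (indep_of_indep_of_le_right
    (indep_iSup_of_disjoint hle hw.indep.iIndep hST) (hcomap T)) (hcomap S)

/-- The past block consists of the first `n + 1` sojourn times only. All jumps lie in the
complementary block, so the jump ending the current sojourn already counts as future. -/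
lemma indepFun_jumpTime (hw : IsWalk P τ J ψ h) (n : ℕ) :
    IndepFun (fun ω => (jumpTime τ n ω, jumpTime τ (n + 1) ω))
      (seqPair (fun k => τ (n + 1 + k)) fun k => J (n + k)) P := by
  have h1 := hw.indepFun_masked (S := Sum.inl '' Iio (n + 1)) (T := (Sum.inl '' Iio (n + 1))ᶜ)
    disjoint_compl_right
  have h2 := h1.comp
    (φ := fun x : ℕ ⊕ ℕ → ℝ => (∑ k ∈ Finset.range n, x (.inl k),
      ∑ k ∈ Finset.range (n + 1), x (.inl k)))
    (ψ := fun x : ℕ ⊕ ℕ → ℝ => ((fun k => x (.inl (n + 1 + k)), fun k => x (.inr (n + k))) :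
      (ℕ → ℝ) × (ℕ → ℝ))) (by fun_prop) (by fun_prop)
  convert! h2 using 1
  · funext ω
    simp only [Function.comp, jumpTime]
    congr 1 <;> refine Finset.sum_congr rfl fun k hk => ?_ <;>
      · have : k < n + 1 := by have := Finset.mem_range.1 hk; omega
        rw [masked, indicator_of_mem]
        · rfl
        · exact ⟨k, this, rfl⟩
  · funext ω
    have : ∀ k, n < n + 1 + k := fun k => by omega
    simp [masked, seqPair, Set.indicator, this]

lemma indepFun_jump_zero (hw : IsWalk P τ J ψ h) :
    IndepFun (J 0) (seqPair τ fun k => J (1 + k)) P := by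
  have h1 := hw.indepFun_masked (S := {Sum.inr 0}) (T := {Sum.inr 0}ᶜ) disjoint_compl_right
  have hφ : Measurable fun x : ℕ ⊕ ℕ → ℝ => x (.inr 0) := measurable_pi_apply _
  have h2 := h1.comp
    (ψ := fun x : ℕ ⊕ ℕ → ℝ => ((fun k => x (.inl k), fun k => x (.inr (1 + k))) :
      (ℕ → ℝ) × (ℕ → ℝ))) hφ (by fun_prop)
  convert! h2 using 1
  · funext ω
    simp [masked]
  · funext ω
    simp [masked, seqPair, Set.indicator]

lemma measurable_jumpTime (hw : IsWalk P τ J ψ h) (n : ℕ) : Measurable (jumpTime τ n) :=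
  Finset.measurable_sum _ fun i _ => hw.measurable_wait i

lemma ae_wait_pos (hw : IsWalk P τ J ψ h) : ∀ᵐ ω ∂P, ∀ k, 0 < τ k ω := by
  refine ae_all_iff.2 fun k => ?_
  have := hw.density_wait.ae_pos
  rw [halfLaw, ← hw.law_wait k] at this
  exact ae_of_ae_map (hw.measurable_wait k).aemeasurable this

lemma ae_jump_pos (hw : IsWalk P τ J ψ h) : ∀ᵐ ω ∂P, ∀ k, 0 < J k ω := by
  refine ae_all_iff.2 fun k => ?_
  have := hw.density_jump.ae_pos
  rw [halfLaw, ← hw.law_jump k] at this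
  exact ae_of_ae_map (hw.measurable_jump k).aemeasurable this

section AlmostSure

variable [IsProbabilityMeasure P]

/-- The Chernoff bound with exponent -1; by independence the exponential moment of `jumpTime τ n` is
an `n`-th power. -/
lemma measure_jumpTime_le (hw : IsWalk P τ J ψ h) (n : ℕ) (r : ℝ) :
    P {ω | jumpTime τ n ω ≤ r}
      ≤ ENNReal.ofReal (Real.exp r * (∫ x, Real.exp (-1 * x) ∂halfLaw ψ) ^ n) := by
  have hmgf : mgf (jumpTime τ n) P (-1) = (∫ x, Real.exp (-1 * x) ∂halfLaw ψ) ^ n := by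
    have hind := hw.indep.precomp (g := Sum.inl) Sum.inl_injective
    have hm := iIndepFun.mgf_sum (t := -1) hind hw.measurable_wait (Finset.range n)
    have h1 : ∀ i, mgf (τ i) P (-1) = ∫ x, Real.exp (-1 * x) ∂halfLaw ψ := by
      intro i
      rw [mgf, halfLaw, ← hw.law_wait i, integral_map (hw.measurable_wait i).aemeasurable
        (by fun_prop)]
    have h2 : jumpTime τ n = ∑ i ∈ Finset.range n, τ i := by
      funext ω; simp [jumpTime]
    rw [h2]
    refine hm.trans ?_
    simp [h1]
  have hint : Integrable (fun ω => Real.exp (-1 * jumpTime τ n ω)) P := by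
    refine Integrable.of_bound (by have := hw.measurable_jumpTime n; fun_prop) 1 ?_
    filter_upwards [hw.ae_wait_pos] with ω hω
    rw [Real.norm_eq_abs, abs_of_pos (Real.exp_pos _), Real.exp_le_one_iff]
    have : 0 ≤ jumpTime τ n ω := Finset.sum_nonneg fun i _ => (hω i).le
    linarith
  have := measure_le_le_exp_mul_mgf (X := jumpTime τ n) (μ := P) (t := -1) r (by norm_num) hint
  rw [hmgf, neg_neg, one_mul] at this
  rw [← ENNReal.ofReal_toReal (measure_ne_top P {ω | jumpTime τ n ω ≤ r})]
  exact ENNReal.ofReal_le_ofReal this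

/-- The bounds are geometric with ratio below one. This sum is the renewal function at `r`; its
finiteness yields divergence of the jump times by Borel–Cantelli and finite moments of the excess
life. -/
lemma tsum_measure_jumpTime_le (hw : IsWalk P τ J ψ h) (r : ℝ) :
    ∑' n, P {ω | jumpTime τ n ω ≤ r} ≠ ∞ := by
  have := hw.density_wait.isProbabilityMeasure
  set q := ∫ x, Real.exp (-1 * x) ∂halfLaw ψ
  have hq1 : q < 1 := integral_exp_neg_lt_one hw.density_wait.ae_pos one_pos
  have hq0 : 0 ≤ q := integral_nonneg fun x => (Real.exp_pos _).le
  refine ne_top_of_le_ne_top ?_ (ENNReal.tsum_le_tsum fun n => hw.measure_jumpTime_le n r)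
  exact ((summable_geometric_of_lt_one hq0 hq1).mul_left _).tsum_ofReal_ne_top

lemma ae_tendsto_jumpTime (hw : IsWalk P τ J ψ h) :
    ∀ᵐ ω ∂P, Tendsto (fun n => jumpTime τ n ω) atTop atTop := by
  have h1 : ∀ᵐ ω ∂P, ∀ N : ℕ, ∀ᶠ n in atTop, ω ∉ {ω | jumpTime τ n ω ≤ N} :=
    ae_all_iff.2 fun N => ae_eventually_notMem (hw.tsum_measure_jumpTime_le N)
  filter_upwards [h1] with ω hω
  refine tendsto_atTop.2 fun r => ?_
  obtain ⟨N, hN⟩ := exists_nat_ge r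
  filter_upwards [hω N] with n hn
  have : (N : ℝ) < jumpTime τ n ω := not_le.1 hn
  linarith

end AlmostSure

end IsWalk

/-! ### Mean passage times as extended nonnegative integrals -/

lemma measurable_seqCons {α : Type*} [MeasurableSpace α] {e : α → ℝ} {a : α → ℕ → ℝ}
    (he : Measurable e) (ha : Measurable a) : Measurable fun x => seqCons (e x) (a x) := by
  refine measurable_pi_iff.2 fun k => ?_
  cases k with
  | zero => exact he
  | succ k => exact (measurable_pi_apply k).comp ha

lemma measurable_passageTime {α : Type*} [MeasurableSpace α] (v : ℝ) {y : α → ℝ} {a c : α → ℕ → ℝ}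
    (hy : Measurable y) (ha : Measurable a) (hc : Measurable c) :
    Measurable fun x => passageTime v (y x) (a x) (c x) := by
  unfold passageTime psum
  have ha' : ∀ k, Measurable fun x => a x k := fun k => (measurable_pi_apply k).comp ha
  have hc' : ∀ k, Measurable fun x => c x k := fun k => (measurable_pi_apply k).comp hc
  refine Measurable.tsum fun k => ?_
  fun_prop

section MeanPassage

variable {Ω : Type*} [MeasurableSpace Ω]

/-- The mean passage time over the distance `y`, starting just after a jump. -/
def meanPassage (P : Measure Ω) (τ J : ℕ → Ω → ℝ) (v y : ℝ) : ℝ≥0∞ :=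
  ∫⁻ ω, passageTime v y (fun k => τ k ω) (fun k => J k ω) ∂P

/-- The mean passage time over the distance `y` when the next jump occurs after the time `e`. -/
def meanPassageFrom (P : Measure Ω) (τ J : ℕ → Ω → ℝ) (v e y : ℝ) : ℝ≥0∞ :=
  ∫⁻ ω, passageTime v y (seqCons e fun k => τ k ω) (fun k => J k ω) ∂P

variable {P : Measure Ω} {τ J : ℕ → Ω → ℝ} {ψ h : ℝ → ℝ}

namespace IsWalk

lemma measurable_wait_path (hw : IsWalk P τ J ψ h) : Measurable fun ω k => τ k ω :=
  measurable_pi_lambda _ hw.measurable_wait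

lemma measurable_jump_path (hw : IsWalk P τ J ψ h) : Measurable fun ω k => J k ω :=
  measurable_pi_lambda _ hw.measurable_jump

section

variable [SFinite P]

lemma measurable_meanPassage (hw : IsWalk P τ J ψ h) (v : ℝ) : Measurable (meanPassage P τ J v) :=
  Measurable.lintegral_prod_right' (f := fun p : ℝ × Ω =>
    passageTime v p.1 (fun k => τ k p.2) (fun k => J k p.2))
    (measurable_passageTime v measurable_fst (hw.measurable_wait_path.comp measurable_snd)
      (hw.measurable_jump_path.comp measurable_snd))

lemma measurable_meanPassageFrom (hw : IsWalk P τ J ψ h) (v : ℝ) :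
    Measurable fun p : ℝ × ℝ => meanPassageFrom P τ J v p.1 p.2 :=
  Measurable.lintegral_prod_right' (f := fun p : (ℝ × ℝ) × Ω =>
    passageTime v p.1.2 (seqCons p.1.1 fun k => τ k p.2) (fun k => J k p.2))
    (measurable_passageTime v (by fun_prop)
      (measurable_seqCons (by fun_prop) (hw.measurable_wait_path.comp measurable_snd))
      (hw.measurable_jump_path.comp measurable_snd))

end

variable [IsProbabilityMeasure P]

lemma meanPassage_le (hw : IsWalk P τ J ψ h) {v : ℝ} (hv : 0 < v) (y : ℝ) :
    meanPassage P τ J v y ≤ ENNReal.ofReal (y / v) := by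
  refine (lintegral_mono_ae (g := fun _ => ENNReal.ofReal (y / v)) ?_).trans (by simp)
  filter_upwards [hw.ae_wait_pos, hw.ae_jump_pos] with ω h1 h2
  exact passageTime_le hv y (fun k => (h1 k).le) (fun k => (h2 k).le)

lemma meanPassageFrom_le (hw : IsWalk P τ J ψ h) {v e : ℝ} (hv : 0 < v) (he : 0 ≤ e) (y : ℝ) :
    meanPassageFrom P τ J v e y ≤ ENNReal.ofReal (y / v) := by
  refine (lintegral_mono_ae (g := fun _ => ENNReal.ofReal (y / v)) ?_).trans (by simp)
  filter_upwards [hw.ae_wait_pos, hw.ae_jump_pos] with ω h1 h2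
  refine passageTime_le hv y (fun k => ?_) (fun k => (h2 k).le)
  cases k
  exacts [he, (h1 _).le]

/-- Conditioning on the first jump: the sojourn times together with the remaining jumps are
independent of it and form a walk of the same law. -/
lemma meanPassageFrom_eq (hw : IsWalk P τ J ψ h) (v e y : ℝ) :
    meanPassageFrom P τ J v e y = ENNReal.ofReal (min e (y / v))
      + ∫⁻ u, meanPassage P τ J v (y - v * e - u) ∂halfLaw h := by
  have hw' := hw.shift 0 1
  simp only [zero_add] at hw'
  have hΦ : Measurable (Function.uncurry fun (u : ℝ) (z : (ℕ → ℝ) × (ℕ → ℝ)) =>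
      passageTime v (y - v * e - u) z.1 z.2) :=
    measurable_passageTime v (by fun_prop) (by fun_prop) (by fun_prop)
  have h1 := lintegral_indepFun (hw.measurable_jump 0) hw'.measurable_seqPair
    hw.measurable_seqPair hw.indepFun_jump_zero (map_seqPair_congr hw' hw) hΦ
  unfold meanPassageFrom
  simp only [passageTime_seqCons]
  rw [lintegral_add_left measurable_const]
  congr 1
  · simp
  · rw [halfLaw, ← hw.law_jump 0, lintegral_map _ (hw.measurable_jump 0)]
    · refine Eq.trans ?_ h1
      refine lintegral_congr fun ω => ?_
      simp only [seqPair, add_comm 1]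
    · exact (hw.measurable_meanPassage v).comp (by fun_prop)

/-- The renewal property at the end of the current sojourn. The residual time `f` and the weight `g`
may depend on both ends of that sojourn: `g = 1` with the full sojourn length restarts at a jump,
while the indicator of `t_n ≤ r < t_{n+1}` with residual `t_{n+1} - r` restarts at the fixed time
`r`. -/
lemma lintegral_residual (hw : IsWalk P τ J ψ h) (v y : ℝ) (n : ℕ) {f : ℝ × ℝ → ℝ}
    (hf : Measurable f) {g : ℝ × ℝ → ℝ≥0∞} (hg : Measurable g) :
    ∫⁻ ω, g (jumpTime τ n ω, jumpTime τ (n + 1) ω) * passageTime v y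
        (seqCons (f (jumpTime τ n ω, jumpTime τ (n + 1) ω)) fun k => τ (n + 1 + k) ω)
        (fun k => J (n + k) ω) ∂P
      = ∫⁻ ω, g (jumpTime τ n ω, jumpTime τ (n + 1) ω) * meanPassageFrom P τ J v
        (f (jumpTime τ n ω, jumpTime τ (n + 1) ω)) y ∂P := by
  have hw' := hw.shift (n + 1) n
  have hΦ : Measurable (Function.uncurry fun (p : ℝ × ℝ) (z : (ℕ → ℝ) × (ℕ → ℝ)) =>
      g p * passageTime v y (seqCons (f p) z.1) z.2) :=
    (hg.comp measurable_fst).mul (measurable_passageTime v (by fun_prop)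
      (measurable_seqCons (by fun_prop) (by fun_prop)) (by fun_prop))
  have h1 := lintegral_indepFun ((hw.measurable_jumpTime n).prodMk (hw.measurable_jumpTime (n + 1)))
    hw'.measurable_seqPair hw.measurable_seqPair (hw.indepFun_jumpTime n)
    (map_seqPair_congr hw' hw) hΦ
  refine h1.trans (lintegral_congr fun ω => ?_)
  rw [lintegral_const_mul]
  · rfl
  · exact measurable_passageTime v measurable_const
      (measurable_seqCons measurable_const hw.measurable_wait_path) hw.measurable_jump_path

lemma lintegral_meanPassageFrom_wait (hw : IsWalk P τ J ψ h) (v y : ℝ) (n : ℕ) :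
    ∫⁻ ω, meanPassageFrom P τ J v (τ n ω) y ∂P
      = ∫⁻ e, meanPassageFrom P τ J v e y ∂halfLaw ψ := by
  have hm := hw.measurable_meanPassageFrom v
  rw [halfLaw, ← hw.law_wait n, lintegral_map (by fun_prop) (hw.measurable_wait n)]

lemma meanPassage_eq_lintegral (hw : IsWalk P τ J ψ h) (v y : ℝ) :
    meanPassage P τ J v y = ∫⁻ e, meanPassageFrom P τ J v e y ∂halfLaw ψ := by
  have h1 := hw.lintegral_residual v y 0 (f := fun p => p.2 - p.1) (by fun_prop) (g := 1)
    measurable_const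
  have e0 : ∀ ω, jumpTime τ (0 + 1) ω - jumpTime τ 0 ω = τ 0 ω := fun ω => by simp [jumpTime]
  simp only [e0, Pi.one_apply, one_mul] at h1
  rw [← hw.lintegral_meanPassageFrom_wait v y 0, ← h1, meanPassage]
  refine lintegral_congr fun ω => ?_
  congr 1
  · rw [← seqCons_eta fun k => τ k ω]
    congr 1
    funext k
    congr 1
    omega
  · simp

lemma ae_good (hw : IsWalk P τ J ψ h) : ∀ᵐ ω ∂P, (∀ k, 0 < τ k ω) ∧ (∀ k, 0 < J k ω) ∧
    Tendsto (fun n => jumpTime τ n ω) atTop atTop := by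
  filter_upwards [hw.ae_wait_pos, hw.ae_jump_pos, hw.ae_tendsto_jumpTime] with ω h1 h2 h3
  exact ⟨h1, h2, h3⟩

omit [IsProbabilityMeasure P] in
lemma measurable_passageTime_residual (hw : IsWalk P τ J ψ h) (v y : ℝ) (n : ℕ) {f : Ω → ℝ}
    (hf : Measurable f) : Measurable fun ω => passageTime v y
        (seqCons (f ω) fun k => τ (n + 1 + k) ω) (fun k => J (n + k) ω) :=
  measurable_passageTime v measurable_const
    (measurable_seqCons hf (hw.shift (n + 1) n).measurable_wait_path)
    (hw.shift (n + 1) n).measurable_jump_path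

/-- Transfers the extended-valued computation to the real exit time: the almost sure bound gives
integrability and makes `toReal` commute with the integral. -/
lemma integral_exit_of_ae_eq {E : Ω → ℝ} {T : Ω → ℝ≥0∞} {y v : ℝ}
    (hT : AEMeasurable T P) (hTle : ∀ᵐ ω ∂P, T ω ≤ ENNReal.ofReal (y / v))
    (hE : E =ᵐ[P] fun ω => (T ω).toReal) :
    Integrable E P ∧ ∫ ω, E ω ∂P = (∫⁻ ω, T ω ∂P).toReal := by
  have hlt : ∀ᵐ ω ∂P, T ω < ∞ := by
    filter_upwards [hTle] with ω hω
    exact hω.trans_lt ENNReal.ofReal_lt_top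
  refine ⟨(integrable_toReal_of_lintegral_ne_top hT ?_).congr hE.symm, ?_⟩
  · refine ((lintegral_mono_ae hTle).trans_lt ?_).ne
    simp
  · rw [integral_congr_ae hE, integral_toReal hT hlt]

lemma integral_exitTime_jumpTime (hw : IsWalk P τ J ψ h) {v b x : ℝ} (hv : 0 < v) (hx : 0 < x)
    (hxb : x < b) (n : ℕ) :
    Integrable (fun ω => exitTime τ J v b x (jumpTime τ n ω) ω) P ∧
      ∫ ω, exitTime τ J v b x (jumpTime τ n ω) ω ∂P = (meanPassage P τ J v (b - x)).toReal := by
  have h1 := hw.lintegral_residual v (b - x) n (f := fun p => p.2 - p.1) (by fun_prop) (g := 1)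
    measurable_const
  have e0 : ∀ ω, jumpTime τ (n + 1) ω - jumpTime τ n ω = τ n ω := fun ω => by
    simp [jumpTime, Finset.sum_range_succ]
  simp only [e0, Pi.one_apply, one_mul] at h1
  rw [hw.lintegral_meanPassageFrom_wait, ← hw.meanPassage_eq_lintegral] at h1
  rw [← h1]
  refine integral_exit_of_ae_eq (v := v) (y := b - x)
    (hw.measurable_passageTime_residual v (b - x) n (hw.measurable_wait n)).aemeasurable ?_ ?_
  · filter_upwards [hw.ae_good] with ω hω
    refine passageTime_le hv _ (fun k => ?_) (fun k => (hω.2.1 _).le)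
    cases k
    exacts [(hω.1 _).le, (hω.1 _).le]
  · filter_upwards [hw.ae_good] with ω hω
    rw [exitTime_eq_passageTime hv hx hxb hω.1 hω.2.1 hω.2.2 le_rfl
      (by linarith [e0 ω, hω.1 n]), e0]

/-- The event that the instant `r` lies between the `n`-th and the next jump time. -/
def between (τ : ℕ → Ω → ℝ) (r : ℝ) (n : ℕ) : Set Ω :=
  {ω | jumpTime τ n ω ≤ r ∧ r < jumpTime τ (n + 1) ω}

omit [MeasurableSpace Ω] in
lemma tsum_between {ω : Ω} (hτ : ∀ k, 0 < τ k ω) {r : ℝ} {n : ℕ} (hn : ω ∈ between τ r n)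
    (f : ℕ → ℝ≥0∞) : ∑' k, (between τ r k).indicator 1 ω * f k = f n := by
  rw [tsum_eq_single n]
  · simp [hn]
  · intro k hk
    rw [indicator_of_notMem, zero_mul]
    intro hkm
    exact hk ((jumpCount_eq hτ hkm.1 hkm.2).symm.trans (jumpCount_eq hτ hn.1 hn.2))

lemma integral_exitTime (hw : IsWalk P τ J ψ h) {v b x r : ℝ} (hv : 0 < v) (hx : 0 < x)
    (hxb : x < b) (hr : 0 ≤ r) :
    Integrable (exitTime τ J v b x r) P ∧ ∫ ω, exitTime τ J v b x r ω ∂P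
      = (∫⁻ ω, meanPassageFrom P τ J v (excessLife τ r ω) (b - x) ∂P).toReal := by
  have hm := hw.measurable_meanPassageFrom v
  have hmt := hw.measurable_jumpTime
  have hbm : ∀ n, Measurable ((between τ r n).indicator (1 : Ω → ℝ≥0∞)) := fun n =>
    measurable_one.indicator ((measurableSet_le (hmt n) measurable_const).inter
      (measurableSet_lt measurable_const (hmt (n + 1))))
  have hpm : ∀ n, Measurable fun ω => (between τ r n).indicator 1 ω * passageTime v (b - x)
      (seqCons (jumpTime τ (n + 1) ω - r) fun k => τ (n + 1 + k) ω) (fun k => J (n + k) ω) :=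
    fun n => (hbm n).mul (hw.measurable_passageTime_residual v (b - x) n
      ((hmt (n + 1)).sub_const r))
  -- Decompose according to the number of jumps before `r`, restart the walk on each piece, and sum
  -- again. Almost surely exactly one piece is active, and there the residual time is the excess
  -- life.
  have key : ∫⁻ ω, meanPassageFrom P τ J v (excessLife τ r ω) (b - x) ∂P
      = ∫⁻ ω, ∑' n, (between τ r n).indicator 1 ω * passageTime v (b - x)
        (seqCons (jumpTime τ (n + 1) ω - r) fun k => τ (n + 1 + k) ω) (fun k => J (n + k) ω)
        ∂P := by
    rw [lintegral_tsum fun n => (hpm n).aemeasurable]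
    have h1 : ∀ n, ∫⁻ ω, (between τ r n).indicator 1 ω * passageTime v (b - x)
        (seqCons (jumpTime τ (n + 1) ω - r) fun k => τ (n + 1 + k) ω) (fun k => J (n + k) ω) ∂P
        = ∫⁻ ω, (between τ r n).indicator 1 ω *
          meanPassageFrom P τ J v (jumpTime τ (n + 1) ω - r) (b - x) ∂P := by
      intro n
      exact hw.lintegral_residual v (b - x) n (f := fun p => p.2 - r) (by fun_prop)
        (g := ({p : ℝ × ℝ | p.1 ≤ r ∧ r < p.2}).indicator 1)
        (measurable_one.indicator ((measurableSet_le measurable_fst measurable_const).inter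
          (measurableSet_lt measurable_const measurable_snd)))
    simp only [h1]
    rw [← lintegral_tsum]
    · refine lintegral_congr_ae ?_
      filter_upwards [hw.ae_good] with ω hω
      obtain ⟨n, hn⟩ := exists_jumpTime_le_lt hω.2.2 hr
      rw [excessLife_eq hω.1 hn.1 hn.2]
      exact (tsum_between hω.1 hn
        fun n => meanPassageFrom P τ J v (jumpTime τ (n + 1) ω - r) (b - x)).symm
    · intro n
      exact ((hbm n).mul (hm.comp (((hmt (n + 1)).sub_const r).prodMk
        measurable_const))).aemeasurable
  rw [key]
  have hT : ∀ᵐ ω ∂P, ∃ n, ω ∈ between τ r n ∧ (∑' n, (between τ r n).indicator 1 ω *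
      passageTime v (b - x) (seqCons (jumpTime τ (n + 1) ω - r) fun k => τ (n + 1 + k) ω)
        (fun k => J (n + k) ω)) = passageTime v (b - x)
        (seqCons (jumpTime τ (n + 1) ω - r) fun k => τ (n + 1 + k) ω) (fun k => J (n + k) ω) := by
    filter_upwards [hw.ae_good] with ω hω
    obtain ⟨n, hn⟩ := exists_jumpTime_le_lt hω.2.2 hr
    exact ⟨n, hn, tsum_between hω.1 hn fun n => passageTime v (b - x)
        (seqCons (jumpTime τ (n + 1) ω - r) fun k => τ (n + 1 + k) ω) (fun k => J (n + k) ω)⟩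
  refine integral_exit_of_ae_eq (v := v) (y := b - x)
    (Measurable.tsum hpm).aemeasurable ?_ ?_
  · filter_upwards [hw.ae_good, hT] with ω hω ⟨n, hn, hs⟩
    rw [hs]
    refine passageTime_le hv _ (fun k => ?_) (fun k => (hω.2.1 _).le)
    cases k
    exacts [sub_nonneg.2 hn.2.le, (hω.1 _).le]
  · filter_upwards [hw.ae_good, hT] with ω hω ⟨n, hn, hs⟩
    rw [hs, exitTime_eq_passageTime hv hx hxb hω.1 hω.2.1 hω.2.2 hn.1 hn.2]

end IsWalk

end MeanPassage

/-! ### Real-valued means and the integral equation -/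

section RealMeans

variable {Ω : Type*} [MeasurableSpace Ω]

/-- The mean passage time over the distance `y` starting just after a jump, as a real number. -/
def passageMean (P : Measure Ω) (τ J : ℕ → Ω → ℝ) (v y : ℝ) : ℝ := (meanPassage P τ J v y).toReal

/-- The mean passage time over the distance `y` when the next jump occurs after the time `e`, as a
real number. -/
def passageMeanFrom (P : Measure Ω) (τ J : ℕ → Ω → ℝ) (v e y : ℝ) : ℝ :=
  (meanPassageFrom P τ J v e y).toReal

/-- The mean passage time over the distance `y` when the time until the next jump has law `κ`. -/
def passageMeanLaw (P : Measure Ω) (τ J : ℕ → Ω → ℝ) (v : ℝ) (κ : Measure ℝ) (y : ℝ) : ℝ :=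
  ∫ e, passageMeanFrom P τ J v e y ∂κ

variable {P : Measure Ω} {τ J : ℕ → Ω → ℝ} {ψ h : ℝ → ℝ} {v : ℝ}

lemma passageMean_nonneg (y : ℝ) : 0 ≤ passageMean P τ J v y := ENNReal.toReal_nonneg

lemma passageMeanFrom_nonneg (e y : ℝ) : 0 ≤ passageMeanFrom P τ J v e y := ENNReal.toReal_nonneg

variable [IsProbabilityMeasure P]

namespace IsWalk

lemma measurable_passageMean (hw : IsWalk P τ J ψ h) (v : ℝ) :
    Measurable (passageMean P τ J v) := (hw.measurable_meanPassage v).ennreal_toReal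

lemma measurable_passageMeanFrom (hw : IsWalk P τ J ψ h) (v : ℝ) :
    Measurable fun p : ℝ × ℝ => passageMeanFrom P τ J v p.1 p.2 :=
  (hw.measurable_meanPassageFrom v).ennreal_toReal

lemma measurable_passageMeanLaw (hw : IsWalk P τ J ψ h) (v : ℝ) (κ : Measure ℝ) [SFinite κ] :
    Measurable (passageMeanLaw P τ J v κ) :=
  ((hw.measurable_passageMeanFrom v).comp measurable_swap).stronglyMeasurable.integral_prod_right'
    |>.measurable

lemma passageMean_le (hw : IsWalk P τ J ψ h) (hv : 0 < v) {y : ℝ} (hy : 0 ≤ y) :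
    passageMean P τ J v y ≤ y / v := by
  have := ENNReal.toReal_mono ENNReal.ofReal_ne_top (hw.meanPassage_le hv y)
  rwa [ENNReal.toReal_ofReal (div_nonneg hy hv.le)] at this

lemma passageMean_of_nonpos (hw : IsWalk P τ J ψ h) (hv : 0 < v) {y : ℝ} (hy : y ≤ 0) :
    passageMean P τ J v y = 0 := by
  have := hw.meanPassage_le hv y
  rw [ENNReal.ofReal_of_nonpos (div_nonpos_of_nonpos_of_nonneg hy hv.le)] at this
  rw [passageMean, nonpos_iff_eq_zero.1 this, ENNReal.toReal_zero]

lemma passageMean_le_max (hw : IsWalk P τ J ψ h) (hv : 0 < v) (y : ℝ) :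
    passageMean P τ J v y ≤ max y 0 / v := by
  rcases le_total y 0 with hy | hy
  · rw [hw.passageMean_of_nonpos hv hy]; positivity
  · rw [max_eq_left hy]; exact hw.passageMean_le hv hy

lemma passageMeanFrom_le (hw : IsWalk P τ J ψ h) (hv : 0 < v) {e y : ℝ} (he : 0 ≤ e)
    (hy : 0 ≤ y) : passageMeanFrom P τ J v e y ≤ y / v := by
  have := ENNReal.toReal_mono ENNReal.ofReal_ne_top (hw.meanPassageFrom_le hv he y)
  rwa [ENNReal.toReal_ofReal (div_nonneg hy hv.le)] at this

lemma integrable_passageMean_sub (hw : IsWalk P τ J ψ h) (hv : 0 < v) {η : Measure ℝ}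
    [IsFiniteMeasure η] (hη : ∀ᵐ w ∂η, 0 ≤ w) (z : ℝ) :
    Integrable (fun w => passageMean P τ J v (z - w)) η := by
  have hm := hw.measurable_passageMean v
  refine Integrable.of_bound (hm.comp (by fun_prop)).aestronglyMeasurable (max z 0 / v) ?_
  filter_upwards [hη] with w hw0
  rw [Real.norm_eq_abs, abs_of_nonneg (passageMean_nonneg _)]
  refine (hw.passageMean_le_max hv _).trans ?_
  gcongr
  linarith

lemma passageMeanFrom_eq (hw : IsWalk P τ J ψ h) (hv : 0 < v) {e y : ℝ} (he : 0 ≤ e)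
    (hy : 0 ≤ y) : passageMeanFrom P τ J v e y = min e (y / v)
      + ∫ u, passageMean P τ J v (y - v * e - u) ∂halfLaw h := by
  have := hw.density_jump.isProbabilityMeasure
  have hm := hw.measurable_meanPassage v
  have hlt : ∀ z, meanPassage P τ J v z < ∞ := fun z =>
    (hw.meanPassage_le hv z).trans_lt ENNReal.ofReal_lt_top
  have h1 := hw.meanPassageFrom_eq v e y
  have hfin : ∫⁻ u, meanPassage P τ J v (y - v * e - u) ∂halfLaw h ≠ ∞ := by
    refine ne_top_of_le_ne_top ?_ (le_add_self.trans (h1.symm.le))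
    exact ((hw.meanPassageFrom_le hv he y).trans_lt ENNReal.ofReal_lt_top).ne
  rw [passageMeanFrom, h1, ENNReal.toReal_add ENNReal.ofReal_ne_top hfin,
    ENNReal.toReal_ofReal (le_min he (div_nonneg hy hv.le))]
  congr 1
  exact (integral_toReal (by fun_prop) (ae_of_all _ fun u => hlt _)).symm

lemma integrable_passageMeanFrom (hw : IsWalk P τ J ψ h) (hv : 0 < v) {κ : Measure ℝ}
    [IsFiniteMeasure κ] (hκ : ∀ᵐ e ∂κ, 0 ≤ e) {y : ℝ} (hy : 0 ≤ y) :
    Integrable (fun e => passageMeanFrom P τ J v e y) κ := by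
  have hm := hw.measurable_passageMeanFrom v
  refine Integrable.of_bound (by fun_prop) (y / v) ?_
  filter_upwards [hκ] with e he
  rw [Real.norm_eq_abs, abs_of_nonneg (passageMeanFrom_nonneg _ _)]
  exact hw.passageMeanFrom_le hv he hy

omit [IsProbabilityMeasure P] in
lemma passageMeanLaw_nonneg (κ : Measure ℝ) (y : ℝ) : 0 ≤ passageMeanLaw P τ J v κ y :=
  integral_nonneg fun _ => passageMeanFrom_nonneg _ _

lemma passageMeanLaw_le (hw : IsWalk P τ J ψ h) (hv : 0 < v) {κ : Measure ℝ}
    [IsProbabilityMeasure κ] (hκ : ∀ᵐ e ∂κ, 0 ≤ e) {y : ℝ} (hy : 0 ≤ y) :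
    passageMeanLaw P τ J v κ y ≤ y / v := by
  refine (integral_mono_ae (hw.integrable_passageMeanFrom hv hκ hy)
    (integrable_const (y / v)) ?_).trans (by simp)
  filter_upwards [hκ] with e he using hw.passageMeanFrom_le hv he hy

lemma toReal_lintegral_meanPassageFrom (hw : IsWalk P τ J ψ h) (hv : 0 < v) {κ : Measure ℝ}
    (hκ : ∀ᵐ e ∂κ, 0 ≤ e) (y : ℝ) :
    (∫⁻ e, meanPassageFrom P τ J v e y ∂κ).toReal = passageMeanLaw P τ J v κ y := by
  have hm := hw.measurable_meanPassageFrom v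
  refine (integral_toReal (by fun_prop) ?_).symm
  filter_upwards [hκ] with e he
  exact (hw.meanPassageFrom_le hv he y).trans_lt ENNReal.ofReal_lt_top

lemma passageMean_eq_passageMeanLaw (hw : IsWalk P τ J ψ h) (hv : 0 < v) (y : ℝ) :
    passageMean P τ J v y = passageMeanLaw P τ J v (halfLaw ψ) y := by
  rw [passageMean, hw.meanPassage_eq_lintegral, hw.toReal_lintegral_meanPassageFrom hv]
  filter_upwards [hw.density_wait.ae_pos] with e he using he.le

/-- The mean over the next jump of the remaining mean passage time. -/
def jumpMean (P : Measure Ω) (τ J : ℕ → Ω → ℝ) (h : ℝ → ℝ) (v z : ℝ) : ℝ :=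
  ∫ u, passageMean P τ J v (z - u) ∂halfLaw h

omit [IsProbabilityMeasure P] in
lemma jumpMean_nonneg (z : ℝ) : 0 ≤ jumpMean P τ J h v z :=
  integral_nonneg fun _ => passageMean_nonneg _

lemma measurable_jumpMean (hw : IsWalk P τ J ψ h) (v : ℝ) : Measurable (jumpMean P τ J h v) := by
  have := hw.density_jump.isProbabilityMeasure
  have hm : Measurable fun p : ℝ × ℝ => passageMean P τ J v (p.1 - p.2) :=
    (hw.measurable_passageMean v).comp (by fun_prop)
  exact hm.stronglyMeasurable.integral_prod_right'.measurable

lemma jumpMean_of_nonpos (hw : IsWalk P τ J ψ h) (hv : 0 < v) {z : ℝ} (hz : z ≤ 0) :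
    jumpMean P τ J h v z = 0 := by
  refine integral_eq_zero_of_ae ?_
  filter_upwards [hw.density_jump.ae_pos] with u hu
  exact hw.passageMean_of_nonpos hv (by linarith)

lemma jumpMean_le (hw : IsWalk P τ J ψ h) (hv : 0 < v) (z : ℝ) :
    jumpMean P τ J h v z ≤ max z 0 / v := by
  have := hw.density_jump.isProbabilityMeasure
  have h0 : ∀ᵐ u ∂halfLaw h, 0 ≤ u := hw.density_jump.ae_pos.mono fun _ => le_of_lt
  refine (integral_mono_ae (hw.integrable_passageMean_sub hv h0 z)
    (integrable_const (max z 0 / v)) ?_).trans (by simp)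
  filter_upwards [h0] with u hu
  refine (hw.passageMean_le_max hv _).trans ?_
  gcongr
  linarith

lemma integral_halfLaw {φ : ℝ → ℝ} (hφ : Measurable φ) (hφ0 : ∀ t, 0 ≤ φ t) {E : Type*}
    [NormedAddCommGroup E] [NormedSpace ℝ E] (f : ℝ → E) :
    ∫ t, f t ∂halfLaw φ = ∫ t, φ t • f t := by
  rw [halfLaw, integral_withDensity_eq_integral_toReal_smul (by fun_prop) (by simp)]
  refine integral_congr_ae (ae_of_all _ fun t => ?_)
  simp only [ENNReal.toReal_ofReal (hφ0 t)]

lemma jumpMean_eq (hw : IsWalk P τ J ψ h) (hv : 0 < v) {z : ℝ} (hz : 0 ≤ z) :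
    jumpMean P τ J h v z = ∫ u in (0 : ℝ)..z, h u * passageMean P τ J v (z - u) := by
  rw [jumpMean, integral_halfLaw hw.density_jump.measurable hw.density_jump.nonneg,
    intervalIntegral.integral_of_le hz, ← integral_Icc_eq_integral_Ioc]
  refine (setIntegral_eq_integral_of_forall_compl_eq_zero fun u hu => ?_).symm
  rcases lt_or_ge u 0 with h0 | h0
  · simp [hw.density_jump.eq_zero_of_neg u h0]
  · have : z < u := by
      by_contra hcon
      exact hu ⟨h0, not_lt.1 hcon⟩
    rw [hw.passageMean_of_nonpos hv (by linarith), smul_zero]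

lemma integrable_jumpMean_sub (hw : IsWalk P τ J ψ h) (hv : 0 < v) {κ : Measure ℝ}
    [IsFiniteMeasure κ] (hκ : ∀ᵐ e ∂κ, 0 ≤ e) (y : ℝ) :
    Integrable (fun e => jumpMean P τ J h v (y - v * e)) κ := by
  have hm := hw.measurable_jumpMean v
  refine Integrable.of_bound (hm.comp (by fun_prop)).aestronglyMeasurable (max y 0 / v) ?_
  filter_upwards [hκ] with e he
  rw [Real.norm_eq_abs, abs_of_nonneg (jumpMean_nonneg _)]
  refine (hw.jumpMean_le hv _).trans ?_
  gcongr
  have := mul_nonneg hv.le he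
  linarith

omit [IsProbabilityMeasure P] in
lemma integrable_min {κ : Measure ℝ} [IsFiniteMeasure κ] (hκ : ∀ᵐ e ∂κ, 0 ≤ e) {c : ℝ}
    (hc : 0 ≤ c) : Integrable (fun e => min e c) κ := by
  refine Integrable.of_bound (by fun_prop) c ?_
  filter_upwards [hκ] with e he
  rw [Real.norm_eq_abs, abs_of_nonneg (le_min he hc)]
  exact min_le_right _ _

lemma passageMeanLaw_eq (hw : IsWalk P τ J ψ h) (hv : 0 < v) {κ : Measure ℝ}
    [IsFiniteMeasure κ] (hκ : ∀ᵐ e ∂κ, 0 ≤ e) {y : ℝ} (hy : 0 ≤ y) :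
    passageMeanLaw P τ J v κ y
      = ∫ e, min e (y / v) ∂κ + ∫ e, jumpMean P τ J h v (y - v * e) ∂κ := by
  rw [← integral_add (integrable_min hκ (div_nonneg hy hv.le))
    (hw.integrable_jumpMean_sub hv hκ y)]
  refine integral_congr_ae ?_
  filter_upwards [hκ] with e he using hw.passageMeanFrom_eq hv he hy

end IsWalk

/-- The layer-cake formula. Absolute continuity rules out atoms, so the closed tail that appears
there may be replaced by the open one. -/
lemma integral_min_eq_intervalIntegral {κ : Measure ℝ} [IsProbabilityMeasure κ]
    (hκ : ∀ᵐ e ∂κ, 0 ≤ e) {c : ℝ} (hc : 0 ≤ c) {Φ : ℝ → ℝ}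
    (hΦ : ∀ l, 0 ≤ l → Φ l = κ.real (Iic l)) (hac : κ ≪ volume) :
    ∫ e, min e c ∂κ = ∫ l in (0 : ℝ)..c, (1 - Φ l) := by
  have h1 := (IsWalk.integrable_min hκ hc).integral_eq_integral_Ioc_meas_le (M := c)
    (by filter_upwards [hκ] with e he using le_min he hc)
    (ae_of_all _ fun e => min_le_right _ _)
  rw [h1, intervalIntegral.integral_of_le hc]
  refine setIntegral_congr_fun measurableSet_Ioc fun l hl => ?_
  have e1 : {a : ℝ | l ≤ min a c} = Ici l := by
    ext a; simp [hl.2]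
  rw [e1, hΦ l hl.1.le, ← probReal_compl_eq_one_sub measurableSet_Iic, compl_Iic]
  refine measureReal_congr ?_
  have : NullSingletonClass κ := ⟨fun x => hac (measure_singleton x)⟩
  exact Ioi_ae_eq_Ici.symm

namespace IsWalk

/-- The passage mean for a residual time with density `φ`, by quadratures. -/
lemma passageMeanLaw_eq_quadrature (hw : IsWalk P τ J ψ h) (hv : 0 < v) {φ : ℝ → ℝ}
    (hφ : Measurable φ) (hφ0 : ∀ t, 0 ≤ φ t) [IsProbabilityMeasure (halfLaw φ)]
    (hκ : ∀ᵐ e ∂halfLaw φ, 0 < e) {Φ : ℝ → ℝ}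
    (hΦ : ∀ l, 0 ≤ l → Φ l = (halfLaw φ).real (Iic l)) {y : ℝ} (hy : 0 ≤ y) :
    passageMeanLaw P τ J v (halfLaw φ) y = (∫ l in (0 : ℝ)..(y / v), (1 - Φ l))
      + (1 / v) * ∫ z in (0 : ℝ)..y,
        φ ((y - z) / v) * ∫ u in (0 : ℝ)..z, h u * passageMean P τ J v (z - u) := by
  have hκ0 : ∀ᵐ e ∂halfLaw φ, 0 ≤ e := hκ.mono fun _ => le_of_lt
  have hyv := div_nonneg hy hv.le
  rw [hw.passageMeanLaw_eq hv hκ0 hy, integral_min_eq_intervalIntegral hκ0 hyv hΦ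
    (IsHalfLineDensity.absolutelyContinuous φ)]
  congr 1
  -- For `e > y / v` the drift has carried the walk past the level before the next jump and nothing
  -- remains to be travelled, so the integral stops at `y / v`. The substitution `z = y - v * e`
  -- follows.
  have e1 : ∫ e, jumpMean P τ J h v (y - v * e) ∂halfLaw φ
      = ∫ e in (0 : ℝ)..(y / v), φ e * jumpMean P τ J h v (y - v * e) := by
    rw [integral_halfLaw hφ hφ0, intervalIntegral.integral_of_le hyv]
    refine (setIntegral_eq_integral_of_ae_compl_eq_zero ?_).symm
    have hneg : ∀ᵐ e : ℝ, ENNReal.ofReal (φ e) ≠ 0 → 0 < e := by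
      rwa [halfLaw, ae_withDensity_iff (by fun_prop)] at hκ
    filter_upwards [hneg] with e he hnot
    rcases eq_or_ne (φ e) 0 with h0 | h0
    · simp [h0]
    · have hpos : 0 < e := he (by simpa using lt_of_le_of_ne (hφ0 e) (Ne.symm h0))
      have : y / v < e := by
        by_contra hcon
        exact hnot ⟨hpos, not_lt.1 hcon⟩
      rw [div_lt_iff₀' hv] at this
      rw [hw.jumpMean_of_nonpos hv (by linarith), smul_zero]
  have e2 := intervalIntegral.integral_comp_sub_mul (a := 0) (b := y / v)
    (fun z => φ ((y - z) / v) * jumpMean P τ J h v z) hv.ne' y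
  have e3 : ∀ e, (y - (y - v * e)) / v = e := fun e => by field_simp; ring
  have e4 : y - v * (y / v) = 0 := by field_simp; ring
  simp only [e3, e4, mul_zero, sub_zero] at e2
  rw [e1, e2, smul_eq_mul, one_div]
  congr 1
  refine intervalIntegral.integral_congr fun z hz => ?_
  rw [uIcc_of_le hy] at hz
  simp only [hw.jumpMean_eq hv hz.1]

lemma waitCdf_eq {ψ : ℝ → ℝ} (hψ : IsHalfLineDensity ψ) {l : ℝ} (hl : 0 ≤ l) :
    waitCdf ψ l = (halfLaw ψ).real (Iic l) := by
  rw [waitCdf, intervalIntegral.integral_of_le hl, measureReal_def, halfLaw,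
    withDensity_apply _ measurableSet_Iic, ← integral_Icc_eq_integral_Ioc,
    integral_eq_lintegral_of_nonneg_ae (ae_of_all _ hψ.nonneg)
      hψ.measurable.aestronglyMeasurable]
  congr 1
  rw [← lintegral_indicator measurableSet_Icc, ← lintegral_indicator measurableSet_Iic]
  refine lintegral_congr fun t => ?_
  rcases lt_or_ge t 0 with ht | ht
  · simp [Set.indicator, hψ.eq_zero_of_neg t ht]
  · simp [Set.indicator, ht]

lemma solvesRenewal_passageMean (hw : IsWalk P τ J ψ h) (hv : 0 < v) :
    SolvesRenewal ψ h v (passageMean P τ J v) where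
  locInt Y := by
    refine IntegrableOn.of_bound (by simp) (hw.measurable_passageMean v).aestronglyMeasurable
      (max Y 0 / v) ?_
    filter_upwards [ae_restrict_mem measurableSet_Icc] with y hy
    rw [Real.norm_eq_abs, abs_of_nonneg (passageMean_nonneg _)]
    refine (hw.passageMean_le_max hv _).trans ?_
    gcongr
    exact hy.2
  eqn y hy := by
    have := hw.density_wait.isProbabilityMeasure
    rw [hw.passageMean_eq_passageMeanLaw hv]
    exact hw.passageMeanLaw_eq_quadrature hv hw.density_wait.measurable hw.density_wait.nonneg
      hw.density_wait.ae_pos (fun l hl => waitCdf_eq hw.density_wait hl) hy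

end IsWalk

end RealMeans

/-! ### Laplace transforms of the mean passage times -/

/-- The Laplace–Stieltjes transform of a measure on the line. -/
def lawLaplace (κ : Measure ℝ) (s : ℂ) : ℂ := ∫ e, Complex.exp (-s * (e : ℂ)) ∂κ

lemma norm_exp_neg_mul (s : ℂ) (y : ℝ) : ‖Complex.exp (-s * (y : ℂ))‖ = Real.exp (-s.re * y) := by
  rw [Complex.norm_exp]; simp

lemma integrable_cexp_neg {κ : Measure ℝ} [IsFiniteMeasure κ] (hκ : ∀ᵐ x ∂κ, 0 ≤ x) {s : ℂ}
    (hs : 0 ≤ s.re) : Integrable (fun x : ℝ => Complex.exp (-s * (x : ℂ))) κ := by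
  refine Integrable.of_bound (by fun_prop) 1 ?_
  filter_upwards [hκ] with x hx
  rw [norm_exp_neg_mul, Real.exp_le_one_iff]
  nlinarith

lemma norm_lawLaplace_le {κ : Measure ℝ} [IsProbabilityMeasure κ] (hκ : ∀ᵐ x ∂κ, 0 < x) {s : ℂ}
    (hs : 0 ≤ s.re) : ‖lawLaplace κ s‖ ≤ 1 := by
  refine (norm_integral_le_of_norm_le_const (C := 1) ?_).trans (by simp)
  filter_upwards [hκ] with x hx
  rw [norm_exp_neg_mul, Real.exp_le_one_iff]
  nlinarith

lemma norm_lawLaplace_lt_one {κ : Measure ℝ} [IsProbabilityMeasure κ] (hκ : ∀ᵐ x ∂κ, 0 < x)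
    {s : ℂ} (hs : 0 < s.re) : ‖lawLaplace κ s‖ < 1 := by
  refine (norm_integral_le_integral_norm _).trans_lt ?_
  simp only [norm_exp_neg_mul]
  exact integral_exp_neg_lt_one hκ hs

lemma laplace_eq_lawLaplace {φ : ℝ → ℝ} (hφ : Measurable φ) (hφ0 : ∀ t, 0 ≤ φ t)
    (hκ : ∀ᵐ e ∂halfLaw φ, 0 < e) (s : ℂ) : laplace φ s = lawLaplace (halfLaw φ) s := by
  rw [lawLaplace, IsWalk.integral_halfLaw hφ hφ0, laplace]
  rw [setIntegral_eq_integral_of_ae_compl_eq_zero]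
  · simp
  · rw [halfLaw, ae_withDensity_iff (by fun_prop)] at hκ
    filter_upwards [hκ] with e he hnot
    rcases eq_or_ne (φ e) 0 with h0 | h0
    · simp [h0]
    · exact absurd (he (by simpa using lt_of_le_of_ne (hφ0 e) (Ne.symm h0))) hnot

lemma integrableOn_mul_exp_neg {σ : ℝ} (hσ : 0 < σ) (v : ℝ) :
    IntegrableOn (fun y => y / v * Real.exp (-σ * y)) (Ioi 0) := by
  have h := integrableOn_rpow_mul_exp_neg_mul_rpow (p := 1) (s := 1) (b := σ) (by norm_num)
    one_pos hσ
  simp only [Real.rpow_one] at h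
  refine (h.div_const v).congr (ae_of_all _ fun y => ?_)
  simp only
  ring

lemma laplaceConverges_of_abs_le {g : ℝ → ℝ} {s : ℂ} (hs : 0 < s.re) {v : ℝ}
    (hg : AEStronglyMeasurable g (volume.restrict (Ioi 0)))
    (hle : ∀ᵐ y ∂volume.restrict (Ioi 0), |g y| ≤ y / v) : LaplaceConverges g s := by
  refine (integrableOn_mul_exp_neg hs v).mono' ?_ ?_
  · exact (Complex.continuous_ofReal.comp_aestronglyMeasurable hg).mul (by fun_prop)
  · filter_upwards [hle] with y hy
    rw [norm_mul, norm_exp_neg_mul, Complex.norm_real, Real.norm_eq_abs]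
    gcongr

/-- Fubini, with the linear bound `y / v` times the decaying exponential as an integrable majorant
that is uniform in the parameter. -/
lemma laplace_integral {κ : Measure ℝ} [IsFiniteMeasure κ] {G : ℝ → ℝ → ℝ}
    (hG : Measurable (Function.uncurry G)) {v : ℝ}
    (hle : ∀ᵐ e ∂κ, ∀ y, 0 < y → |G e y| ≤ y / v) {s : ℂ} (hs : 0 < s.re) :
    laplace (fun y => ∫ e, G e y ∂κ) s = ∫ e, laplace (G e) s ∂κ := by
  unfold laplace
  rw [← integral_integral_swap]
  · refine integral_congr_ae (ae_of_all _ fun y => ?_)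
    simp only
    rw [← integral_complex_ofReal, ← integral_mul_const]
  · have hm : Measurable fun p : ℝ × ℝ => G p.2 p.1 := hG.comp measurable_swap
    refine ((integrableOn_mul_exp_neg hs v).comp_fst κ).mono' ?_ ?_
    · have : Measurable fun p : ℝ × ℝ => (G p.2 p.1 : ℂ) := Complex.measurable_ofReal.comp hm
      exact (this.mul (by fun_prop)).aestronglyMeasurable
    · have h1 : ∀ᵐ p ∂(volume.restrict (Ioi (0 : ℝ))).prod κ, 0 < p.1 :=
        Measure.quasiMeasurePreserving_fst.ae (ae_restrict_mem measurableSet_Ioi)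
      have h2 := Measure.quasiMeasurePreserving_snd (μ := volume.restrict (Ioi (0 : ℝ))).ae hle
      filter_upwards [h1, h2] with p hp1 hp2
      rw [Function.uncurry, norm_mul, norm_exp_neg_mul, Complex.norm_real, Real.norm_eq_abs]
      gcongr
      exact hp2 _ hp1

/-- Since `g` vanishes on the negative axis, both transforms are integrals over the whole line,
where translation invariance applies. -/
lemma laplace_comp_sub {g : ℝ → ℝ} (hg : ∀ z, z ≤ 0 → g z = 0) {w : ℝ} (hw : 0 ≤ w) (s : ℂ) :
    laplace (fun y => g (y - w)) s = Complex.exp (-s * (w : ℂ)) * laplace g s := by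
  have key : ∀ {f : ℝ → ℝ}, (∀ z, z ≤ 0 → f z = 0) →
      laplace f s = ∫ y : ℝ, (f y : ℂ) * Complex.exp (-s * (y : ℂ)) := fun hf =>
    setIntegral_eq_integral_of_forall_compl_eq_zero fun y hy => by
      rw [hf y (not_lt.1 hy)]; simp
  rw [key hg, key fun z hz => hg _ (by linarith), ← integral_const_mul,
    ← integral_sub_right_eq_self
      (fun y => Complex.exp (-s * (w : ℂ)) * ((g y : ℂ) * Complex.exp (-s * (y : ℂ)))) w]
  refine integral_congr_ae (ae_of_all _ fun y => ?_)
  simp only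
  rw [mul_left_comm, ← Complex.exp_add]
  congr 2
  push_cast
  ring

lemma laplace_min {v e : ℝ} (hv : 0 < v) (he : 0 ≤ e) {s : ℂ} (hs : 0 < s.re) :
    laplace (fun y => min e (y / v)) s = (1 - Complex.exp (-(s * v) * (e : ℂ))) / (v * s ^ 2) := by
  have hs0 : s ≠ 0 := fun h => by simp [h] at hs
  have hvc : (v : ℂ) ≠ 0 := by exact_mod_cast hv.ne'
  have hconv : LaplaceConverges (fun y => min e (y / v)) s := by
    refine laplaceConverges_of_abs_le (v := v) hs (by fun_prop) ?_
    filter_upwards [ae_restrict_mem measurableSet_Ioi] with y hy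
    rw [abs_of_nonneg (le_min he (div_nonneg (le_of_lt hy) hv.le))]
    exact min_le_right _ _
  have hev := mul_nonneg hv.le he
  -- The minimum changes branch at `y = v * e`: linear before, constant after.
  have hsplit : Ioi (0 : ℝ) = Ioc 0 (v * e) ∪ Ioi (v * e) := (Ioc_union_Ioi_eq_Ioi hev).symm
  rw [LaplaceConverges, hsplit, integrableOn_union] at hconv
  rw [laplace, hsplit, setIntegral_union (by simp) measurableSet_Ioi hconv.1 hconv.2]
  have e1 : ∫ y in Ioc 0 (v * e), ((min e (y / v) : ℝ) : ℂ) * Complex.exp (-s * (y : ℂ))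
      = 1 / (v * s ^ 2) - (e / s + 1 / (v * s ^ 2)) * Complex.exp (-s * ((v * e : ℝ) : ℂ)) := by
    have hder : ∀ y : ℝ, HasDerivAt
        (fun y : ℝ => -((y : ℂ) / (v * s) + 1 / (v * s ^ 2)) * Complex.exp (-s * (y : ℂ)))
        ((y : ℂ) / v * Complex.exp (-s * (y : ℂ))) y := by
      intro y
      have h0 : HasDerivAt (fun y : ℝ => (y : ℂ)) 1 y := Complex.ofRealCLM.hasDerivAt
      have h1 := ((h0.div_const ((v : ℂ) * s)).add_const (1 / ((v : ℂ) * s ^ 2))).fun_neg.fun_mul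
        (h0.const_mul (-s)).cexp
      convert! h1 using 1
      field_simp
      ring
    have h2 := intervalIntegral.integral_eq_sub_of_hasDerivAt (a := 0) (b := v * e)
      (fun y _ => hder y) (Continuous.intervalIntegrable (by fun_prop) _ _)
    rw [intervalIntegral.integral_of_le hev] at h2
    have h3 : ∫ y in Ioc 0 (v * e), ((min e (y / v) : ℝ) : ℂ) * Complex.exp (-s * (y : ℂ))
        = ∫ y in Ioc 0 (v * e), (y : ℂ) / v * Complex.exp (-s * (y : ℂ)) := by
      refine setIntegral_congr_fun measurableSet_Ioc fun y hy => ?_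
      have : y / v ≤ e := by rw [div_le_iff₀' hv]; exact hy.2
      simp only [min_eq_right this, Complex.ofReal_div]
    rw [h3, h2]
    push_cast
    simp only [mul_zero, Complex.exp_zero]
    field_simp
    ring
  have e2 : ∫ y in Ioi (v * e), ((min e (y / v) : ℝ) : ℂ) * Complex.exp (-s * (y : ℂ))
      = e / s * Complex.exp (-s * ((v * e : ℝ) : ℂ)) := by
    have h1 : ∫ y in Ioi (v * e), ((min e (y / v) : ℝ) : ℂ) * Complex.exp (-s * (y : ℂ))
        = ∫ y in Ioi (v * e), (e : ℂ) * Complex.exp (-s * (y : ℂ)) := by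
      refine setIntegral_congr_fun measurableSet_Ioi fun y hy => ?_
      have : e ≤ y / v := by rw [le_div_iff₀' hv]; exact le_of_lt hy
      simp only [min_eq_left this]
    rw [h1, integral_const_mul, integral_exp_mul_complex_Ioi (by simpa using hs)]
    field_simp
  rw [e1, e2]
  push_cast
  rw [show -(s * v) * (e : ℂ) = -s * (v * e) by ring]
  field_simp
  ring

section

variable {Ω : Type*} [MeasurableSpace Ω] {P : Measure Ω} [IsProbabilityMeasure P]
  {τ J : ℕ → Ω → ℝ} {ψ h : ℝ → ℝ} {v : ℝ}

namespace IsWalk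

omit [IsProbabilityMeasure P] in
lemma laplace_jump (hw : IsWalk P τ J ψ h) (s : ℂ) : laplace h s = lawLaplace (halfLaw h) s :=
  laplace_eq_lawLaplace hw.density_jump.measurable hw.density_jump.nonneg hw.density_jump.ae_pos s

omit [IsProbabilityMeasure P] in
lemma laplace_wait (hw : IsWalk P τ J ψ h) (s : ℂ) : laplace ψ s = lawLaplace (halfLaw ψ) s :=
  laplace_eq_lawLaplace hw.density_wait.measurable hw.density_wait.nonneg hw.density_wait.ae_pos s

lemma laplaceConverges_passageMeanLaw (hw : IsWalk P τ J ψ h) (hv : 0 < v) {κ : Measure ℝ}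
    [IsProbabilityMeasure κ] (hκ : ∀ᵐ e ∂κ, 0 ≤ e) {s : ℂ} (hs : 0 < s.re) :
    LaplaceConverges (passageMeanLaw P τ J v κ) s := by
  refine laplaceConverges_of_abs_le (v := v) hs
    (hw.measurable_passageMeanLaw v κ).aestronglyMeasurable ?_
  filter_upwards [ae_restrict_mem measurableSet_Ioi] with y hy
  rw [abs_of_nonneg (passageMeanLaw_nonneg _ _)]
  exact hw.passageMeanLaw_le hv hκ (le_of_lt hy)

lemma laplace_jumpMean (hw : IsWalk P τ J ψ h) (hv : 0 < v) {s : ℂ} (hs : 0 < s.re) :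
    laplace (jumpMean P τ J h v) s = laplace h s * laplace (passageMean P τ J v) s := by
  have := hw.density_jump.isProbabilityMeasure
  have hm := hw.measurable_passageMean v
  have h0 := laplace_integral (κ := halfLaw h) (G := fun u z => passageMean P τ J v (z - u))
    (hm.comp (by fun_prop)) (v := v) (s := s) (by
      filter_upwards [hw.density_jump.ae_pos] with u hu y hy
      rw [abs_of_nonneg (passageMean_nonneg _)]
      refine (hw.passageMean_le_max hv _).trans ?_
      gcongr
      exact max_le (by linarith) hy.le) hs
  refine h0.trans ?_
  rw [hw.laplace_jump, lawLaplace, ← integral_mul_const]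
  refine integral_congr_ae ?_
  filter_upwards [hw.density_jump.ae_pos] with u hu
  exact laplace_comp_sub (fun z hz => hw.passageMean_of_nonpos hv hz) hu.le s

/-- For a fixed residual time `e`, the shift by `v * e` becomes the factor `exp (-(s * v) * e)` and
averaging over the jump becomes the factor `laplace h s`. Integrating over `e` makes `κ` enter only
through its transform at `s * v`. -/
lemma laplace_passageMeanLaw (hw : IsWalk P τ J ψ h) (hv : 0 < v) {κ : Measure ℝ}
    [IsProbabilityMeasure κ] (hκ : ∀ᵐ e ∂κ, 0 ≤ e) {s : ℂ} (hs : 0 < s.re) :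
    laplace (passageMeanLaw P τ J v κ) s = (1 - lawLaplace κ (s * v)) / (v * s ^ 2)
      + lawLaplace κ (s * v) * (laplace h s * laplace (passageMean P τ J v) s) := by
  have h0 := laplace_integral (κ := κ) (G := fun e y => passageMeanFrom P τ J v e y)
    (hw.measurable_passageMeanFrom v) (v := v) (s := s) (by
      filter_upwards [hκ] with e he y hy
      rw [abs_of_nonneg (passageMeanFrom_nonneg _ _)]
      exact hw.passageMeanFrom_le hv he hy.le) hs
  refine h0.trans ?_
  have h1 : ∀ᵐ e ∂κ, laplace (passageMeanFrom P τ J v e) s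
      = (1 - Complex.exp (-(s * v) * (e : ℂ))) / (v * s ^ 2) + Complex.exp (-(s * v) * (e : ℂ))
        * (laplace h s * laplace (passageMean P τ J v) s) := by
    filter_upwards [hκ] with e he
    rw [← laplace_min hv he hs, ← hw.laplace_jumpMean hv hs]
    have e3 : -(s * v) * (e : ℂ) = -s * ((v * e : ℝ) : ℂ) := by push_cast; ring
    rw [e3, ← laplace_comp_sub (fun z hz => hw.jumpMean_of_nonpos hv hz) (mul_nonneg hv.le he)]
    unfold laplace
    rw [← integral_add]
    · refine setIntegral_congr_fun measurableSet_Ioi fun y hy => ?_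
      simp only
      rw [hw.passageMeanFrom_eq hv he (le_of_lt hy)]
      push_cast
      rw [add_mul]
      rfl
    · refine laplaceConverges_of_abs_le (v := v) hs (by fun_prop) ?_
      filter_upwards [ae_restrict_mem measurableSet_Ioi] with y hy
      rw [abs_of_nonneg (le_min he (div_nonneg (le_of_lt hy) hv.le))]
      exact min_le_right _ _
    · refine laplaceConverges_of_abs_le (v := v) hs
        ((hw.measurable_jumpMean v).comp (by fun_prop)).aestronglyMeasurable ?_
      filter_upwards [ae_restrict_mem measurableSet_Ioi] with y hy
      rw [abs_of_nonneg (jumpMean_nonneg _)]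
      refine (hw.jumpMean_le hv _).trans ?_
      gcongr
      exact max_le (by linarith [mul_nonneg hv.le he]) (le_of_lt hy)
  rw [integral_congr_ae h1]
  have hre : 0 ≤ (s * v).re := by simpa using mul_nonneg hs.le hv.le
  have hint := integrable_cexp_neg hκ hre
  have hint' : Integrable (fun e : ℝ => (1 - Complex.exp (-(s * v) * (e : ℂ))) / (v * s ^ 2)) κ :=
    ((integrable_const _).sub hint).div_const _
  rw [integral_add hint' (hint.mul_const _), integral_div, integral_sub (integrable_const _) hint, integral_mul_const]
  simp [lawLaplace]

omit [IsProbabilityMeasure P] in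
-- Both laws live on the positive axis, so the product of their transforms has modulus strictly
-- below one.
lemma one_sub_laplace_mul_ne_zero (hw : IsWalk P τ J ψ h) (hv : 0 < v) {s : ℂ} (hs : 0 < s.re) :
    1 - laplace ψ (s * v) * laplace h s ≠ 0 := by
  have := hw.density_jump.isProbabilityMeasure
  have := hw.density_wait.isProbabilityMeasure
  have hre : 0 < (s * v).re := by simpa using mul_pos hs hv
  have h1 := norm_lawLaplace_le hw.density_wait.ae_pos hre.le
  have h2 := norm_lawLaplace_lt_one hw.density_jump.ae_pos hs
  rw [← hw.laplace_wait] at h1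
  rw [← hw.laplace_jump] at h2
  intro h0
  have h3 : ‖laplace ψ (s * v) * laplace h s‖ = 1 := by rw [← sub_eq_zero.1 h0, norm_one]
  rw [norm_mul] at h3
  nlinarith [norm_nonneg (laplace h s), norm_nonneg (laplace ψ (s * v))]

omit [IsProbabilityMeasure P] in
lemma one_sub_laplace_ne_zero (hw : IsWalk P τ J ψ h) {s : ℂ} (hs : 0 < s.re) :
    1 - laplace h s ≠ 0 := by
  have := hw.density_jump.isProbabilityMeasure
  have h2 := norm_lawLaplace_lt_one hw.density_jump.ae_pos hs
  rw [← hw.laplace_jump] at h2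
  intro h0
  rw [← sub_eq_zero.1 h0, norm_one] at h2
  exact lt_irrefl _ h2

/-- When the residual time is itself a sojourn time, the same unknown transform stands on both sides
of `laplace_passageMeanLaw`, and the linear equation can be solved. -/
lemma laplace_passageMean (hw : IsWalk P τ J ψ h) (hv : 0 < v) {s : ℂ} (hs : 0 < s.re) :
    LaplaceConverges (passageMean P τ J v) s ∧ laplace (passageMean P τ J v) s
      = 1 / (v * s ^ 2) * ((1 - laplace ψ (s * v)) / (1 - laplace ψ (s * v) * laplace h s)) := by
  have := hw.density_wait.isProbabilityMeasure
  have h0 : ∀ᵐ e ∂halfLaw ψ, 0 ≤ e := hw.density_wait.ae_pos.mono fun _ => le_of_lt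
  have hF : passageMean P τ J v = passageMeanLaw P τ J v (halfLaw ψ) :=
    funext fun y => hw.passageMean_eq_passageMeanLaw hv y
  have h1 := hw.laplace_passageMeanLaw hv h0 hs
  rw [← hF, ← hw.laplace_wait] at h1
  refine ⟨hF ▸ hw.laplaceConverges_passageMeanLaw hv h0 hs, ?_⟩
  have hne := hw.one_sub_laplace_mul_ne_zero hv hs
  have hs0 : s ≠ 0 := fun h => by simp [h] at hs
  have hvc : (v : ℂ) ≠ 0 := by exact_mod_cast hv.ne'
  rw [one_div_mul_eq_div, eq_div_iff (by simp [hs0, hvc]), eq_div_iff hne]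
  have h2 : laplace (passageMean P τ J v) s * (1 - laplace ψ (s * v) * laplace h s)
      = (1 - laplace ψ (s * v)) / (v * s ^ 2) := by linear_combination h1
  rw [mul_right_comm, h2]
  field_simp

lemma laplace_passageMeanLaw' (hw : IsWalk P τ J ψ h) (hv : 0 < v) {κ : Measure ℝ}
    [IsProbabilityMeasure κ] (hκ : ∀ᵐ e ∂κ, 0 ≤ e) {s : ℂ} (hs : 0 < s.re) :
    laplace (passageMeanLaw P τ J v κ) s = laplace (passageMean P τ J v) s
      - (1 - laplace h s) / (v * s ^ 2 * (1 - laplace ψ (s * v) * laplace h s))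
        * (lawLaplace κ (s * v) - laplace ψ (s * v)) := by
  have hne := hw.one_sub_laplace_mul_ne_zero hv hs
  have hs0 : s ≠ 0 := fun h => by simp [h] at hs
  have hvc : (v : ℂ) ≠ 0 := by exact_mod_cast hv.ne'
  rw [hw.laplace_passageMeanLaw hv hκ hs, (hw.laplace_passageMean hv hs).2]
  generalize laplace ψ (s * v) = p at *
  generalize laplace h s = q at *
  have hne' : 1 - q * p ≠ 0 := by rwa [mul_comm]
  field_simp
  ring

end IsWalk

end

/-! ### Convolution and uniqueness for the integral equation -/

/-- The real convolution of two functions on the line. -/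
def conv (f g : ℝ → ℝ) : ℝ → ℝ := f ⋆[ContinuousLinearMap.mul ℝ ℝ, volume] g

lemma conv_apply (f g : ℝ → ℝ) (x : ℝ) : conv f g x = ∫ t, f t * g (x - t) := rfl

lemma integrable_conv {f g : ℝ → ℝ} (hf : Integrable f) (hg : Integrable g) :
    Integrable (conv f g) := hf.integrable_convolution _ hg

lemma integral_conv {f g : ℝ → ℝ} (hf : Integrable f) (hg : Integrable g) :
    ∫ x, conv f g x = (∫ x, f x) * ∫ x, g x := integral_convolution _ hf hg

lemma ae_integrable_conv {f g : ℝ → ℝ} (hf : Integrable f) (hg : Integrable g) :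
    ∀ᵐ x, Integrable fun t => f t * g (x - t) := by
  filter_upwards [Integrable.ae_convolution_exists (ContinuousLinearMap.mul ℝ ℝ) hf hg] with x hx
  simpa [ConvolutionExistsAt] using hx

/-- The exponential weight is multiplicative along a convolution. It preserves the equation while
making the mass of `h` strictly less than one. -/
lemma conv_mul_exp (f g : ℝ → ℝ) :
    conv (fun x => f x * Real.exp (-x)) (fun x => g x * Real.exp (-x))
      = fun x => conv f g x * Real.exp (-x) := by
  funext x
  rw [conv_apply, conv_apply, ← integral_mul_const]
  refine integral_congr_ae (ae_of_all _ fun t => ?_)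
  simp only
  rw [mul_mul_mul_comm, ← Real.exp_add]
  congr 2
  ring

lemma ae_conv_sub {f g₁ g₂ : ℝ → ℝ} (hf : Integrable f) (h₁ : Integrable g₁)
    (h₂ : Integrable g₂) :
    ∀ᵐ x, conv f (fun y => g₁ y - g₂ y) x = conv f g₁ x - conv f g₂ x := by
  filter_upwards [ae_integrable_conv hf h₁, ae_integrable_conv hf h₂] with x hx₁ hx₂
  rw [conv_apply, conv_apply, conv_apply, ← integral_sub hx₁ hx₂]
  simp only [mul_sub]

lemma ae_sub_conv {f₁ f₂ g : ℝ → ℝ} (hg : Integrable g) (h₁ : Integrable f₁)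
    (h₂ : Integrable f₂) :
    ∀ᵐ x, conv (fun y => f₁ y - f₂ y) g x = conv f₁ g x - conv f₂ g x := by
  filter_upwards [ae_integrable_conv h₁ hg, ae_integrable_conv h₂ hg] with x hx₁ hx₂
  rw [conv_apply, conv_apply, conv_apply, ← integral_sub hx₁ hx₂]
  simp only [sub_mul]

lemma abs_conv_le (f g : ℝ → ℝ) (x : ℝ) :
    |conv f g x| ≤ conv (fun t => |f t|) (fun t => |g t|) x := by
  rw [conv_apply, conv_apply]
  refine (abs_integral_le_integral_abs).trans (le_of_eq ?_)
  simp only [abs_mul]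

/-- A strict contraction argument in `L¹` for double convolutions. -/
lemma ae_eq_zero_of_abs_le_conv {h k d : ℝ → ℝ} (hh : Integrable h) (hk : Integrable k)
    (hd : Integrable d) (hh0 : ∀ x, 0 ≤ h x) (hk0 : ∀ x, 0 ≤ k x) (hh1 : ∫ x, h x < 1)
    (hk1 : ∫ x, k x ≤ 1) (hle : ∀ᵐ x, |d x| ≤ |conv (conv h d) k x|) : d =ᵐ[volume] 0 := by
  have hda : Integrable fun x => |d x| := hd.abs
  have hhd := integrable_conv hh hda
  have hle' : ∀ᵐ x, |d x| ≤ conv (conv h fun x => |d x|) k x := by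
    filter_upwards [hle, ae_integrable_conv hhd hk,
      ae_integrable_conv (integrable_conv hh hd).abs hk] with x hx h1 h2
    refine hx.trans ((abs_conv_le _ _ x).trans ?_)
    simp only [abs_of_nonneg (hk0 _)]
    rw [conv_apply, conv_apply]
    refine integral_mono h2 h1 fun t => ?_
    refine mul_le_mul_of_nonneg_right ?_ (hk0 _)
    refine (abs_conv_le _ _ t).trans (le_of_eq ?_)
    simp only [abs_of_nonneg (hh0 _)]
  -- Integrating bounds the norm of `d` by `(∫ h) * (∫ k)` times itself, a factor below one; no
  -- iteration is needed.
  have h1 := integral_mono_ae hda (integrable_conv hhd hk) hle'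
  rw [integral_conv hhd hk, integral_conv hh hda] at h1
  have hnn : 0 ≤ ∫ x, |d x| := integral_nonneg fun _ => abs_nonneg _
  have hzero : ∫ x, |d x| = 0 := by
    have hh2 : 0 ≤ ∫ x, h x := integral_nonneg hh0
    have hk2 : 0 ≤ ∫ x, k x := integral_nonneg hk0
    have h3 : (∫ x, h x) * (∫ x, |d x|) * ∫ x, k x ≤ (∫ x, h x) * (∫ x, |d x|) * 1 :=
      mul_le_mul_of_nonneg_left hk1 (mul_nonneg hh2 hnn)
    nlinarith
  rw [integral_eq_zero_iff_of_nonneg (fun _ => abs_nonneg _) hda] at hzero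
  filter_upwards [hzero] with x hx
  exact abs_eq_zero.1 hx

section Uniqueness

variable {ψ h : ℝ → ℝ} {v Y : ℝ}

/-- Causality: up to `Y` the convolution sees only the values of `G` on `[0, Y]`. Truncation makes a
locally integrable solution integrable without altering the equation there. -/
lemma conv_truncate_eq (hh : IsHalfLineDensity h) (G : ℝ → ℝ) {z : ℝ} (hz : 0 ≤ z) (hzY : z ≤ Y) :
    conv h ((Icc 0 Y).indicator G) z = ∫ u in (0 : ℝ)..z, h u * G (z - u) := by
  rw [conv_apply, intervalIntegral.integral_of_le hz, ← integral_Icc_eq_integral_Ioc,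
    ← integral_indicator measurableSet_Icc]
  refine integral_congr_ae (ae_of_all _ fun u => ?_)
  by_cases hu : u ∈ Icc 0 z
  · have : z - u ∈ Icc 0 Y := ⟨by linarith [hu.2], by linarith [hu.1]⟩
    simp [hu, this]
  · simp only [indicator_of_notMem hu]
    rcases lt_or_ge u 0 with h0 | h0
    · rw [hh.eq_zero_of_neg u h0, zero_mul]
    · rw [indicator_of_notMem, mul_zero]
      exact fun hm => hu ⟨h0, by linarith [hm.1]⟩

lemma conv_truncate_of_neg (hh : IsHalfLineDensity h) (G : ℝ → ℝ) {z : ℝ} (hz : z < 0) :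
    conv h ((Icc 0 Y).indicator G) z = 0 := by
  rw [conv_apply]
  refine integral_eq_zero_of_ae (ae_of_all _ fun u => ?_)
  simp only [Pi.zero_apply]
  rcases lt_or_ge u 0 with h0 | h0
  · rw [hh.eq_zero_of_neg u h0, zero_mul]
  · rw [indicator_of_notMem, mul_zero]
    exact fun hm => by linarith [hm.1]

lemma conv_conv_truncate_eq (hψ : IsHalfLineDensity ψ) (hh : IsHalfLineDensity h) (hv : 0 < v)
    (G : ℝ → ℝ) {y : ℝ} (hy : 0 ≤ y) (hyY : y ≤ Y) :
    conv (conv h ((Icc 0 Y).indicator G)) (fun x => 1 / v * ψ (x / v)) y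
      = (1 / v) * ∫ z in (0 : ℝ)..y, ψ ((y - z) / v) * ∫ u in (0 : ℝ)..z, h u * G (z - u) := by
  rw [conv_apply, intervalIntegral.integral_of_le hy, ← integral_Icc_eq_integral_Ioc,
    ← integral_const_mul, ← integral_indicator measurableSet_Icc]
  refine integral_congr_ae (ae_of_all _ fun z => ?_)
  by_cases hz : z ∈ Icc 0 y
  · simp only [indicator_of_mem hz]
    rw [conv_truncate_eq hh G hz.1 (hz.2.trans hyY)]
    ring
  · simp only [indicator_of_notMem hz]
    rcases lt_or_ge z 0 with h0 | h0
    · rw [conv_truncate_of_neg hh G h0, zero_mul]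
    · have : y < z := by
        by_contra hcon
        exact hz ⟨h0, not_lt.1 hcon⟩
      rw [hψ.eq_zero_of_neg _ (div_neg_of_neg_of_pos (by linarith) hv), mul_zero, mul_zero]

lemma integrable_mul_exp_neg {g : ℝ → ℝ} (hg : Integrable g) (hg0 : ∀ x, x < 0 → g x = 0) :
    Integrable fun x => g x * Real.exp (-x) := by
  refine hg.mono (hg.aestronglyMeasurable.mul (by fun_prop)) (ae_of_all _ fun x => ?_)
  rcases lt_or_ge x 0 with hx | hx
  · simp [hg0 x hx]
  · rw [norm_mul, Real.norm_eq_abs (Real.exp _), abs_of_pos (Real.exp_pos _)]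
    exact mul_le_of_le_one_right (norm_nonneg _) (Real.exp_le_one_iff.2 (by linarith))

/-- The truncated and exponentially weighted difference of two solutions is dominated by its
convolution with the weighted kernels of the jump and of the rescaled sojourn time, so the `L¹`
contraction makes it vanish. -/
lemma SolvesRenewal.ae_eq (hψ : IsHalfLineDensity ψ) (hh : IsHalfLineDensity h) (hv : 0 < v)
    {F G : ℝ → ℝ} (hF : SolvesRenewal ψ h v F) (hG : SolvesRenewal ψ h v G) (Y : ℝ) :
    ∀ᵐ y, y ∈ Icc 0 Y → G y = F y := by
  set E : ℝ → ℝ := fun x => Real.exp (-x) with hE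
  set k : ℝ → ℝ := fun x => 1 / v * ψ (x / v) with hkdef
  set f : ℝ → ℝ := (Icc 0 Y).indicator F with hf
  set g : ℝ → ℝ := (Icc 0 Y).indicator G with hg
  have hkneg : ∀ x, x < 0 → k x = 0 := fun x hx => by
    simp [hkdef, hψ.eq_zero_of_neg _ (div_neg_of_neg_of_pos hx hv)]
  have hk0 : ∀ x, 0 ≤ k x := fun x => mul_nonneg (by positivity) (hψ.nonneg _)
  have hki : Integrable k := (hψ.integrable.comp_div hv.ne').const_mul _
  have hk1 : ∫ x, k x = 1 := by
    rw [hkdef, integral_const_mul, Measure.integral_comp_div, abs_of_pos hv, smul_eq_mul,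
      integral_eq_lintegral_of_nonneg_ae (ae_of_all _ hψ.nonneg)
        hψ.measurable.aestronglyMeasurable, hψ.lintegral_eq_one]
    field_simp
    simp
  have hfi : Integrable f := (hF.locInt Y).integrable_indicator measurableSet_Icc
  have hgi : Integrable g := (hG.locInt Y).integrable_indicator measurableSet_Icc
  have hneg : ∀ (G : ℝ → ℝ) (x : ℝ), x < 0 → (Icc 0 Y).indicator G x = 0 := fun G x hx =>
    indicator_of_notMem (fun hm => absurd hm.1 (not_le.2 hx)) _
  set h' : ℝ → ℝ := fun x => h x * E x
  set k' : ℝ → ℝ := fun x => k x * E x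
  set f' : ℝ → ℝ := fun x => f x * E x
  set g' : ℝ → ℝ := fun x => g x * E x
  have hh'i : Integrable h' := integrable_mul_exp_neg hh.integrable hh.eq_zero_of_neg
  have hk'i : Integrable k' := integrable_mul_exp_neg hki hkneg
  have hf'i : Integrable f' := integrable_mul_exp_neg hfi (hneg F)
  have hg'i : Integrable g' := integrable_mul_exp_neg hgi (hneg G)
  have hconv : ∀ G : ℝ → ℝ, conv (conv h' fun x => (Icc 0 Y).indicator G x * E x) k'
      = fun y => conv (conv h ((Icc 0 Y).indicator G)) k y * E y := fun G => by
    rw [conv_mul_exp h, conv_mul_exp]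
  have hd : (fun x => g' x - f' x) =ᵐ[volume] 0 := by
    have := hh.isProbabilityMeasure
    refine ae_eq_zero_of_abs_le_conv hh'i hk'i (hg'i.sub hf'i)
      (fun x => mul_nonneg (hh.nonneg x) (Real.exp_pos _).le)
      (fun x => mul_nonneg (hk0 x) (Real.exp_pos _).le) ?_ ?_ ?_
    · have h1 := integral_exp_neg_lt_one hh.ae_pos one_pos
      rw [IsWalk.integral_halfLaw hh.measurable hh.nonneg] at h1
      refine lt_of_eq_of_lt (integral_congr_ae (ae_of_all _ fun x => ?_)) h1
      simp [h', hE]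
    · rw [← hk1]
      refine integral_mono hk'i hki fun x => ?_
      rcases lt_or_ge x 0 with hx | hx
      · simp [k', hkneg x hx]
      · exact mul_le_of_le_one_right (hk0 x) (Real.exp_le_one_iff.2 (by linarith))
    · have hc : conv (conv h' fun x => g' x - f' x) k'
          = conv (fun x => conv h' g' x - conv h' f' x) k' := by
        funext y
        rw [conv_apply, conv_apply]
        refine integral_congr_ae ?_
        filter_upwards [ae_conv_sub hh'i hg'i hf'i] with t ht
        rw [ht]
      rw [hc]
      filter_upwards [ae_sub_conv hk'i (integrable_conv hh'i hg'i)
        (integrable_conv hh'i hf'i)] with y hy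
      rw [hy]
      by_cases hyY : y ∈ Icc 0 Y
      · refine le_of_eq (congrArg _ ?_)
        have e1 : g y = G y := indicator_of_mem hyY _
        have e2 : f y = F y := indicator_of_mem hyY _
        rw [hconv G, hconv F]
        simp only [g', f', e1, e2]
        rw [hG.eqn y hyY.1, hF.eqn y hyY.1, conv_conv_truncate_eq hψ hh hv G hyY.1 hyY.2,
          conv_conv_truncate_eq hψ hh hv F hyY.1 hyY.2]
        ring
      -- Outside `[0, Y]` the truncated difference is zero while its convolution need not be. This
      -- is why the contraction lemma is stated with an inequality.
      · have e1 : g y = 0 := indicator_of_notMem hyY _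
        have e2 : f y = 0 := indicator_of_notMem hyY _
        simp only [g', f', e1, e2]
        simp
  filter_upwards [hd] with y hy hyY
  have e1 : g y = G y := indicator_of_mem hyY _
  have e2 : f y = F y := indicator_of_mem hyY _
  simp only [g', f', e1, e2, Pi.zero_apply] at hy
  rw [← sub_mul] at hy
  rcases mul_eq_zero.1 hy with h1 | h1
  · linarith
  · exact absurd h1 (Real.exp_pos _).ne'

/-- The right side of the equation depends on the solution only up to null sets, so almost
everywhere equality becomes equality at every point. -/
lemma SolvesRenewal.eqOn (hψ : IsHalfLineDensity ψ) (hh : IsHalfLineDensity h) (hv : 0 < v)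
    {F G : ℝ → ℝ} (hF : SolvesRenewal ψ h v F) (hG : SolvesRenewal ψ h v G) :
    EqOn G F (Ici 0) := by
  intro y hy
  rw [hG.eqn y hy, hF.eqn y hy]
  congr 2
  refine intervalIntegral.integral_congr fun z hz => ?_
  rw [uIcc_of_le hy] at hz
  congr 1
  rw [intervalIntegral.integral_of_le hz.1, intervalIntegral.integral_of_le hz.1]
  refine setIntegral_congr_ae measurableSet_Ioc ?_
  have h1 := hF.ae_eq hψ hh hv hG z
  have h2 : ∀ᵐ u : ℝ, z - u ∈ Icc 0 z → G (z - u) = F (z - u) :=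
    (Measure.measurePreserving_sub_left volume z).quasiMeasurePreserving.ae h1
  filter_upwards [h2] with u hu hmem
  rw [hu ⟨by linarith [hmem.2], by linarith [hmem.1]⟩]

end Uniqueness

/-! ### Density and moments of the excess life -/

section ExcessLife

variable {Ω : Type*} [MeasurableSpace Ω]

/-- Joint measurability in the time and the outcome is needed because means of the excess life are
later integrated over `r`. The count is the cardinality of a measurably varying set of indices. -/
lemma measurable_excessLife {τ : ℕ → Ω → ℝ} (hτ : ∀ k, Measurable (τ k)) :
    Measurable fun p : ℝ × Ω => excessLife τ p.1 p.2 := by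
  have hm : ∀ n, Measurable (jumpTime τ n) := fun n =>
    Finset.measurable_sum _ fun i _ => hτ i
  have h1 : Measurable fun p : ℝ × Ω => {n : ℕ | jumpTime τ (n + 1) p.2 ≤ p.1} :=
    measurable_set_iff.2 fun n =>
      measurableSet_setOfPred.1 (measurableSet_le ((hm (n + 1)).comp measurable_snd) measurable_fst)
  have h2 : Measurable fun p : ℝ × Ω => jumpCount τ p.1 p.2 := measurable_ncard.comp h1
  have h3 : Measurable fun q : Ω × ℕ => jumpTime τ (q.2 + 1) q.1 :=
    measurable_from_prod_countable_left fun n => hm (n + 1)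
  exact (h3.comp (measurable_snd.prodMk h2)).sub measurable_fst

variable {P : Measure Ω} {τ J : ℕ → Ω → ℝ} {ψ h : ℝ → ℝ}

namespace IsWalk

lemma measurable_excess (hw : IsWalk P τ J ψ h) (r : ℝ) : Measurable (excessLife τ r) :=
  Measurable.comp (g := fun p : ℝ × Ω => excessLife τ p.1 p.2) (f := fun ω => (r, ω))
    (measurable_excessLife hw.measurable_wait) measurable_prodMk_left

variable [IsProbabilityMeasure P]

omit [IsProbabilityMeasure P] in
lemma indepFun_jumpTime_wait (hw : IsWalk P τ J ψ h) (n : ℕ) :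
    IndepFun (jumpTime τ n) (τ n) P := by
  have hind := hw.indep.precomp (g := Sum.inl) Sum.inl_injective
  have h1 := iIndepFun.indepFun_sum_range_succ hind hw.measurable_wait n
  have h2 : jumpTime τ n = ∑ i ∈ Finset.range n, τ i := by
    funext ω; simp [jumpTime]
  rw [h2]
  exact h1

/-- The last summand is independent of the others and has a density; given the others, a null set is
hit with probability zero. -/
lemma map_jumpTime_absolutelyContinuous (hw : IsWalk P τ J ψ h) (n : ℕ) :
    P.map (jumpTime τ (n + 1)) ≪ volume := by
  refine Measure.AbsolutelyContinuous.mk fun A hA h0 => ?_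
  rw [Measure.map_apply (hw.measurable_jumpTime _) hA]
  have h1 := lintegral_indepFun (hw.measurable_jumpTime n) (hw.measurable_wait n)
    (hw.measurable_wait n) (hw.indepFun_jumpTime_wait n) rfl
    (Φ := fun t x => A.indicator 1 (t + x)) ((measurable_one.indicator hA).comp (by fun_prop))
  have h2 : ∀ ω, A.indicator (1 : ℝ → ℝ≥0∞) (jumpTime τ n ω + τ n ω)
      = (jumpTime τ (n + 1) ⁻¹' A).indicator 1 ω := by
    intro ω
    have : jumpTime τ (n + 1) ω = jumpTime τ n ω + τ n ω := by
      simp [jumpTime, Finset.sum_range_succ]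
    rw [← this]
    rfl
  have h3 : ∀ t, ∫⁻ ω, A.indicator (1 : ℝ → ℝ≥0∞) (t + τ n ω) ∂P = 0 := by
    intro t
    have hmA : MeasurableSet ((fun x => t + x) ⁻¹' A) := (measurable_const_add t) hA
    have e1 : ∫⁻ ω, A.indicator (1 : ℝ → ℝ≥0∞) (t + τ n ω) ∂P
        = ∫⁻ x, ((fun x => t + x) ⁻¹' A).indicator 1 x ∂P.map (τ n) := by
      rw [lintegral_map (measurable_one.indicator hmA) (hw.measurable_wait n)]
      rfl
    rw [e1, lintegral_indicator_one hmA, hw.law_wait]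
    refine withDensity_absolutelyContinuous _ _ ?_
    rw [measure_preimage_add, h0]
  simp only [h2, h3, lintegral_zero] at h1
  rwa [lintegral_indicator_one (hw.measurable_jumpTime _ hA)] at h1

/-- The excess life always equals one of the countably many variables `jumpTime τ (n + 1) - r`, each
of which avoids a given null set almost surely. -/
lemma map_excessLife_absolutelyContinuous (hw : IsWalk P τ J ψ h) (r : ℝ) :
    P.map (excessLife τ r) ≪ volume := by
  refine Measure.AbsolutelyContinuous.mk fun A hA h0 => ?_
  rw [Measure.map_apply (hw.measurable_excess r) hA]
  refine measure_mono_null (t := ⋃ n, jumpTime τ (n + 1) ⁻¹' ((fun x => x + -r) ⁻¹' A))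
    (fun ω hω => mem_iUnion.2 ⟨jumpCount τ r ω, ?_⟩) (measure_iUnion_null fun n => ?_)
  · simpa [excessLife, sub_eq_add_neg] using hω
  · have hm : MeasurableSet ((fun x => x + -r) ⁻¹' A) := (measurable_add_const (-r)) hA
    rw [← Measure.map_apply (hw.measurable_jumpTime _) hm]
    refine hw.map_jumpTime_absolutelyContinuous n ?_
    rw [measure_preimage_add_right, h0]

lemma hasPDF_excessLife (hw : IsWalk P τ J ψ h) (r : ℝ) : HasPDF (excessLife τ r) P volume :=
  Real.hasPDF_iff.2 ⟨(hw.measurable_excess r).aemeasurable,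
    hw.map_excessLife_absolutelyContinuous r⟩

omit [IsProbabilityMeasure P] in
lemma measurable_excessPdf (r : ℝ) : Measurable (excessPdf P τ r) :=
  (measurable_pdf _ _ _).ennreal_toReal

omit [IsProbabilityMeasure P] in
lemma excessPdf_nonneg (r t : ℝ) : 0 ≤ excessPdf P τ r t := ENNReal.toReal_nonneg

lemma halfLaw_excessPdf (hw : IsWalk P τ J ψ h) (r : ℝ) :
    halfLaw (excessPdf P τ r) = P.map (excessLife τ r) := by
  have := hw.hasPDF_excessLife r
  rw [map_eq_withDensity_pdf (excessLife τ r) P volume, halfLaw]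
  exact withDensity_congr_ae pdf.ofReal_toReal_ae_eq

lemma isProbabilityMeasure_excess (hw : IsWalk P τ J ψ h) (r : ℝ) :
    IsProbabilityMeasure (halfLaw (excessPdf P τ r)) := by
  rw [hw.halfLaw_excessPdf]
  exact Measure.isProbabilityMeasure_map (hw.measurable_excess r).aemeasurable

lemma excessCdf_eq (hw : IsWalk P τ J ψ h) (r t : ℝ) :
    excessCdf P τ r t = (halfLaw (excessPdf P τ r)).real (Iic t) := by
  rw [hw.halfLaw_excessPdf, map_measureReal_apply (hw.measurable_excess r) measurableSet_Iic]
  rfl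

lemma ae_hasDerivAt_excessCdf (hw : IsWalk P τ J ψ h) (r : ℝ) :
    ∀ᵐ t : ℝ, HasDerivAt (excessCdf P τ r) (excessPdf P τ r t) t := by
  have := hw.isProbabilityMeasure_excess r
  have hi : Integrable (excessPdf P τ r) := by
    refine ⟨(measurable_excessPdf r).aestronglyMeasurable, ?_⟩
    rw [hasFiniteIntegral_iff_ofReal (ae_of_all _ (excessPdf_nonneg r))]
    have h1 : halfLaw (excessPdf P τ r) univ = 1 := measure_univ
    rw [halfLaw, withDensity_apply _ MeasurableSet.univ, Measure.restrict_univ] at h1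
    rw [h1]
    exact ENNReal.one_lt_top
  have hcdf : ∀ t, excessCdf P τ r t = ∫ u in Iic t, excessPdf P τ r u := by
    intro t
    rw [hw.excessCdf_eq, measureReal_def, halfLaw, withDensity_apply _ measurableSet_Iic,
      integral_eq_lintegral_of_nonneg_ae (ae_of_all _ (excessPdf_nonneg r))
        (measurable_excessPdf r).aestronglyMeasurable]
  filter_upwards [LocallyIntegrable.ae_hasDerivAt_integral hi.locallyIntegrable] with t ht
  have h2 := (ht 0).const_add (∫ u in Iic 0, excessPdf P τ r u)
  refine h2.congr_of_eventuallyEq (Eventually.of_forall fun x => ?_)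
  simp only
  rw [hcdf, ← intervalIntegral.integral_Iic_sub_Iic hi.integrableOn hi.integrableOn,
    add_sub_cancel]

lemma ae_excessLife_pos (hw : IsWalk P τ J ψ h) {r : ℝ} (hr : 0 ≤ r) :
    ∀ᵐ ω ∂P, 0 < excessLife τ r ω := by
  filter_upwards [hw.ae_good] with ω hω
  obtain ⟨n, h1, h2⟩ := exists_jumpTime_le_lt hω.2.2 hr
  rw [excessLife_eq hω.1 h1 h2]
  linarith

lemma ae_excess_pos (hw : IsWalk P τ J ψ h) {r : ℝ} (hr : 0 ≤ r) :
    ∀ᵐ e ∂halfLaw (excessPdf P τ r), 0 < e := by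
  rw [hw.halfLaw_excessPdf, ae_map_iff (hw.measurable_excess r).aemeasurable measurableSet_Ioi]
  exact hw.ae_excessLife_pos hr

lemma laplace_excessPdf (hw : IsWalk P τ J ψ h) {r : ℝ} (hr : 0 ≤ r) (s : ℂ) :
    laplace (excessPdf P τ r) s = lawLaplace (P.map (excessLife τ r)) s := by
  rw [laplace_eq_lawLaplace (measurable_excessPdf r) (excessPdf_nonneg r) (hw.ae_excess_pos hr),
    hw.halfLaw_excessPdf]

/-- The excess life is at most the sojourn time covering `r`, so its `p`-th power is at most the sum
over `n` of the `p`-th power of `τ n` on the event that `jumpTime τ n ≤ r`. Since `τ n` is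
independent of that event, the expectation factors into the renewal function times the `p`-th
moment. -/
lemma integrable_excessLife_pow (hw : IsWalk P τ J ψ h) {p : ℕ}
    (hi : Integrable (fun ω => τ 0 ω ^ p) P) {r : ℝ} (hr : 0 ≤ r) :
    Integrable (fun ω => excessLife τ r ω ^ p) P := by
  have hpos := hw.ae_excessLife_pos hr
  refine ⟨((hw.measurable_excess r).pow_const p).aestronglyMeasurable, ?_⟩
  rw [hasFiniteIntegral_iff_ofReal (by filter_upwards [hpos] with ω hω; positivity)]
  have hfin : ∫⁻ x, ENNReal.ofReal (x ^ p) ∂halfLaw ψ < ∞ := by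
    have h1 := hi.hasFiniteIntegral
    rw [hasFiniteIntegral_iff_ofReal
      (by filter_upwards [hw.ae_wait_pos] with ω hω; have := hω 0; positivity)] at h1
    rwa [halfLaw, ← hw.law_wait 0, lintegral_map (by fun_prop) (hw.measurable_wait 0)]
  have hterm : ∀ n, ∫⁻ ω, (Iic r).indicator 1 (jumpTime τ n ω) * ENNReal.ofReal (τ n ω ^ p) ∂P
      = P {ω | jumpTime τ n ω ≤ r} * ∫⁻ x, ENNReal.ofReal (x ^ p) ∂halfLaw ψ := by
    intro n
    have h1 := lintegral_indepFun (hw.measurable_jumpTime n) (hw.measurable_wait n)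
      (hw.measurable_wait n) (hw.indepFun_jumpTime_wait n) rfl
      (Φ := fun t x => (Iic r).indicator 1 t * ENNReal.ofReal (x ^ p))
      (((measurable_one.indicator measurableSet_Iic).comp measurable_fst).mul (by fun_prop))
    rw [h1, halfLaw, ← hw.law_wait n, lintegral_map (by fun_prop) (hw.measurable_wait n)]
    have hmn := hw.measurable_wait n
    have hset : MeasurableSet {ω | jumpTime τ n ω ≤ r} :=
      measurableSet_le (hw.measurable_jumpTime n) measurable_const
    rw [← lintegral_indicator_one hset, ← lintegral_mul_const _ (measurable_one.indicator hset)]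
    refine lintegral_congr fun ω => ?_
    rw [lintegral_const_mul _ (by fun_prop)]
    rfl
  calc ∫⁻ ω, ENNReal.ofReal (excessLife τ r ω ^ p) ∂P
      ≤ ∫⁻ ω, ∑' n, (Iic r).indicator 1 (jumpTime τ n ω) * ENNReal.ofReal (τ n ω ^ p) ∂P := by
        refine lintegral_mono_ae ?_
        filter_upwards [hw.ae_good] with ω hω
        obtain ⟨n, h1, h2⟩ := exists_jumpTime_le_lt hω.2.2 hr
        refine le_trans ?_ (ENNReal.le_tsum n)
        rw [excessLife_eq hω.1 h1 h2, indicator_of_mem (mem_Iic.2 h1), Pi.one_apply, one_mul]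
        have : jumpTime τ (n + 1) ω = jumpTime τ n ω + τ n ω := by
          simp [jumpTime, Finset.sum_range_succ]
        refine ENNReal.ofReal_le_ofReal (pow_le_pow_left₀ (by linarith) (by linarith) p)
    _ = (∑' n, P {ω | jumpTime τ n ω ≤ r}) * ∫⁻ x, ENNReal.ofReal (x ^ p) ∂halfLaw ψ := by
        rw [lintegral_tsum]
        · simp only [hterm, ENNReal.tsum_mul_right]
        · intro n
          have h1 := hw.measurable_wait n
          exact (((measurable_one.indicator measurableSet_Iic).comp
            (hw.measurable_jumpTime n)).mul (by fun_prop)).aemeasurable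
    _ < ∞ := ENNReal.mul_lt_top (lt_top_iff_ne_top.2 (hw.tsum_measure_jumpTime_le r)) hfin

/-- Through this identification every statement on `J(·|r)` becomes the case of `passageMeanLaw` in
which the residual law is that of the excess life. -/
lemma meanExitFrom_eq (hw : IsWalk P τ J ψ h) {v : ℝ} (hv : 0 < v) {r : ℝ} (hr : 0 ≤ r) {y : ℝ}
    (hy : 0 ≤ y) : meanExitFrom P τ h v (passageMean P τ J v) r y
      = passageMeanLaw P τ J v (P.map (excessLife τ r)) y := by
  have := hw.isProbabilityMeasure_excess r
  rw [← hw.halfLaw_excessPdf, hw.passageMeanLaw_eq_quadrature hv (measurable_excessPdf r)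
    (excessPdf_nonneg r) (hw.ae_excess_pos hr) (fun l _ => hw.excessCdf_eq r l) hy]
  rfl

end IsWalk

end ExcessLife

/-! ### Translations in L¹ and tails of laws -/

/-- Translation is continuous in `L¹` of the line. -/
lemma tendsto_integral_translate_sub {f : ℝ → ℝ} (hf : Integrable f) :
    Tendsto (fun δ : ℝ => ∫ x, |f (δ + x) - f x|) (𝓝 0) (𝓝 0) := by
  have : Fact ((1 : ℝ≥0∞) ≠ ∞) := ⟨ENNReal.one_ne_top⟩
  have hf1 : MemLp f 1 := memLp_one_iff_integrable.2 hf
  -- Translation is a continuous action on `Lp` for finite exponents; the `L¹` norm of this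
  -- difference is the integral in question.
  have hc : Continuous fun δ : ℝ => (DomAddAct.mk δ +ᵥ hf1.toLp f) - hf1.toLp f := by
    have : Continuous fun δ : ℝ => (DomAddAct.mk δ : ℝᵈᵃᵃ) := DomAddAct.continuous_mk
    exact (this.vadd continuous_const).sub continuous_const
  have h0 := (hc.norm).tendsto 0
  have hval : ∀ δ : ℝ, ‖(DomAddAct.mk δ +ᵥ hf1.toLp f) - hf1.toLp f‖ = ∫ x, |f (δ + x) - f x| := by
    intro δ
    rw [DomAddAct.mk_vadd_toLp, ← MemLp.toLp_sub, Lp.norm_toLp, eLpNorm_one_eq_lintegral_enorm,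
      ← integral_norm_eq_lintegral_enorm]
    · rfl
    · exact ((hf.comp_add_left δ).sub hf).aestronglyMeasurable
  simp only [hval] at h0
  simpa using h0

/-- The tail of a law. -/
def tail (ν : Measure ℝ) (a : ℝ) : ℝ := ν.real (Ioi a)

lemma tail_nonneg (ν : Measure ℝ) (a : ℝ) : 0 ≤ tail ν a := measureReal_nonneg

section Tail

variable {ν : Measure ℝ} [IsProbabilityMeasure ν]

lemma tail_le_one (a : ℝ) : tail ν a ≤ 1 := measureReal_le_one

lemma antitone_tail : Antitone (tail ν) := fun _ _ hab =>
  measureReal_mono (Ioi_subset_Ioi hab)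

lemma measurable_tail : Measurable (tail ν) := antitone_tail.measurable

lemma tendsto_tail : Tendsto (tail ν) atTop (𝓝 0) := by
  have h1 := tendsto_cdf_atTop ν
  have h2 : tail ν = fun a => 1 - cdf ν a := by
    funext a
    rw [cdf_eq_real, tail, ← compl_Iic, probReal_compl_eq_one_sub measurableSet_Iic]
  rw [h2]
  simpa using h1.const_sub 1

lemma integrableOn_tail (hpos : ∀ᵐ u ∂ν, 0 < u) (hi : Integrable (fun u => u) ν) :
    IntegrableOn (tail ν) (Ioi 0) := by
  refine ⟨measurable_tail.aestronglyMeasurable, ?_⟩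
  rw [hasFiniteIntegral_iff_ofReal (ae_of_all _ (tail_nonneg ν))]
  have h0 := lintegral_eq_lintegral_meas_lt ν (f := fun u => u)
    (by filter_upwards [hpos] with u hu using hu.le) aemeasurable_id
  have h1 := hi.lintegral_lt_top
  rw [h0] at h1
  refine lt_of_eq_of_lt (lintegral_congr fun a => ?_) h1
  rw [tail, ofReal_measureReal]
  rfl

omit [IsProbabilityMeasure ν] in
lemma integral_tail (hpos : ∀ᵐ u ∂ν, 0 < u) (hi : Integrable (fun u => u) ν) :
    ∫ a in Ioi 0, tail ν a = ∫ u, u ∂ν :=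
  (hi.integral_eq_integral_meas_lt (by filter_upwards [hpos] with u hu using hu.le)).symm

/-- Exchange of integrations over the region `0 < a < u`. -/
lemma integral_tail_swap {E : Type*} [NormedAddCommGroup E] [NormedSpace ℝ E]
    (hi : IntegrableOn (tail ν) (Ioi 0)) {K : ℝ → ℝ → E}
    (hK : StronglyMeasurable (Function.uncurry K)) {B : ℝ} (hB : ∀ a u, ‖K a u‖ ≤ B) :
    IntegrableOn (fun a => ∫ u in Ioi a, K a u ∂ν) (Ioi 0) ∧
    ∫ a in Ioi 0, ∫ u in Ioi a, K a u ∂ν = ∫ u, (∫ a in Ioo 0 u, K a u) ∂ν := by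
  set S : Set (ℝ × ℝ) := {p | p.1 < p.2} with hS
  have hSm : MeasurableSet S := measurableSet_lt measurable_fst measurable_snd
  set G : ℝ × ℝ → E := S.indicator (Function.uncurry K) with hG
  have hGm : StronglyMeasurable G := hK.indicator hSm
  have hGa : ∀ a u, G (a, u) = (Ioi a).indicator (K a) u := fun a u => rfl
  have hGu : ∀ a u, G (a, u) = (Iio u).indicator (fun a => K a u) a := fun a u => rfl
  have hint : Integrable G ((volume.restrict (Ioi 0)).prod ν) := by
    rw [integrable_prod_iff hGm.aestronglyMeasurable]
    constructor
    · refine ae_of_all _ fun a => Integrable.of_bound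
        (hGm.comp_measurable measurable_prodMk_left).aestronglyMeasurable B (ae_of_all _ fun u => ?_)
      exact (norm_indicator_le_norm_self _ _).trans (hB _ _)
    · refine (hi.const_mul B).mono'
        hGm.norm.integral_prod_right'.aestronglyMeasurable (ae_of_all _ fun a => ?_)
      rw [Real.norm_of_nonneg (integral_nonneg fun _ => norm_nonneg _)]
      simp only [hGa, norm_indicator_eq_indicator_norm]
      rw [integral_indicator measurableSet_Ioi]
      have h1 := norm_setIntegral_le_of_norm_le_const (μ := ν) (s := Ioi a) (f := fun u => ‖K a u‖)
        (C := B) (measure_lt_top _ _) (fun u _ => by rw [norm_norm]; exact hB _ _)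
      exact (le_abs_self _).trans h1
  have h2 : (fun a => ∫ u, G (a, u) ∂ν) = fun a => ∫ u in Ioi a, K a u ∂ν := by
    funext a
    simp only [hGa]
    rw [integral_indicator measurableSet_Ioi]
  constructor
  · rw [← h2]; exact hint.integral_prod_left
  · rw [← h2, integral_integral_swap (f := fun a u => G (a, u)) hint]
    refine integral_congr_ae (ae_of_all _ fun u => ?_)
    simp only [hGu]
    rw [integral_indicator measurableSet_Iio, Measure.restrict_restrict measurableSet_Iio]
    congr 2
    ext a; simp [and_comm]

lemma integral_mul_tail {E : Type*} [NormedAddCommGroup E] [NormedSpace ℝ E] [CompleteSpace E]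
    (hi : IntegrableOn (tail ν) (Ioi 0)) {f : ℝ → E} (hf : StronglyMeasurable f) {B : ℝ}
    (hB : ∀ a, ‖f a‖ ≤ B) :
    ∫ a in Ioi 0, tail ν a • f a = ∫ u, (∫ a in Ioo 0 u, f a) ∂ν := by
  rw [← (integral_tail_swap hi (K := fun a _ => f a)
    (hf.comp_measurable measurable_fst) (fun a _ => hB a)).2]
  simp [tail]

end Tail

/-! ### The key renewal theorem -/

/-- `Z` solves a bounded renewal equation, whose inhomogeneity `g` is dominated by the tail of the
law of the sojourn times. -/
structure IsRenewal (ψ Z g : ℝ → ℝ) (B : ℝ) : Prop where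
  density : IsHalfLineDensity ψ
  tail_integrable : IntegrableOn (tail (halfLaw ψ)) (Ioi 0)
  measurable_Z : Measurable Z
  measurable_g : Measurable g
  Z_neg : ∀ r, r < 0 → Z r = 0
  abs_Z_le : ∀ r, |Z r| ≤ B
  g_neg : ∀ r, r < 0 → g r = 0
  abs_g_le : ∀ r, 0 ≤ r → |g r| ≤ B * tail (halfLaw ψ) r
  eqn : ∀ r, Z r = g r + ∫ u, Z (r - u) ∂halfLaw ψ

namespace IsRenewal

variable {ψ Z g : ℝ → ℝ} {B : ℝ}

/-- The convolution term of a renewal equation. -/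
def past (ψ Z : ℝ → ℝ) (r : ℝ) : ℝ := ∫ u, Z (r - u) ∂halfLaw ψ

lemma neg (hR : IsRenewal ψ Z g B) : IsRenewal ψ (fun r => -Z r) (fun r => -g r) B where
  density := hR.density
  tail_integrable := hR.tail_integrable
  measurable_Z := hR.measurable_Z.neg
  measurable_g := hR.measurable_g.neg
  Z_neg r hr := by simp [hR.Z_neg r hr]
  abs_Z_le r := by rw [abs_neg]; exact hR.abs_Z_le r
  g_neg r hr := by simp [hR.g_neg r hr]
  abs_g_le r hr := by rw [abs_neg]; exact hR.abs_g_le r hr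
  eqn r := by rw [hR.eqn r, integral_neg]; ring

lemma B_nonneg (hR : IsRenewal ψ Z g B) : 0 ≤ B := (abs_nonneg _).trans (hR.abs_Z_le 0)

lemma tendsto_g (hR : IsRenewal ψ Z g B) : Tendsto g atTop (𝓝 0) := by
  have := hR.density.isProbabilityMeasure
  refine squeeze_zero_norm' ?_ (by simpa using (tendsto_tail (ν := halfLaw ψ)).const_mul B)
  filter_upwards [eventually_ge_atTop 0] with r hr using hR.abs_g_le r hr

lemma abs_g_le' (hR : IsRenewal ψ Z g B) (r : ℝ) : |g r| ≤ B := by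
  have := hR.density.isProbabilityMeasure
  rcases lt_or_ge r 0 with hr | hr
  · rw [hR.g_neg r hr, abs_zero]; exact hR.B_nonneg
  · exact (hR.abs_g_le r hr).trans (mul_le_of_le_one_right hR.B_nonneg (tail_le_one _))

lemma abs_past_le (hR : IsRenewal ψ Z g B) (r : ℝ) : |past ψ Z r| ≤ B := by
  have := hR.density.isProbabilityMeasure
  refine (norm_integral_le_of_norm_le_const (f := fun u => Z (r - u)) (C := B)
    (ae_of_all _ fun u => hR.abs_Z_le (r - u))).trans ?_
  simp

/-- The convolution of a bounded function with an integrable density inherits a modulus of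
continuity from the continuity of translations in `L¹`. The solution `Z` itself need not be
continuous, so the argument below works with `past`. -/
lemma uniformContinuous_past (hR : IsRenewal ψ Z g B) : UniformContinuous (past ψ Z) := by
  have hψ := hR.density
  have hZm := hR.measurable_Z
  have hform : ∀ r, past ψ Z r = ∫ t, ψ (r - t) * Z t := by
    intro r
    rw [past, IsWalk.integral_halfLaw hψ.measurable hψ.nonneg, ← integral_sub_left_eq_self _ volume r]
    simp
  have hint : ∀ r, Integrable fun t => ψ (r - t) * Z t := fun r =>
    (hψ.integrable.comp_sub_left r).mul_bdd (c := B) hZm.aestronglyMeasurable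
      (ae_of_all _ fun t => hR.abs_Z_le t)
  have hle : ∀ x y, |past ψ Z x - past ψ Z y| ≤ B * ∫ t, |ψ ((x - y) + t) - ψ t| := by
    intro x y
    rw [hform, hform, ← integral_sub (hint x) (hint y), ← integral_const_mul]
    refine abs_integral_le_integral_abs.trans ?_
    rw [← integral_sub_left_eq_self _ volume y]
    refine integral_mono ?_ ?_ fun t => ?_
    · exact (((hint x).sub (hint y)).abs).comp_sub_left y
    · exact (((hψ.integrable.comp_add_left (x - y)).sub hψ.integrable).abs).const_mul B
    · simp only
      rw [← sub_mul, abs_mul, mul_comm, show x - (y - t) = x - y + t by ring,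
        show y - (y - t) = t by ring]
      exact mul_le_mul_of_nonneg_right (hR.abs_Z_le _) (abs_nonneg _)
  have hlim := (tendsto_integral_translate_sub hψ.integrable).const_mul B
  rw [mul_zero] at hlim
  rw [Metric.uniformContinuous_iff]
  intro ε hε
  obtain ⟨δ, hδ, hδε⟩ := Metric.eventually_nhds_iff.1 (hlim.eventually_lt_const hε)
  refine ⟨δ, hδ, fun x y hxy => ?_⟩
  rw [Real.dist_eq] at hxy ⊢
  refine (hle x y).trans_lt (hδε ?_)
  rwa [Real.dist_eq, sub_zero]

lemma eqn' (hR : IsRenewal ψ Z g B) (r : ℝ) : Z r = g r + past ψ Z r := hR.eqn r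

/-- If the convolution term is asymptotically maximal along a sequence, then it is also
asymptotically maximal along the sequence shifted by a point of the support of the law. -/
lemma tendsto_past_sub (hR : IsRenewal ψ Z g B) {L : ℝ} {q : ℕ → ℝ} (hq : Tendsto q atTop atTop)
    (hL : Tendsto (fun k => past ψ Z (q k)) atTop (𝓝 L))
    (hsup : ∀ ε > 0, ∀ᶠ r in atTop, past ψ Z r ≤ L + ε) {w : ℝ}
    (hw : w ∈ (halfLaw ψ).support) :
    Tendsto (fun k => past ψ Z (q k - w)) atTop (𝓝 L) := by
  have := hR.density.isProbabilityMeasure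
  set ν := halfLaw ψ
  set W := past ψ Z with hWdef
  have hWc : Continuous W := hR.uniformContinuous_past.continuous
  have hgm := hR.measurable_g
  have hqu : ∀ u, Tendsto (fun k => q k - u) atTop atTop := fun u =>
    tendsto_atTop_add_const_right _ (-u) hq
  have hWi : ∀ k, Integrable (fun u => W (q k - u)) ν := fun k =>
    Integrable.of_bound (by fun_prop) B (ae_of_all _ fun u => hR.abs_past_le _)
  have hgi : ∀ k, Integrable (fun u => g (q k - u)) ν := fun k =>
    Integrable.of_bound (hgm.comp (by fun_prop)).aestronglyMeasurable B
      (ae_of_all _ fun u => hR.abs_g_le' (q k - u))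
  have hg0 : Tendsto (fun k => ∫ u, g (q k - u) ∂ν) atTop (𝓝 0) := by
    have := tendsto_integral_of_dominated_convergence (μ := ν) (F := fun k u => g (q k - u))
      (f := fun _ => 0) (fun _ => B) (fun k => (hgi k).aestronglyMeasurable) (integrable_const _)
      (fun k => ae_of_all _ fun u => hR.abs_g_le' _)
      (ae_of_all _ fun u => hR.tendsto_g.comp (hqu u))
    simpa using this
  -- Averaging the renewal equation against `ν` gives `W (q k)` as the mean of `W (q k - u)` plus a
  -- vanishing term, so the mean deficit from `L` tends to zero.
  have hX0 : Tendsto (fun k => ∫ u, (L - W (q k - u)) ∂ν) atTop (𝓝 0) := by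
    have h1 : ∀ k, ∫ u, (L - W (q k - u)) ∂ν = L - W (q k) + ∫ u, g (q k - u) ∂ν := by
      intro k
      have h2 : W (q k) = ∫ u, g (q k - u) ∂ν + ∫ u, W (q k - u) ∂ν := by
        rw [← integral_add (hgi k) (hWi k)]
        simp only [hWdef, past, ← hR.eqn]
        rfl
      rw [integral_sub (integrable_const _) (hWi k), h2]
      simp only [integral_const, probReal_univ, one_smul]
      ring
    simp only [h1]
    simpa using (hL.const_sub L).add hg0
  -- Asymptotically `W` does not exceed `L`, so the deficit has no negative part in the limit and
  -- its convergence to zero holds in `L¹(ν)`.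
  have hN0 : Tendsto (fun k => ∫ u, max (W (q k - u) - L) 0 ∂ν) atTop (𝓝 0) := by
    have := tendsto_integral_of_dominated_convergence (μ := ν)
      (F := fun k u => max (W (q k - u) - L) 0)
      (f := fun _ => 0) (fun _ => B + |L|) (fun k => by fun_prop) (integrable_const _)
      (fun k => ae_of_all _ fun u => ?_) (ae_of_all _ fun u => ?_)
    · simpa using this
    · rw [Real.norm_of_nonneg (le_max_right _ _)]
      refine max_le ?_ (add_nonneg hR.B_nonneg (abs_nonneg _))
      have h1 := (abs_le.1 (hR.abs_past_le (q k - u))).2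
      have h2 := neg_abs_le L
      linarith
    · refine tendsto_order.2 ⟨fun a ha => Eventually.of_forall fun k => ha.trans_le
        (le_max_right _ _), fun a ha => ?_⟩
      filter_upwards [(hqu u).eventually (hsup (a / 2) (by linarith))] with k hk
      exact max_lt (by linarith) ha
  have habs : Tendsto (fun k => ∫ u, |L - W (q k - u)| ∂ν) atTop (𝓝 0) := by
    have h1 : ∀ k, ∫ u, |L - W (q k - u)| ∂ν
        = ∫ u, (L - W (q k - u)) ∂ν + 2 * ∫ u, max (W (q k - u) - L) 0 ∂ν := by
      intro k
      have hs : Integrable (fun u => W (q k - u) - L) ν := (hWi k).sub (integrable_const _)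
      have hs' : Integrable (fun u => L - W (q k - u)) ν := (integrable_const _).sub (hWi k)
      rw [← integral_const_mul, ← integral_add hs' (hs.pos_part.const_mul 2)]
      refine integral_congr_ae (ae_of_all _ fun u => ?_)
      simp only
      rcases le_total (W (q k - u)) L with h | h
      · rw [abs_of_nonneg (by linarith), max_eq_right (by linarith)]; ring
      · rw [abs_of_nonpos (by linarith), max_eq_left (by linarith)]; ring
    simp only [h1]
    simpa using hX0.add (hN0.const_mul 2)
  rw [Metric.tendsto_nhds]
  intro ε hε
  obtain ⟨δ, hδ, hδε⟩ := Metric.uniformContinuous_iff.1 hR.uniformContinuous_past (ε / 2)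
    (by linarith)
  -- A ball around a support point carries positive mass. Convergence in mean together with uniform
  -- continuity therefore gives convergence at `w` itself.
  have hm : 0 < ν.real (Metric.ball w δ) := by
    refine ENNReal.toReal_pos ?_ (measure_ne_top _ _)
    exact ((Measure.mem_support_iff_forall w).1 hw _ (Metric.ball_mem_nhds w hδ)).ne'
  set m := ν.real (Metric.ball w δ)
  filter_upwards [habs.eventually_lt_const (show (0 : ℝ) < m * (ε / 2) by positivity)] with k hk
  rw [Real.dist_eq, abs_sub_comm]
  have hXi : Integrable (fun u => |L - W (q k - u)|) ν :=
    ((integrable_const L).sub (hWi k)).abs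
  have h1 : m * |L - W (q k - w)| ≤ ∫ u in Metric.ball w δ, (|L - W (q k - u)| + ε / 2) ∂ν := by
    have : m * |L - W (q k - w)| = ∫ u in Metric.ball w δ, |L - W (q k - w)| ∂ν := by
      simp [m]
    rw [this]
    refine setIntegral_mono_on (integrableOn_const (by simp))
      (hXi.integrableOn.add (integrableOn_const (by simp))) measurableSet_ball fun u hu => ?_
    have hd : dist (q k - u) (q k - w) < δ := by
      rw [dist_sub_left]; exact hu
    have h2 := hδε hd
    rw [Real.dist_eq] at h2
    have h3 : L - W (q k - w) = (L - W (q k - u)) + (W (q k - u) - W (q k - w)) := by ring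
    rw [h3]
    exact (abs_add_le _ _).trans (by linarith)
  have h2 : ∫ u in Metric.ball w δ, (|L - W (q k - u)| + ε / 2) ∂ν
      ≤ ∫ u, |L - W (q k - u)| ∂ν + m * (ε / 2) := by
    rw [integral_add hXi.integrableOn (integrableOn_const (by simp))]
    refine add_le_add (setIntegral_le_integral hXi (ae_of_all _ fun _ => abs_nonneg _)) ?_
    simp [m]
  have h3 : m * |L - W (q k - w)| < m * ε := by nlinarith
  exact lt_of_mul_lt_mul_left h3 hm.le

/-- The law is absolutely continuous, so its support has positive Lebesgue measure; by Steinhaus its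
difference set contains a neighbourhood of zero. -/
lemma exists_support_near (hψ : IsHalfLineDensity ψ) {δ : ℝ} (hδ : 0 < δ) :
    ∃ s s', s ∈ (halfLaw ψ).support ∧ s' ∈ (halfLaw ψ).support ∧ 0 ≤ s' ∧ 0 < s - s' ∧
      s - s' < δ := by
  have := hψ.isProbabilityMeasure
  have hpos : 0 < volume (halfLaw ψ).support := by
    rw [pos_iff_ne_zero]
    intro h0
    have h1 := IsHalfLineDensity.absolutelyContinuous ψ h0
    have h2 := Measure.measure_compl_support (μ := halfLaw ψ)
    have h3 : halfLaw ψ univ ≤ 0 := by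
      rw [← union_compl_self (halfLaw ψ).support]
      exact (measure_union_le _ _).trans (by rw [h1, h2, zero_add])
    simp at h3
  have h1 := Measure.sub_mem_nhds_zero_of_addHaar_pos volume _
    Measure.isClosed_support.measurableSet hpos
  obtain ⟨ε, hε, hsub⟩ := Metric.mem_nhds_iff.1 h1
  have hmem : min ε δ / 2 ∈ Metric.ball (0 : ℝ) ε := by
    have := lt_min hε hδ
    rw [Metric.mem_ball, dist_zero_right, Real.norm_of_nonneg (by linarith)]
    linarith [min_le_left ε δ]
  obtain ⟨s, hs, s', hs', hd⟩ := hsub hmem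
  have hmin := lt_min hε hδ
  have hsub0 : (halfLaw ψ).support ⊆ Ici 0 :=
    Measure.support_subset_of_isClosed isClosed_Ici
      (hψ.ae_pos.mono fun _ h => le_of_lt h)
  refine ⟨s, s', hs, hs', hsub0 hs', ?_, ?_⟩
  · simp only at hd; linarith
  · simp only at hd; linarith [min_le_right ε δ]

/-- A set closed under adding two points `s' < s` of the half-line at distance less than `δ` is
eventually `δ`-dense. -/
lemma exists_mem_near {S : Set ℝ} (h0 : (0 : ℝ) ∈ S) {s s' : ℝ} (hs' : 0 ≤ s') (hd : 0 < s - s')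
    (hS : ∀ x ∈ S, x + s ∈ S) (hS' : ∀ x ∈ S, x + s' ∈ S) {u : ℝ} (hu : s ^ 2 / (s - s') ≤ u) :
    ∃ x ∈ S, |u - x| < s - s' := by
  have hs : 0 < s := by linarith
  have hmul : ∀ m : ℕ, (m : ℝ) * s ∈ S := by
    intro m
    induction m with
    | zero => simpa using h0
    | succ m ih => push_cast; rw [add_mul, one_mul]; exact hS _ ih
  have hcomb : ∀ m n : ℕ, (m : ℝ) * s + n * s' ∈ S := by
    intro m n
    induction n with
    | zero => simpa using hmul m
    | succ n ih =>
      push_cast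
      rw [add_mul, one_mul, ← add_assoc]; exact hS' _ ih
  have hu0 : 0 ≤ u := le_trans (by positivity) hu
  -- Overshoot `u` with `N` steps of length `s`, by less than `s`, then replace `j` of them by steps
  -- of length `s'`, each of which lowers the sum by `s - s'`.
  set N := ⌈u / s⌉₊ with hN
  have hN1 : u ≤ N * s := (div_le_iff₀ hs).1 (Nat.le_ceil _)
  have hN2 : N * s < u + s := by
    have := Nat.ceil_lt_add_one (div_nonneg hu0 hs.le)
    rw [← hN, ← sub_lt_iff_lt_add, lt_div_iff₀ hs] at this
    linarith
  set j := ⌊(N * s - u) / (s - s')⌋₊ with hj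
  have hj0 : 0 ≤ (N * s - u) / (s - s') := div_nonneg (by linarith) hd.le
  have hj1 : j * (s - s') ≤ N * s - u := (le_div_iff₀ hd).1 (Nat.floor_le hj0)
  have hj2 : N * s - u < (j + 1) * (s - s') := (div_lt_iff₀ hd).1 (Nat.lt_floor_add_one _)
  -- There must be enough steps to replace: `j * (s - s') ≤ s`, and the threshold `s ^ 2 / (s - s')`
  -- for `u` makes `N` at least `s / (s - s')`.
  have hjN : j ≤ N := by
    have h1 : (j : ℝ) * (s - s') * s ≤ N * s * (s - s') := by
      have h2 : (j : ℝ) * (s - s') * s ≤ s * s := by nlinarith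
      have h3 : s ^ 2 ≤ u * (s - s') := (div_le_iff₀ hd).1 hu
      nlinarith
    have h4 : (j : ℝ) ≤ N := by
      by_contra hcon
      push Not at hcon
      have : (N : ℝ) * (s * (s - s')) < j * (s * (s - s')) :=
        mul_lt_mul_of_pos_right hcon (by positivity)
      nlinarith
    exact_mod_cast h4
  refine ⟨_, hcomb (N - j) j, ?_⟩
  rw [Nat.cast_sub hjN, abs_lt]
  constructor <;> nlinarith

/-- The balance identity of a renewal equation. -/
lemma integral_mul_tail_eq (hR : IsRenewal ψ Z g B) (R : ℝ) :
    ∫ a in Ici 0, Z (R - a) * tail (halfLaw ψ) a = ∫ r in Icc 0 R, g r := by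
  have := hR.density.isProbabilityMeasure
  set ν := halfLaw ψ
  have hZm := hR.measurable_Z
  have hgm := hR.measurable_g
  have hgi : IntegrableOn g (Icc 0 R) := IntegrableOn.of_bound (by simp) (by fun_prop) B
    (ae_of_all _ fun r => hR.abs_g_le' r)
  have hZi : IntegrableOn Z (Icc 0 R) := IntegrableOn.of_bound (by simp) (by fun_prop) B
    (ae_of_all _ fun r => hR.abs_Z_le r)
  have hPi : IntegrableOn (past ψ Z) (Icc 0 R) :=
    hR.uniformContinuous_past.continuous.continuousOn.integrableOn_compact isCompact_Icc
  have h1 : ∫ r in Icc 0 R, Z r = (∫ r in Icc 0 R, g r) + ∫ r in Icc 0 R, past ψ Z r := by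
    rw [← integral_add hgi hPi]
    exact setIntegral_congr_fun measurableSet_Icc fun r _ => hR.eqn' r
  have h2 : ∫ r in Icc 0 R, past ψ Z r = ∫ u, (∫ r in Icc 0 R, Z (r - u)) ∂ν := by
    refine integral_integral_swap (f := fun r u => Z (r - u)) ?_
    have hm : Measurable fun p : ℝ × ℝ => Z (p.1 - p.2) := hZm.comp (by fun_prop)
    exact Integrable.of_bound hm.aestronglyMeasurable B
      (ae_of_all _ fun p => hR.abs_Z_le (p.1 - p.2))
  -- After the shift `t = r - u`, a value `Z t` with `t` in `[0, R]` contributes exactly when `u ≤ R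
  -- - t`. Integrating over `u` gives the weight `1 - tail ν (R - t)`, and subtraction from the
  -- integrated equation leaves the tail.
  have h3 : ∀ᵐ u ∂ν, ∫ r in Icc 0 R, Z (r - u)
      = ∫ t in Icc 0 R, (Iic (R - t)).indicator (fun _ => Z t) u := by
    filter_upwards [hR.density.ae_pos] with u hu
    rw [← integral_indicator measurableSet_Icc, ← integral_indicator measurableSet_Icc,
      ← integral_add_right_eq_self _ u]
    refine integral_congr_ae (ae_of_all _ fun t => ?_)
    simp only [Set.indicator, mem_Icc, mem_Iic, add_sub_cancel_right]
    rcases lt_or_ge t 0 with ht | ht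
    · simp [hR.Z_neg t ht]
    · by_cases htu : t + u ≤ R
      · rw [if_pos ⟨by linarith, htu⟩, if_pos ⟨ht, by linarith⟩, if_pos (by linarith)]
      · rw [if_neg (fun h => htu h.2), if_neg (fun h : u ≤ R - t => htu (by linarith))]
        simp
  have h4 : ∫ u, (∫ t in Icc 0 R, (Iic (R - t)).indicator (fun _ => Z t) u) ∂ν
      = ∫ t in Icc 0 R, Z t * (1 - tail ν (R - t)) := by
    rw [integral_integral_swap]
    · refine integral_congr_ae (ae_of_all _ fun t => ?_)
      simp only
      rw [integral_indicator measurableSet_Iic, setIntegral_const, smul_eq_mul, mul_comm, tail,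
        ← probReal_compl_eq_one_sub measurableSet_Ioi, compl_Ioi]
    · have hm : Measurable fun p : ℝ × ℝ => (Iic (R - p.2)).indicator (fun _ => Z p.2) p.1 := by
        have : (fun p : ℝ × ℝ => (Iic (R - p.2)).indicator (fun _ => Z p.2) p.1)
            = ({p : ℝ × ℝ | p.1 ≤ R - p.2}).indicator fun p => Z p.2 := rfl
        rw [this]
        exact (hZm.comp measurable_snd).indicator
          (measurableSet_le measurable_fst (measurable_const.sub measurable_snd))
      refine Integrable.of_bound hm.aestronglyMeasurable B (ae_of_all _ fun p => ?_)
      exact (norm_indicator_le_norm_self (fun _ => Z p.2) p.1).trans (hR.abs_Z_le p.2)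
  have hHm : Measurable (tail ν) := measurable_tail
  have hZH : IntegrableOn (fun t => Z t * tail ν (R - t)) (Icc 0 R) := by
    refine IntegrableOn.of_bound (by simp) (by fun_prop) B (ae_of_all _ fun r => ?_)
    rw [norm_mul, Real.norm_of_nonneg (tail_nonneg _ _)]
    exact (mul_le_of_le_one_right (norm_nonneg _) (tail_le_one _)).trans (hR.abs_Z_le r)
  have h5 : ∫ t in Icc 0 R, Z t * tail ν (R - t) = ∫ r in Icc 0 R, g r := by
    have h6 : ∫ t in Icc 0 R, Z t * (1 - tail ν (R - t))
        = (∫ t in Icc 0 R, Z t) - ∫ t in Icc 0 R, Z t * tail ν (R - t) := by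
      rw [← integral_sub hZi hZH]
      simp only [mul_sub, mul_one]
    rw [h2, integral_congr_ae h3, h4, h6] at h1
    linarith
  rw [← h5, ← integral_indicator measurableSet_Icc, ← integral_indicator measurableSet_Ici,
    ← integral_sub_left_eq_self _ volume R]
  refine integral_congr_ae (ae_of_all _ fun t => ?_)
  simp only [Set.indicator, mem_Icc, mem_Ici, sub_sub_cancel]
  rcases lt_or_ge t 0 with ht | ht
  · simp [hR.Z_neg t ht]
  · by_cases htR : t ≤ R
    · rw [if_pos (by linarith), if_pos ⟨ht, htR⟩]
    · rw [if_neg (fun h : 0 ≤ R - t => htR (by linarith)), if_neg (fun h => htR h.2)]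

lemma integrableOn_g (hR : IsRenewal ψ Z g B) : IntegrableOn g (Ioi 0) := by
  have hgm := hR.measurable_g
  refine (hR.tail_integrable.const_mul B).mono' hgm.aestronglyMeasurable ?_
  filter_upwards [ae_restrict_mem measurableSet_Ioi] with r hr
  exact hR.abs_g_le r (le_of_lt hr)

/-- The asymptotic maximum of the convolution term is at most the value expected in the limit. -/
lemma mul_le_integral (hR : IsRenewal ψ Z g B) {L : ℝ} {q : ℕ → ℝ} (hq : Tendsto q atTop atTop)
    (hL : Tendsto (fun k => past ψ Z (q k)) atTop (𝓝 L))
    (hsup : ∀ ε > 0, ∀ᶠ r in atTop, past ψ Z r ≤ L + ε) :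
    L * ∫ a in Ioi 0, tail (halfLaw ψ) a ≤ ∫ r in Ioi 0, g r := by
  have := hR.density.isProbabilityMeasure
  set ν := halfLaw ψ
  have hZm := hR.measurable_Z
  have hHm : Measurable (tail ν) := measurable_tail
  have hqu : ∀ u, Tendsto (fun k => q k - u) atTop atTop := fun u =>
    tendsto_atTop_add_const_right _ (-u) hq
  set m := ∫ a in Ioi 0, tail ν a with hm
  have hm0 : 0 ≤ m := integral_nonneg fun a => tail_nonneg ν a
  have hHi : IntegrableOn (tail ν) (Ici 0) := by
    rw [integrableOn_Ici_iff_integrableOn_Ioi]; exact hR.tail_integrable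
  -- The three losses of `η` come from the limit along the sequence, from uniform continuity of
  -- `past`, and from the vanishing inhomogeneity.
  have key : ∀ η > 0, (L - 3 * η) * m ≤ ∫ r in Ioi 0, g r := by
    intro η hη
    obtain ⟨δ, hδ, hδη⟩ := Metric.uniformContinuous_iff.1 hR.uniformContinuous_past η hη
    obtain ⟨s, s', hs, hs', hs0, hd, hdδ⟩ := exists_support_near hR.density hδ
    set A := s ^ 2 / (s - s') with hA
    -- The shifts that preserve asymptotic maximality; this set contains 0 and is closed under
    -- adding support points.
    set S : Set ℝ := {u | Tendsto (fun k => past ψ Z (q k - u)) atTop (𝓝 L)} with hS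
    have hadd : ∀ w ∈ ν.support, ∀ x ∈ S, x + w ∈ S := by
      intro w hw x hx
      have := hR.tendsto_past_sub (hqu x) hx hsup hw
      simpa only [hS, mem_ofPred_eq, sub_sub] using this
    have hlow : ∀ u, A ≤ u → ∀ᶠ k in atTop, L - 3 * η ≤ Z (q k - u) := by
      intro u hu
      obtain ⟨x, hxS, hx⟩ := exists_mem_near (S := S) (by simpa [hS] using hL) hs0 hd (hadd s hs)
        (hadd s' hs') hu
      have h1 : Tendsto (fun k => past ψ Z (q k - x)) atTop (𝓝 L) := hxS
      have hg := (hR.tendsto_g.comp (hqu u)).eventually_const_lt (show -η < 0 by linarith)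
      filter_upwards [h1.eventually_const_lt (show L - η < L by linarith), hg] with k hk1 hk2
      have h2 : dist (q k - u) (q k - x) < δ := by
        rw [dist_sub_left, Real.dist_eq]; linarith
      have h3 := hδη h2
      rw [Real.dist_eq, abs_lt] at h3
      rw [hR.eqn']
      simp only [Function.comp] at hk2
      linarith [h3.1]
    -- Only a lower bound on `Z` is known. Cutting off at `L - 3 * η` makes the integrand eventually
    -- constant in `k`, and the extra shift by `A` makes the lower bound available for every `a ≥
    -- 0`.
    have hlim1 : Tendsto (fun k => ∫ a in Ici 0, min (Z (q k - A - a)) (L - 3 * η) * tail ν a) atTop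
        (𝓝 (∫ a in Ici 0, (L - 3 * η) * tail ν a)) := by
      refine tendsto_integral_of_dominated_convergence
        (fun a => (B + |L - 3 * η|) * tail ν a) (fun k => by fun_prop) (hHi.const_mul _)
        (fun k => ae_of_all _ fun a => ?_) ?_
      · rw [norm_mul, Real.norm_of_nonneg (tail_nonneg ν a)]
        refine mul_le_mul_of_nonneg_right ?_ (tail_nonneg ν a)
        rw [Real.norm_eq_abs]
        refine abs_min_le_max_abs_abs.trans (max_le ?_ ?_)
        · linarith [hR.abs_Z_le (q k - A - a), abs_nonneg (L - 3 * η)]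
        · linarith [hR.B_nonneg]
      · filter_upwards [ae_restrict_mem measurableSet_Ici] with a ha
        refine Tendsto.mul_const _ (tendsto_const_nhds.congr' ?_)
        filter_upwards [hlow (A + a) (by linarith [mem_Ici.1 ha])] with k hk
        rw [min_eq_right]
        rwa [sub_sub]
    have hlim2 : Tendsto (fun k => ∫ r in Icc 0 (q k - A), g r) atTop (𝓝 (∫ r in Ioi 0, g r)) := by
      have := intervalIntegral_tendsto_integral_Ioi 0 hR.integrableOn_g (hqu A)
      refine this.congr' ?_
      filter_upwards [(hqu A).eventually_ge_atTop 0] with k hk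
      rw [intervalIntegral.integral_of_le hk, integral_Icc_eq_integral_Ioc]
    have hle : ∀ k, ∫ a in Ici 0, min (Z (q k - A - a)) (L - 3 * η) * tail ν a
        ≤ ∫ r in Icc 0 (q k - A), g r := by
      intro k
      rw [← hR.integral_mul_tail_eq]
      refine integral_mono ?_ ?_ fun a =>
        mul_le_mul_of_nonneg_right (min_le_left _ _) (tail_nonneg ν a)
      · refine hHi.bdd_mul (c := B + |L - 3 * η|)
          (((hZm.comp (measurable_const.sub measurable_id)).min measurable_const).aestronglyMeasurable)
          (ae_of_all _ fun a => ?_)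
        rw [Real.norm_eq_abs]
        refine abs_min_le_max_abs_abs.trans (max_le ?_ ?_)
        · linarith [hR.abs_Z_le (q k - A - a), abs_nonneg (L - 3 * η)]
        · linarith [hR.B_nonneg]
      · exact hHi.bdd_mul (c := B)
          (hZm.comp (measurable_const.sub measurable_id)).aestronglyMeasurable
          (ae_of_all _ fun a => hR.abs_Z_le (q k - A - a))
    have := le_of_tendsto_of_tendsto' hlim1 hlim2 hle
    rwa [integral_const_mul, integral_Ici_eq_integral_Ioi] at this
  by_contra hcon
  push Not at hcon
  -- With this `η` the loss `3 * η * m` is less than half of the supposed excess; the denominator `m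
  -- + 1` avoids a case distinction on `m = 0`.
  have h1 := key ((L * m - ∫ r in Ioi 0, g r) / (6 * (m + 1))) (div_pos (by linarith) (by linarith))
  set D := L * m - ∫ r in Ioi 0, g r with hD
  have hDpos : 0 < D := by linarith
  have h2 : 3 * (D / (6 * (m + 1))) * m < D := by
    have : 3 * (D / (6 * (m + 1))) * m = D * (m / (2 * (m + 1))) := by field_simp; ring
    rw [this]
    refine mul_lt_of_lt_one_right hDpos ?_
    rw [div_lt_one (by linarith)]
    linarith
  nlinarith

lemma eventually_past_le (hR : IsRenewal ψ Z g B)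
    (hm : 0 < ∫ a in Ioi 0, tail (halfLaw ψ) a) {ε : ℝ} (hε : 0 < ε) :
    ∀ᶠ r in atTop, past ψ Z r
      ≤ (∫ r in Ioi 0, g r) / (∫ a in Ioi 0, tail (halfLaw ψ) a) + ε := by
  set c := (∫ r in Ioi 0, g r) / (∫ a in Ioi 0, tail (halfLaw ψ) a) with hc
  set W := past ψ Z
  set L := limsup W atTop with hL
  have hbdd : IsBoundedUnder (· ≤ ·) atTop W :=
    isBoundedUnder_of ⟨B, fun r => (abs_le.1 (hR.abs_past_le r)).2⟩
  have hcob : IsCoboundedUnder (· ≤ ·) atTop W :=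
    (isBoundedUnder_of ⟨-B, fun r => (abs_le.1 (hR.abs_past_le r)).1⟩ :
      IsBoundedUnder (· ≥ ·) atTop W).isCoboundedUnder_le
  have hsup : ∀ ε > 0, ∀ᶠ r in atTop, W r ≤ L + ε := fun ε hε =>
    (eventually_lt_of_limsup_lt (show limsup W atTop < L + ε by linarith) hbdd).mono
      fun r hr => hr.le
  -- Points going to infinity along which the limsup is attained.
  have hfreq : ∀ n : ℕ, ∃ x, (n : ℝ) ≤ x ∧ |W x - L| ≤ 1 / ((n : ℝ) + 1) := by
    intro n
    have hpos : (0 : ℝ) < 1 / ((n : ℝ) + 1) := by positivity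
    have h1 : ∃ᶠ r in atTop, L - 1 / ((n : ℝ) + 1) < W r :=
      frequently_lt_of_lt_limsup hcob (by linarith)
    obtain ⟨x, hx1, hx2, hx3⟩ :=
      (h1.and_eventually ((hsup _ hpos).and (eventually_ge_atTop (n : ℝ)))).exists
    exact ⟨x, hx3, abs_le.2 ⟨by linarith, by linarith⟩⟩
  choose q hq1 hq2 using hfreq
  have hq : Tendsto q atTop atTop := tendsto_atTop_mono hq1 tendsto_natCast_atTop_atTop
  have hqL : Tendsto (fun k => W (q k)) atTop (𝓝 L) := by
    rw [tendsto_iff_norm_sub_tendsto_zero]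
    exact squeeze_zero (fun _ => norm_nonneg _) hq2 tendsto_one_div_add_atTop_nhds_zero_nat
  have h1 := hR.mul_le_integral hq hqL hsup
  have hLc : L ≤ c := (le_div_iff₀ hm).2 h1
  filter_upwards [hsup ε hε] with r hr
  linarith

/-- The **key renewal theorem** for a sojourn time with a density and a finite mean. -/
theorem tendsto (hR : IsRenewal ψ Z g B) (hm : 0 < ∫ a in Ioi 0, tail (halfLaw ψ) a) :
    Tendsto Z atTop (𝓝 ((∫ r in Ioi 0, g r) / ∫ a in Ioi 0, tail (halfLaw ψ) a)) := by
  set c := (∫ r in Ioi 0, g r) / ∫ a in Ioi 0, tail (halfLaw ψ) a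
  have hW : Tendsto (past ψ Z) atTop (𝓝 c) := by
    rw [Metric.tendsto_nhds]
    intro ε hε
    -- The hypotheses are invariant under a change of sign, so the upper bound for `-Z` is the lower
    -- bound for `Z`.
    have hneg : ∀ r, past ψ (fun r => -Z r) r = -past ψ Z r := fun r => integral_neg _
    filter_upwards [hR.eventually_past_le hm (half_pos hε),
      hR.neg.eventually_past_le hm (half_pos hε)] with r h1 h2
    rw [hneg, integral_neg, neg_div] at h2
    rw [Real.dist_eq, abs_lt]
    constructor <;> linarith
  have := hR.tendsto_g.add hW
  rw [zero_add] at this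
  exact this.congr fun r => (hR.eqn' r).symm

end IsRenewal

/-! ### Convergence of the excess life to its stationary law -/

namespace IsWalk

variable {Ω : Type*} [MeasurableSpace Ω] {P : Measure Ω} {τ J : ℕ → Ω → ℝ} {ψ h : ℝ → ℝ}

lemma integrable_id_halfLaw (hw : IsWalk P τ J ψ h) (hi : Integrable (τ 0) P) :
    Integrable (fun u => u) (halfLaw ψ) := by
  rw [halfLaw, ← hw.law_wait 0]
  exact (integrable_map_measure aestronglyMeasurable_id (hw.measurable_wait 0).aemeasurable).2 hi

lemma integral_id_halfLaw (hw : IsWalk P τ J ψ h) : ∫ u, u ∂halfLaw ψ = ∫ ω, τ 0 ω ∂P := by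
  rw [halfLaw, ← hw.law_wait 0]
  exact integral_map (hw.measurable_wait 0).aemeasurable aestronglyMeasurable_id

/-- The excess life as a function of the sequence of sojourn times. -/
def seqExcess (p : ℝ × (ℕ → ℝ)) : ℝ := excessLife (fun k (a : ℕ → ℝ) => a k) p.1 p.2

lemma measurable_seqExcess : Measurable seqExcess :=
  measurable_excessLife fun k => measurable_pi_apply k

omit [MeasurableSpace Ω] in
lemma seqExcess_eq (r : ℝ) (f : ℕ → Ω → ℝ) (ω : Ω) :
    seqExcess (r, fun k => f k ω) = excessLife f r ω := rfl

variable [IsProbabilityMeasure P]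

lemma integral_wait_pos (hw : IsWalk P τ J ψ h) (hi : Integrable (τ 0) P) :
    0 < ∫ ω, τ 0 ω ∂P := by
  rw [integral_pos_iff_support_of_nonneg_ae
    (by filter_upwards [hw.ae_wait_pos] with ω hω using (hω 0).le) hi]
  have : Function.support (τ 0) =ᵐ[P] univ := by
    filter_upwards [hw.ae_wait_pos] with ω hω
    exact eq_iff_iff.2 (iff_of_true (hω 0).ne' trivial)
  rw [measure_congr this]
  simp

omit [IsProbabilityMeasure P] in
lemma integral_tail_wait (hw : IsWalk P τ J ψ h) (hi : Integrable (τ 0) P) :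
    ∫ a in Ioi 0, tail (halfLaw ψ) a = ∫ ω, τ 0 ω ∂P := by
  have := hw.density_wait.isProbabilityMeasure
  rw [integral_tail hw.density_wait.ae_pos (hw.integrable_id_halfLaw hi), hw.integral_id_halfLaw]

/-- The mean of a function of the excess life at `r`, extended by `0` to negative `r`. -/
def excessMean (P : Measure Ω) (τ : ℕ → Ω → ℝ) (f : ℝ → ℝ) (r : ℝ) : ℝ :=
  (Ici 0).indicator (fun r => ∫ ω, f (excessLife τ r ω) ∂P) r

/-- Conditioning on the first sojourn time `u`: if `u > r` the excess life is `u - r`; otherwise the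
process restarts and the excess life is that of an independent copy at time `r - u`. -/
lemma integral_excess_eq (hw : IsWalk P τ J ψ h) {f : ℝ → ℝ} (hf : Measurable f) {B : ℝ}
    (hB : ∀ a, |f a| ≤ B) {r : ℝ} (hr : 0 ≤ r) :
    ∫ ω, f (excessLife τ r ω) ∂P = ∫ u in Ioi r, f (u - r) ∂halfLaw ψ
      + ∫ u, excessMean P τ f (r - u) ∂halfLaw ψ := by
  have := hw.density_wait.isProbabilityMeasure
  set Φ : ℝ → (ℕ → ℝ) → ℝ := fun u a =>
    (Iic r).indicator (fun u => f (seqExcess (r - u, a))) u with hΦ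
  have hΦm : Measurable (Function.uncurry Φ) := by
    have h1 : Function.uncurry Φ = ({p : ℝ × (ℕ → ℝ) | p.1 ≤ r}).indicator fun p =>
        f (seqExcess (r - p.1, p.2)) := rfl
    rw [h1]
    have h2 : Measurable fun p : ℝ × (ℕ → ℝ) => (r - p.1, p.2) :=
      (measurable_const.sub measurable_fst).prodMk measurable_snd
    exact Measurable.indicator (hf.comp (measurable_seqExcess.comp h2))
      (measurableSet_le measurable_fst measurable_const)
  have hΦB : ∀ u a, |Φ u a| ≤ B := fun u a =>
    (norm_indicator_le_norm_self
      (fun u => f (seqExcess (r - u, a))) u).trans (hB _)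
  have hw' := hw.shift (0 + 1) 0
  have hind : IndepFun (τ 0) (fun ω k => τ (0 + 1 + k) ω) P := by
    have h1 := (hw.indepFun_jumpTime 0).comp (measurable_snd (α := ℝ) (β := ℝ))
      (measurable_fst (α := ℕ → ℝ) (β := ℕ → ℝ))
    convert! h1 using 1
    funext ω
    simp [jumpTime]
  have hlaw : P.map (fun ω k => τ (0 + 1 + k) ω) = P.map fun ω k => τ k ω := by
    have h1 := congrArg (Measure.map Prod.fst) (map_seqPair_congr hw' hw)
    rwa [Measure.map_map measurable_fst hw'.measurable_seqPair,
      Measure.map_map measurable_fst hw.measurable_seqPair] at h1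
  have h2 := integral_indepFun (hw.measurable_wait 0) hw'.measurable_wait_path
    hw.measurable_wait_path hind hlaw hΦm hΦB
  have hsplit : ∫ ω, f (excessLife τ r ω) ∂P
      = ∫ ω, ((Ioi r).indicator (fun u => f (u - r)) (τ 0 ω)
        + Φ (τ 0 ω) fun k => τ (0 + 1 + k) ω) ∂P := by
    refine integral_congr_ae ?_
    filter_upwards [hw.ae_good] with ω hω
    rcases lt_or_ge r (τ 0 ω) with h | h
    · simp only [hΦ]
      rw [excessLife_of_lt hω.1 hr h, indicator_of_mem (mem_Ioi.2 h),
        indicator_of_notMem (by simpa using h), add_zero]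
    · simp only [hΦ]
      rw [excessLife_of_le hω.1 hω.2.2 h, indicator_of_notMem (by simpa using h),
        indicator_of_mem (mem_Iic.2 h), zero_add, seqExcess_eq]
      simp only [zero_add, add_comm 1]
  have hm1 : Measurable ((Ioi r).indicator fun u => f (u - r)) :=
    (hf.comp (by fun_prop)).indicator measurableSet_Ioi
  rw [hsplit, integral_add, h2]
  · congr 1
    · rw [← integral_indicator measurableSet_Ioi, halfLaw, ← hw.law_wait 0,
        integral_map (hw.measurable_wait 0).aemeasurable hm1.aestronglyMeasurable]
    · have hm2 : Measurable fun u => ∫ ω, Φ u (fun k => τ k ω) ∂P := by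
        have : Measurable fun p : ℝ × Ω => Φ p.1 fun k => τ k p.2 :=
          hΦm.comp (measurable_fst.prodMk (hw.measurable_wait_path.comp measurable_snd))
        exact this.stronglyMeasurable.integral_prod_right'.measurable
      have h3 : ∀ u, excessMean P τ f (r - u) = ∫ ω, Φ u (fun k => τ k ω) ∂P := by
        intro u
        by_cases hu : u ≤ r
        · rw [excessMean, indicator_of_mem (by simpa using hu)]
          refine integral_congr_ae (ae_of_all _ fun ω => ?_)
          simp only [hΦ]
          rw [indicator_of_mem (mem_Iic.2 hu), seqExcess_eq]
        · rw [excessMean, indicator_of_notMem (by simpa using hu)]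
          simp only [hΦ]
          simp [indicator_of_notMem (show u ∉ Iic r from hu)]
      simp only [h3]
      rw [halfLaw, ← hw.law_wait 0,
        integral_map (hw.measurable_wait 0).aemeasurable hm2.aestronglyMeasurable]
  · exact Integrable.of_bound (hm1.comp (hw.measurable_wait 0)).aestronglyMeasurable B
      (ae_of_all _ fun ω => (norm_indicator_le_norm_self (fun u => f (u - r)) _).trans (hB _))
  · exact Integrable.of_bound (hΦm.comp ((hw.measurable_wait 0).prodMk
      hw'.measurable_wait_path)).aestronglyMeasurable B (ae_of_all _ fun ω => hΦB _ _)

lemma isRenewal_excessMean (hw : IsWalk P τ J ψ h) (hi : Integrable (τ 0) P) {f : ℝ → ℝ}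
    (hf : Measurable f) {B : ℝ} (hB : ∀ a, |f a| ≤ B) :
    IsRenewal ψ (excessMean P τ f)
      ((Ici 0).indicator fun r => ∫ u in Ioi r, f (u - r) ∂halfLaw ψ) B := by
  have := hw.density_wait.isProbabilityMeasure
  have hB0 : 0 ≤ B := (abs_nonneg _).trans (hB 0)
  constructor
  · exact hw.density_wait
  · exact integrableOn_tail hw.density_wait.ae_pos (hw.integrable_id_halfLaw hi)
  · have h1 := hf.comp (measurable_excessLife hw.measurable_wait)
    exact h1.stronglyMeasurable.integral_prod_right'.measurable.indicator measurableSet_Ici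
  · have h1 : Measurable fun p : ℝ × ℝ =>
        ({p : ℝ × ℝ | p.1 < p.2}).indicator (fun p => f (p.2 - p.1)) p :=
      (hf.comp (by fun_prop)).indicator (measurableSet_lt measurable_fst measurable_snd)
    refine Measurable.indicator ?_ measurableSet_Ici
    have h2 := h1.stronglyMeasurable.integral_prod_right' (ν := halfLaw ψ)
    have h3 : (fun r => ∫ u in Ioi r, f (u - r) ∂halfLaw ψ) = fun r => ∫ u,
        ({p : ℝ × ℝ | p.1 < p.2}).indicator (fun p => f (p.2 - p.1)) (r, u) ∂halfLaw ψ := by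
      funext r
      rw [← integral_indicator measurableSet_Ioi]
      rfl
    rw [h3]
    exact h2.measurable
  · intro r hr
    exact indicator_of_notMem (not_le.2 hr) _
  · intro r
    refine (norm_indicator_le_norm_self (fun r => ∫ ω, f (excessLife τ r ω) ∂P) r).trans ?_
    refine (norm_integral_le_of_norm_le_const (C := B) (ae_of_all _ fun ω => hB _)).trans ?_
    simp
  · intro r hr
    exact indicator_of_notMem (not_le.2 hr) _
  · intro r hr
    rw [indicator_of_mem (mem_Ici.2 hr)]
    refine (norm_integral_le_of_norm_le_const (f := fun u => f (u - r)) (C := B)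
      (ae_of_all _ fun u => hB (u - r))).trans ?_
    rw [measureReal_restrict_apply_univ, tail, mul_comm]
  · intro r
    rcases lt_or_ge r 0 with hr | hr
    · have hr' : r ∉ Ici (0 : ℝ) := not_le.2 hr
      rw [excessMean, indicator_of_notMem hr', indicator_of_notMem hr', zero_add, eq_comm]
      refine integral_eq_zero_of_ae ?_
      filter_upwards [hw.density_wait.ae_pos] with u hu
      exact indicator_of_notMem (show ¬ (0 : ℝ) ≤ r - u by linarith) _
    · rw [excessMean, indicator_of_mem (mem_Ici.2 hr), indicator_of_mem (mem_Ici.2 hr),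
        hw.integral_excess_eq hf hB hr]

/-- The density of the stationary excess life. -/
def statDensity (ψ : ℝ → ℝ) (μ : ℝ) : ℝ → ℝ :=
  (Ioi 0).indicator fun a => tail (halfLaw ψ) a / μ

lemma isHalfLineDensity_statDensity (hw : IsWalk P τ J ψ h) (hi : Integrable (τ 0) P) :
    IsHalfLineDensity (statDensity ψ (∫ ω, τ 0 ω ∂P)) := by
  have := hw.density_wait.isProbabilityMeasure
  have hμ := hw.integral_wait_pos hi
  have hti := integrableOn_tail hw.density_wait.ae_pos (hw.integrable_id_halfLaw hi)
  have hm : Measurable (statDensity ψ (∫ ω, τ 0 ω ∂P)) :=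
    (measurable_tail.div_const _).indicator measurableSet_Ioi
  have hnn : ∀ a, 0 ≤ statDensity ψ (∫ ω, τ 0 ω ∂P) a := fun a =>
    indicator_nonneg (fun a _ => div_nonneg (tail_nonneg _ a) hμ.le) a
  refine ⟨hm, hnn, fun a ha => indicator_of_notMem (not_lt.2 ha.le) _, ?_⟩
  have hint : Integrable (statDensity ψ (∫ ω, τ 0 ω ∂P)) :=
    IntegrableOn.integrable_indicator (f := fun a => tail (halfLaw ψ) a / ∫ ω, τ 0 ω ∂P)
      (hti.div_const _) measurableSet_Ioi
  rw [← ofReal_integral_eq_lintegral_ofReal hint (ae_of_all _ hnn), statDensity,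
    integral_indicator measurableSet_Ioi, integral_div, hw.integral_tail_wait hi, div_self hμ.ne',
    ENNReal.ofReal_one]

lemma integral_statDensity (hw : IsWalk P τ J ψ h) (hi : Integrable (τ 0) P) {E : Type*}
    [NormedAddCommGroup E] [NormedSpace ℝ E] [CompleteSpace E] {f : ℝ → E}
    (hf : StronglyMeasurable f) {B : ℝ} (hB : ∀ a, ‖f a‖ ≤ B) :
    ∫ a, f a ∂halfLaw (statDensity ψ (∫ ω, τ 0 ω ∂P))
      = (∫ ω, τ 0 ω ∂P)⁻¹ • ∫ u, (∫ a in Ioo 0 u, f a) ∂halfLaw ψ := by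
  have := hw.density_wait.isProbabilityMeasure
  have hd := hw.isHalfLineDensity_statDensity hi
  rw [integral_halfLaw hd.measurable hd.nonneg, ← integral_mul_tail
    (integrableOn_tail hw.density_wait.ae_pos (hw.integrable_id_halfLaw hi)) hf hB,
    ← integral_smul, ← integral_indicator measurableSet_Ioi]
  refine integral_congr_ae (ae_of_all _ fun a => ?_)
  by_cases ha : a ∈ Ioi (0 : ℝ)
  · simp only [statDensity, indicator_of_mem ha]
    rw [smul_smul, div_eq_inv_mul]
  · simp only [statDensity, indicator_of_notMem ha, zero_smul]

/-- The law of the excess life converges to the stationary law, on bounded measurable functions. -/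
theorem tendsto_integral_excess (hw : IsWalk P τ J ψ h) (hi : Integrable (τ 0) P) {f : ℝ → ℝ}
    (hf : Measurable f) {B : ℝ} (hB : ∀ a, |f a| ≤ B) :
    Tendsto (fun r => ∫ ω, f (excessLife τ r ω) ∂P) atTop
      (𝓝 (∫ a, f a ∂halfLaw (statDensity ψ (∫ ω, τ 0 ω ∂P)))) := by
  have := hw.density_wait.isProbabilityMeasure
  have hR := hw.isRenewal_excessMean hi hf hB
  have h1 := hR.tendsto (by rw [hw.integral_tail_wait hi]; exact hw.integral_wait_pos hi)
  have hti := integrableOn_tail hw.density_wait.ae_pos (hw.integrable_id_halfLaw hi)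
  -- Exchanging the integrations and reflecting `r` into `u - r` inside `(0, u)` turns the
  -- integrated inhomogeneity into the stationary mean, up to the factor `μ`.
  have h2 : ∫ r in Ioi 0, (Ici 0).indicator (fun r => ∫ u in Ioi r, f (u - r) ∂halfLaw ψ) r
      = ∫ u, (∫ a in Ioo 0 u, f a) ∂halfLaw ψ := by
    have h3 : ∫ r in Ioi 0, (Ici 0).indicator (fun r => ∫ u in Ioi r, f (u - r) ∂halfLaw ψ) r
        = ∫ r in Ioi 0, ∫ u in Ioi r, f (u - r) ∂halfLaw ψ :=
      setIntegral_congr_fun measurableSet_Ioi fun r hr =>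
        indicator_of_mem (mem_Ici.2 (le_of_lt hr)) _
    rw [h3, (integral_tail_swap hti (K := fun r u => f (u - r)) (B := B)
      (hf.comp (by fun_prop : Measurable fun p : ℝ × ℝ => p.2 - p.1)).stronglyMeasurable
      fun a u => hB _).2]
    refine integral_congr_ae (ae_of_all _ fun u => ?_)
    simp only
    rw [← integral_indicator measurableSet_Ioo, ← integral_indicator measurableSet_Ioo,
      ← integral_sub_left_eq_self _ volume u]
    refine integral_congr_ae (ae_of_all _ fun a => ?_)
    simp only [Set.indicator, mem_Ioo, sub_pos, sub_lt_self_iff, sub_sub_cancel]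
    simp only [and_comm]
  rw [h2, hw.integral_tail_wait hi] at h1
  rw [hw.integral_statDensity hi hf.stronglyMeasurable hB, smul_eq_mul, mul_comm, ← div_eq_mul_inv]
  refine h1.congr' ?_
  filter_upwards [eventually_ge_atTop 0] with r hr
  exact indicator_of_mem (mem_Ici.2 hr) _

lemma norm_cexp_neg_max_le {s : ℂ} (hs : 0 ≤ s.re) (a : ℝ) :
    ‖Complex.exp (-s * ((max a 0 : ℝ) : ℂ))‖ ≤ 1 := by
  rw [norm_exp_neg_mul, Real.exp_le_one_iff]
  nlinarith [le_max_right a 0]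

/-- The limit theorem for the excess life takes functions bounded on the whole line. Replacing `e`
by `max e 0` bounds the exponential there without changing its integral. -/
lemma lawLaplace_eq_max {κ : Measure ℝ} (hκ : ∀ᵐ e ∂κ, 0 < e) (s : ℂ) :
    lawLaplace κ s = ∫ e, Complex.exp (-s * ((max e 0 : ℝ) : ℂ)) ∂κ := by
  refine integral_congr_ae ?_
  filter_upwards [hκ] with e he
  rw [max_eq_left he.le]

lemma lawLaplace_statDensity (hw : IsWalk P τ J ψ h) (hi : Integrable (τ 0) P) {s : ℂ}
    (hs : 0 ≤ s.re) (hs0 : s ≠ 0) :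
    lawLaplace (halfLaw (statDensity ψ (∫ ω, τ 0 ω ∂P))) s
      = (1 - laplace ψ s) / (s * ((∫ ω, τ 0 ω ∂P : ℝ) : ℂ)) := by
  have := hw.density_wait.isProbabilityMeasure
  have hμ := hw.integral_wait_pos hi
  have hae : ∀ᵐ u ∂halfLaw ψ, 0 ≤ u := hw.density_wait.ae_pos.mono fun _ => le_of_lt
  rw [lawLaplace_eq_max (hw.isHalfLineDensity_statDensity hi).ae_pos, hw.integral_statDensity hi
    (B := 1) (Continuous.stronglyMeasurable (by fun_prop)) (norm_cexp_neg_max_le hs)]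
  have h1 : ∀ᵐ u ∂halfLaw ψ, ∫ a in Ioo 0 u, Complex.exp (-s * ((max a 0 : ℝ) : ℂ))
      = (1 - Complex.exp (-s * (u : ℂ))) / s := by
    filter_upwards [hae] with u hu
    have h2 : ∫ a in Ioo 0 u, Complex.exp (-s * ((max a 0 : ℝ) : ℂ))
        = ∫ a in Ioo 0 u, Complex.exp (-s * (a : ℂ)) :=
      setIntegral_congr_fun measurableSet_Ioo fun a ha => by
        simp only [max_eq_left ha.1.le]
    rw [h2, ← integral_Ioc_eq_integral_Ioo, ← intervalIntegral.integral_of_le hu,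
      integral_exp_mul_complex (neg_ne_zero.2 hs0)]
    simp only [Complex.ofReal_zero, mul_zero, Complex.exp_zero]
    field_simp
    ring
  rw [integral_congr_ae h1, integral_div, integral_sub (integrable_const _)
    (integrable_cexp_neg hae hs), hw.laplace_wait, lawLaplace]
  simp only [integral_const, probReal_univ, one_smul, Complex.real_smul, Complex.ofReal_inv]
  have : ((∫ ω, τ 0 ω ∂P : ℝ) : ℂ) ≠ 0 := by exact_mod_cast hμ.ne'
  field_simp

lemma tendsto_lawLaplace_excess (hw : IsWalk P τ J ψ h) (hi : Integrable (τ 0) P) {s : ℂ}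
    (hs : 0 ≤ s.re) :
    Tendsto (fun r => lawLaplace (P.map (excessLife τ r)) s) atTop
      (𝓝 (lawLaplace (halfLaw (statDensity ψ (∫ ω, τ 0 ω ∂P))) s)) := by
  have hd := hw.isHalfLineDensity_statDensity hi
  have := hd.isProbabilityMeasure
  set f : ℝ → ℂ := fun a => Complex.exp (-s * ((max a 0 : ℝ) : ℂ)) with hf
  have hfc : Continuous f := by fun_prop
  have hfb : ∀ a, ‖f a‖ ≤ 1 := norm_cexp_neg_max_le hs
  have hfi : ∀ {κ : Measure ℝ} [IsProbabilityMeasure κ], Integrable f κ := fun {κ} _ =>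
    Integrable.of_bound hfc.aestronglyMeasurable 1 (ae_of_all _ hfb)
  -- The renewal theorem is real-valued, so real and imaginary parts are treated separately.
  have h1 : ∀ᶠ r in atTop, lawLaplace (P.map (excessLife τ r)) s
      = ((∫ ω, (f (excessLife τ r ω)).re ∂P : ℝ) : ℂ)
        + ((∫ ω, (f (excessLife τ r ω)).im ∂P : ℝ) : ℂ) * Complex.I := by
    filter_upwards [eventually_ge_atTop 0] with r hr
    have hpos : ∀ᵐ e ∂P.map (excessLife τ r), 0 < e := by
      rw [← hw.halfLaw_excessPdf]; exact hw.ae_excess_pos hr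
    have hint : Integrable (fun ω => f (excessLife τ r ω)) P :=
      Integrable.of_bound (hfc.measurable.comp (hw.measurable_excess r)).aestronglyMeasurable 1
        (ae_of_all _ fun ω => hfb _)
    rw [lawLaplace_eq_max hpos, integral_map (hw.measurable_excess r).aemeasurable
      hfc.aestronglyMeasurable]
    exact (integral_re_add_im hint).symm
  have h2 : lawLaplace (halfLaw (statDensity ψ (∫ ω, τ 0 ω ∂P))) s
      = ((∫ a, (f a).re ∂halfLaw (statDensity ψ (∫ ω, τ 0 ω ∂P)) : ℝ) : ℂ)
        + ((∫ a, (f a).im ∂halfLaw (statDensity ψ (∫ ω, τ 0 ω ∂P)) : ℝ) : ℂ) * Complex.I := by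
    rw [lawLaplace_eq_max hd.ae_pos]
    exact (integral_re_add_im hfi).symm
  rw [h2]
  refine Tendsto.congr' (h1.mono fun _ h => h.symm) ?_
  have hre := hw.tendsto_integral_excess hi (f := fun a => (f a).re) (B := 1)
    (Complex.measurable_re.comp hfc.measurable) fun a => (Complex.abs_re_le_norm _).trans (hfb a)
  have him := hw.tendsto_integral_excess hi (f := fun a => (f a).im) (B := 1)
    (Complex.measurable_im.comp hfc.measurable) fun a => (Complex.abs_im_le_norm _).trans (hfb a)
  exact ((Complex.continuous_ofReal.tendsto _).comp hre).add
    (((Complex.continuous_ofReal.tendsto _).comp him).mul_const Complex.I)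

/-- The limit theorem holds for all bounded measurable functions, so the mean passage time may be
used as test function with no continuity in the residual time. -/
lemma tendsto_passageMeanLaw_excess (hw : IsWalk P τ J ψ h) (hi : Integrable (τ 0) P) {v : ℝ}
    (hv : 0 < v) {y : ℝ} (hy : 0 ≤ y) :
    Tendsto (fun r => passageMeanLaw P τ J v (P.map (excessLife τ r)) y) atTop
      (𝓝 (passageMeanLaw P τ J v (halfLaw (statDensity ψ (∫ ω, τ 0 ω ∂P))) y)) := by
  have hd := hw.isHalfLineDensity_statDensity hi
  have hm : Measurable fun e => passageMeanFrom P τ J v (max e 0) y :=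
    (hw.measurable_passageMeanFrom v).comp (by fun_prop : Measurable fun e : ℝ => (max e 0, y))
  have h1 := hw.tendsto_integral_excess hi hm (B := y / v) fun e => by
    rw [abs_of_nonneg (passageMeanFrom_nonneg _ _)]
    exact hw.passageMeanFrom_le hv (le_max_right _ _) hy
  have h2 : ∀ {κ : Measure ℝ}, (∀ᵐ e ∂κ, 0 < e) → passageMeanLaw P τ J v κ y
      = ∫ e, passageMeanFrom P τ J v (max e 0) y ∂κ := fun hκ => by
    refine integral_congr_ae ?_
    filter_upwards [hκ] with e he
    rw [max_eq_left he.le]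
  rw [h2 hd.ae_pos]
  refine h1.congr' ?_
  filter_upwards [eventually_ge_atTop 0] with r hr
  have hpos : ∀ᵐ e ∂P.map (excessLife τ r), 0 < e := by
    rw [← hw.halfLaw_excessPdf]; exact hw.ae_excess_pos hr
  rw [h2 hpos, integral_map (hw.measurable_excess r).aemeasurable hm.aestronglyMeasurable]

end IsWalk

/-! ### Small-drift expansions -/

lemma norm_cexp_neg_le_one {z : ℂ} (hz : 0 ≤ z.re) : ‖Complex.exp (-z)‖ ≤ 1 := by
  rw [Complex.norm_exp, Real.exp_le_one_iff]
  simpa using hz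

lemma norm_one_sub_cexp_neg_le {z : ℂ} (hz : 0 ≤ z.re) : ‖1 - Complex.exp (-z)‖ ≤ 2 * ‖z‖ := by
  rcases le_total ‖z‖ 1 with h | h
  · have := Complex.norm_exp_sub_one_le (x := -z) (by rwa [norm_neg])
    rwa [norm_sub_rev, ← norm_neg z]
  · have := norm_sub_le (1 : ℂ) (Complex.exp (-z))
    rw [norm_one] at this
    linarith [norm_cexp_neg_le_one hz]

/-- Taylor's bound inside the unit disc; outside it every term is at most a multiple of `‖z‖ ^ 3`.
Holding on the whole half-plane, the estimate can be integrated against a law with a third moment.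
-/
lemma norm_cexp_neg_sub_quadratic_le {z : ℂ} (hz : 0 ≤ z.re) :
    ‖Complex.exp (-z) - (1 - z + z ^ 2 / 2)‖ ≤ 4 * ‖z‖ ^ 3 := by
  rcases le_total ‖z‖ 1 with h | h
  · have := Complex.exp_bound (x := -z) (by rwa [norm_neg]) (n := 3) (by norm_num)
    simp only [Finset.sum_range_succ, Finset.sum_range_zero, norm_neg] at this
    have h1 : (0 + (-z) ^ 0 / ((Nat.factorial 0 : ℕ) : ℂ) + (-z) ^ 1 / ((Nat.factorial 1 : ℕ) : ℂ)
        + (-z) ^ 2 / ((Nat.factorial 2 : ℕ) : ℂ)) = 1 - z + z ^ 2 / 2 := by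
      norm_num [Nat.factorial]
      ring
    rw [h1] at this
    refine this.trans ?_
    rw [mul_comm]
    gcongr
    norm_num [Nat.factorial]
  · have h1 : ‖Complex.exp (-z) - (1 - z + z ^ 2 / 2)‖ ≤ 1 + (1 + ‖z‖ + ‖z‖ ^ 2 / 2) := by
      refine (norm_sub_le _ _).trans (add_le_add (norm_cexp_neg_le_one hz) ?_)
      refine (norm_add_le _ _).trans (add_le_add ((norm_sub_le _ _).trans ?_) ?_)
      · rw [norm_one]
      · rw [norm_div, norm_pow, Complex.norm_two]
    nlinarith [pow_le_pow_right₀ h (show 1 ≤ 3 by norm_num),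
      pow_le_pow_right₀ h (show 2 ≤ 3 by norm_num), pow_le_pow_right₀ h (show 0 ≤ 3 by norm_num)]

section Law

variable {κ : Measure ℝ} [IsProbabilityMeasure κ]

/-- Differentiation at 0 under the integral sign, from the right only; the difference quotients are
dominated by `2 * ‖s‖ * ‖e‖`, so a first moment suffices. -/
lemma tendsto_one_sub_lawLaplace_div (hκ : ∀ᵐ e ∂κ, 0 ≤ e) (hi : Integrable (fun e => e) κ) {s : ℂ}
    (hs : 0 ≤ s.re) :
    Tendsto (fun v : ℝ => (1 - lawLaplace κ (s * v)) / v) (𝓝[>] 0)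
      (𝓝 (s * ((∫ e, e ∂κ : ℝ) : ℂ))) := by
  have hlim : s * ((∫ e, e ∂κ : ℝ) : ℂ) = ∫ e, s * (e : ℂ) ∂κ := by
    rw [integral_const_mul, integral_complex_ofReal]
  have heq : ∀ᶠ v : ℝ in 𝓝[>] 0, ∫ e, (1 - Complex.exp (-(s * v * e))) / v ∂κ
      = (1 - lawLaplace κ (s * v)) / v := by
    filter_upwards [self_mem_nhdsWithin] with v (hv : 0 < v)
    have hre : 0 ≤ (s * v).re := by
      rw [Complex.re_mul_ofReal]; exact mul_nonneg hs hv.le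
    have h1 := integrable_cexp_neg hκ hre
    simp only [neg_mul] at h1
    rw [integral_div, integral_sub (integrable_const _) h1, lawLaplace]
    simp
  rw [hlim]
  refine Tendsto.congr' heq ?_
  refine tendsto_integral_filter_of_dominated_convergence (fun e => 2 * ‖s‖ * ‖e‖) ?_ ?_ ?_ ?_
  · refine Eventually.of_forall fun v => ?_
    exact (Continuous.aestronglyMeasurable (by fun_prop))
  · filter_upwards [self_mem_nhdsWithin] with v (hv : 0 < v)
    filter_upwards [hκ] with e he
    have hre : 0 ≤ (s * v * e).re := by
      rw [Complex.re_mul_ofReal, Complex.re_mul_ofReal]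
      exact mul_nonneg (mul_nonneg hs hv.le) he
    rw [norm_div, div_le_iff₀ (by simpa using hv.ne')]
    refine (norm_one_sub_cexp_neg_le hre).trans (le_of_eq ?_)
    simp only [norm_mul, Complex.norm_real]
    ring
  · exact hi.norm.const_mul _
  · refine ae_of_all _ fun e => ?_
    have hd : HasDerivAt (fun v : ℝ => -Complex.exp (-(s * v * e))) (s * e) 0 := by
      have h1 : HasDerivAt (fun v : ℝ => (v : ℂ)) 1 0 := Complex.ofRealCLM.hasDerivAt
      have h2 := (((h1.const_mul s).mul_const (e : ℂ)).neg.cexp).neg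
      exact h2.congr_deriv (by simp)
    have := (hasDerivAt_iff_tendsto_slope.1 hd).mono_left
      (nhdsWithin_mono 0 fun v (hv : 0 < v) => hv.ne')
    refine this.congr fun v => ?_
    simp only [slope, vsub_eq_sub, sub_zero, Complex.ofReal_zero, mul_zero, zero_mul, neg_zero,
      Complex.exp_zero, Complex.real_smul, Complex.ofReal_inv]
    rw [div_eq_inv_mul]
    ring

lemma lawLaplace_sub_quadratic_isBigO (hκ : ∀ᵐ e ∂κ, 0 ≤ e) (h1 : Integrable (fun e => e) κ)
    (h2 : Integrable (fun e => e ^ 2) κ) (h3 : Integrable (fun e => e ^ 3) κ) {s : ℂ}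
    (hs : 0 ≤ s.re) :
    (fun v : ℝ => (lawLaplace κ (s * v) - (1 - s * v * ((∫ e, e ∂κ : ℝ) : ℂ)
      + (s * v) ^ 2 * ((∫ e, e ^ 2 ∂κ : ℝ) : ℂ) / 2)) / (v : ℂ) ^ 3)
      =O[𝓝[>] 0] fun _ => (1 : ℝ) := by
  refine IsBigO.of_bound (4 * ‖s‖ ^ 3 * ∫ e, e ^ 3 ∂κ) ?_
  filter_upwards [self_mem_nhdsWithin] with v (hv : 0 < v)
  have hre : 0 ≤ (s * v).re := by
    rw [Complex.re_mul_ofReal]; exact mul_nonneg hs hv.le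
  have hexp := integrable_cexp_neg hκ hre
  have hi1 : Integrable (fun e : ℝ => s * v * (e : ℂ)) κ := h1.ofReal.const_mul _
  have hi2 : Integrable (fun e : ℝ => (s * v) ^ 2 * ((e ^ 2 : ℝ) : ℂ) / 2) κ :=
    (h2.ofReal.const_mul _).div_const _
  have hi0 : Integrable (fun e : ℝ => 1 - s * v * (e : ℂ)) κ := (integrable_const _).sub hi1
  have hi3 : Integrable (fun e : ℝ => 1 - s * v * (e : ℂ) + (s * v) ^ 2 * ((e ^ 2 : ℝ) : ℂ) / 2) κ :=
    hi0.add hi2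
  have heq : lawLaplace κ (s * v) - (1 - s * v * ((∫ e, e ∂κ : ℝ) : ℂ)
      + (s * v) ^ 2 * ((∫ e, e ^ 2 ∂κ : ℝ) : ℂ) / 2)
      = ∫ e : ℝ, (Complex.exp (-(s * v) * e)
        - (1 - s * v * (e : ℂ) + (s * v) ^ 2 * ((e ^ 2 : ℝ) : ℂ) / 2)) ∂κ := by
    rw [integral_sub hexp hi3, integral_add hi0 hi2, integral_sub (integrable_const _) hi1,
      integral_div, integral_const_mul, integral_const_mul, integral_complex_ofReal,
      integral_complex_ofReal, lawLaplace]
    simp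
  rw [heq, norm_div, norm_one, mul_one, norm_pow, Complex.norm_real, Real.norm_of_nonneg hv.le,
    div_le_iff₀ (by positivity), mul_assoc, mul_comm _ (v ^ 3), ← mul_assoc, ← integral_const_mul]
  refine norm_integral_le_of_norm_le (h3.const_mul _) ?_
  filter_upwards [hκ] with e he
  have hre' : 0 ≤ (s * v * e).re := by
    rw [Complex.re_mul_ofReal]
    exact mul_nonneg hre he
  have := norm_cexp_neg_sub_quadratic_le hre'
  rw [norm_mul, norm_mul, Complex.norm_real, Complex.norm_real, Real.norm_of_nonneg hv.le,
    Real.norm_of_nonneg he] at this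
  convert this using 1
  · congr 1
    rw [neg_mul]
    push_cast
    ring
  · ring

end Law

/-- The algebra of the second-order expansion. Here `p`, `q`, `A` stand for the transforms of the
sojourn time, the jump and the residual time, `δ` for the difference of first moments, `k` for minus
half that of second moments, and `E₁`, `E₂` for bounded remainders. The error is displayed as
exactly `v ^ 2` times an expression that is visibly bounded. -/
lemma small_drift_identity {s q p A v μ δ k E₁ E₂ : ℂ} (hs : s ≠ 0) (hv : v ≠ 0) (ha : 1 - q ≠ 0)
    (hD : 1 - p * q ≠ 0) (hp : p = 1 - s * v * μ + v ^ 2 * E₂)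
    (hA : A - p = v * s * δ + v ^ 2 * s ^ 2 * k + v ^ 3 * E₁) :
    -((1 - q) / (v * s ^ 2 * (1 - p * q)) * (A - p)) + δ / s - (q / (1 - q) * δ * μ - k) * v
      = v ^ 2 * (-(1 / s ^ 2) * (E₁ + ((1 - q) * q * E₂ + (s * μ * q) ^ 2 - s * v * μ * q ^ 2 * E₂)
          * (1 - q)⁻¹ * (1 - p * q)⁻¹ * (s * δ + v * (s ^ 2 * k) + v ^ 2 * E₁)
        - s * μ * q / (1 - q) * (s ^ 2 * k + v * E₁))) := by
  -- First-order expansion of the quotient with its exact remainder; no second-order term is needed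
  -- because the factor `A - p` is already of order `v` and the prefactor contains `1 / v`.
  have h1 : (1 - q) / (1 - p * q) = 1 - s * v * μ * q / (1 - q)
      + v ^ 2 * (((1 - q) * q * E₂ + (s * μ * q) ^ 2 - s * v * μ * q ^ 2 * E₂)
          * (1 - q)⁻¹ * (1 - p * q)⁻¹) := by
    have h2 : (1 - q) ^ 2 - (1 - q) * (1 - p * q) + s * v * μ * q * (1 - p * q)
        = v ^ 2 * ((1 - q) * q * E₂ + (s * μ * q) ^ 2 - s * v * μ * q ^ 2 * E₂) := by
      rw [hp]; ring
    generalize 1 - p * q = D at h2 hD ⊢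
    field_simp
    linear_combination h2
  have h3 : (1 - q) / (v * s ^ 2 * (1 - p * q)) * (A - p)
      = (1 / s ^ 2) * ((1 - q) / (1 - p * q)) * (s * δ + v * (s ^ 2 * k) + v ^ 2 * E₁) := by
    rw [hA]; field_simp
  rw [h3, h1]
  generalize ((1 - q) * q * E₂ + (s * μ * q) ^ 2 - s * v * μ * q ^ 2 * E₂)
          * (1 - q)⁻¹ * (1 - p * q)⁻¹ = E₃
  field_simp
  ring

namespace IsWalk

variable {Ω : Type*} [MeasurableSpace Ω] {P : Measure Ω} [IsProbabilityMeasure P]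
  {τ J : ℕ → Ω → ℝ} {ψ h : ℝ → ℝ}

/-- The factor `1 / v` is absorbed by the difference of the two transforms, each of which equals 1
at `v = 0` and has a right derivative there. The denominator tends to `1 - laplace h s`, which is
nonzero and cancels. -/
lemma tendsto_laplace_small_drift (hw : IsWalk P τ J ψ h) {κ : Measure ℝ} [IsProbabilityMeasure κ]
    (hκ : ∀ᵐ e ∂κ, 0 ≤ e) (hi : Integrable (τ 0) P) (hi' : Integrable (fun e => e) κ) {s : ℂ}
    (hs : 0 < s.re) :
    Tendsto (fun v : ℝ => laplace (passageMeanLaw P τ J v κ) s - laplace (passageMean P τ J v) s)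
      (𝓝[>] 0) (𝓝 (-(((∫ ω, τ 0 ω ∂P) - ∫ e, e ∂κ : ℝ) : ℂ) / s)) := by
  have := hw.density_wait.isProbabilityMeasure
  have hs0 : s ≠ 0 := by rintro rfl; simp at hs
  have ha := hw.one_sub_laplace_ne_zero hs
  have hp := tendsto_one_sub_lawLaplace_div (hw.density_wait.ae_pos.mono fun _ => le_of_lt)
    (hw.integrable_id_halfLaw hi) hs.le
  rw [hw.integral_id_halfLaw] at hp
  simp only [← hw.laplace_wait] at hp
  have hA := tendsto_one_sub_lawLaplace_div hκ hi' hs.le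
  have hv0 : Tendsto (fun v : ℝ => (v : ℂ)) (𝓝[>] 0) (𝓝 0) := by
    have : Tendsto (fun v : ℝ => (v : ℂ)) (𝓝 0) (𝓝 ((0 : ℝ) : ℂ)) :=
      Complex.continuous_ofReal.tendsto 0
    exact (by simpa using this : Tendsto (fun v : ℝ => (v : ℂ)) (𝓝 0) (𝓝 0)).mono_left
      nhdsWithin_le_nhds
  have hp1 : Tendsto (fun v : ℝ => laplace ψ (s * v)) (𝓝[>] 0) (𝓝 1) := by
    have h1 := (hv0.mul hp).const_sub 1
    rw [zero_mul, sub_zero] at h1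
    refine h1.congr' ?_
    filter_upwards [self_mem_nhdsWithin] with v (hv : 0 < v)
    have : (v : ℂ) ≠ 0 := by exact_mod_cast hv.ne'
    field_simp
    ring
  have hD : Tendsto (fun v : ℝ => 1 - laplace ψ (s * v) * laplace h s) (𝓝[>] 0)
      (𝓝 (1 - laplace h s)) := by
    simpa using (hp1.mul_const (laplace h s)).const_sub 1
  have hmain := (((hp.sub hA).mul_const ((1 - laplace h s) / s ^ 2)).div hD ha).neg
  have hlim : -((s * ((∫ ω, τ 0 ω ∂P : ℝ) : ℂ) - s * ((∫ e, e ∂κ : ℝ) : ℂ))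
      * ((1 - laplace h s) / s ^ 2) / (1 - laplace h s))
      = -(((∫ ω, τ 0 ω ∂P) - ∫ e, e ∂κ : ℝ) : ℂ) / s := by
    push_cast
    field_simp
  rw [hlim] at hmain
  refine hmain.congr' ?_
  filter_upwards [self_mem_nhdsWithin] with v (hv : 0 < v)
  have hvc : (v : ℂ) ≠ 0 := by exact_mod_cast hv.ne'
  have hDv := hw.one_sub_laplace_mul_ne_zero hv hs
  rw [hw.laplace_passageMeanLaw' hv hκ hs, Pi.div_apply]
  generalize 1 - laplace ψ (s * v) * laplace h s = D at hDv ⊢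
  field_simp
  ring

lemma laplace_small_drift_isBigO (hw : IsWalk P τ J ψ h) {κ : Measure ℝ} [IsProbabilityMeasure κ]
    (hκ : ∀ᵐ e ∂κ, 0 ≤ e) (h1 : Integrable (fun e => e) (halfLaw ψ))
    (h2 : Integrable (fun e => e ^ 2) (halfLaw ψ)) (h3 : Integrable (fun e => e ^ 3) (halfLaw ψ))
    (h1' : Integrable (fun e => e) κ) (h2' : Integrable (fun e => e ^ 2) κ)
    (h3' : Integrable (fun e => e ^ 3) κ) {s : ℂ} (hs : 0 < s.re) {μ μr m mr : ℝ}
    (hμ : μ = ∫ e, e ∂halfLaw ψ) (hμr : μr = ∫ e, e ∂κ) (hm : m = ∫ e, e ^ 2 ∂halfLaw ψ)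
    (hmr : mr = ∫ e, e ^ 2 ∂κ) :
    (fun v : ℝ => laplace (passageMeanLaw P τ J v κ) s
        - (laplace (passageMean P τ J v) s - ((μ : ℂ) - μr) / s
          + (laplace h s / (1 - laplace h s) * ((μ : ℂ) - μr) * μ + ((m : ℂ) - mr) / 2) * v))
      =O[𝓝[>] 0] fun v : ℝ => v ^ 2 := by
  have := hw.density_wait.isProbabilityMeasure
  have hs0 : s ≠ 0 := by rintro rfl; simp at hs
  have ha := hw.one_sub_laplace_ne_zero hs
  have hpO := lawLaplace_sub_quadratic_isBigO (hw.density_wait.ae_pos.mono fun _ => le_of_lt)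
    h1 h2 h3 hs.le
  have hAO := lawLaplace_sub_quadratic_isBigO hκ h1' h2' h3' hs.le
  rw [← hμ, ← hm] at hpO
  rw [← hμr, ← hmr] at hAO
  simp only [← hw.laplace_wait] at hpO
  set q := laplace h s
  set p : ℝ → ℂ := fun v => laplace ψ (s * v) with hp
  set R : ℝ → ℂ := fun v =>
    (p v - (1 - s * v * μ + (s * v) ^ 2 * m / 2)) / (v : ℂ) ^ 3 with hR
  set R' : ℝ → ℂ := fun v => (lawLaplace κ (s * v)
    - (1 - s * v * μr + (s * v) ^ 2 * mr / 2)) / (v : ℂ) ^ 3 with hR'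
  have hv0 : Tendsto (fun v : ℝ => (v : ℂ)) (𝓝[>] 0) (𝓝 0) := by
    have : Tendsto (fun v : ℝ => (v : ℂ)) (𝓝 0) (𝓝 ((0 : ℝ) : ℂ)) :=
      Complex.continuous_ofReal.tendsto 0
    exact (by simpa using this : Tendsto (fun v : ℝ => (v : ℂ)) (𝓝 0) (𝓝 0)).mono_left
      nhdsWithin_le_nhds
  have hvO : (fun v : ℝ => (v : ℂ)) =O[𝓝[>] 0] fun _ => (1 : ℝ) := hv0.isBigO_one ℝ
  have hc : ∀ c : ℂ, (fun _ : ℝ => c) =O[𝓝[>] 0] fun _ => (1 : ℝ) := fun c =>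
    isBigO_const_const c one_ne_zero _
  have hmul : ∀ {f g : ℝ → ℂ}, f =O[𝓝[>] 0] (fun _ => (1 : ℝ)) → g =O[𝓝[>] 0] (fun _ => (1 : ℝ)) →
      (fun v => f v * g v) =O[𝓝[>] 0] fun _ => (1 : ℝ) := fun hf hg => by
    simpa using hf.mul hg
  -- The third-order remainders `R` and `R'` are bounded by third moments. In `E₂` the quadratic
  -- term of the sojourn transform is kept together with its remainder.
  set E₁ : ℝ → ℂ := fun v => R' v - R v with hE₁
  set E₂ : ℝ → ℂ := fun v => s ^ 2 * m / 2 + v * R v with hE₂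
  have hE₁O : E₁ =O[𝓝[>] 0] fun _ => (1 : ℝ) := hAO.sub hpO
  have hE₂O : E₂ =O[𝓝[>] 0] fun _ => (1 : ℝ) := (hc _).add (hmul hvO hpO)
  have hpeq : ∀ v : ℝ, 0 < v → p v = 1 - s * v * μ + v ^ 2 * E₂ v := fun v hv => by
    have hvc : (v : ℂ) ≠ 0 := by exact_mod_cast hv.ne'
    simp only [hE₂, hR]
    field_simp
    ring
  have hAeq : ∀ v : ℝ, 0 < v → lawLaplace κ (s * v) - p v
      = v * s * ((μ : ℂ) - μr) + v ^ 2 * s ^ 2 * (-(((m : ℂ) - mr) / 2)) + v ^ 3 * E₁ v :=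
    fun v hv => by
    have hvc : (v : ℂ) ≠ 0 := by exact_mod_cast hv.ne'
    simp only [hE₁, hR, hR']
    field_simp
    ring
  have hp1 : Tendsto p (𝓝[>] 0) (𝓝 1) := by
    have h4 : (fun v : ℝ => (v : ℂ) * (v * E₂ v - s * μ)) =O[𝓝[>] 0] fun v : ℝ => (v : ℂ) := by
      have hle : (fun v : ℝ => (v : ℂ)) =O[𝓝[>] 0] fun v : ℝ => v :=
        isBigO_of_le _ fun v => by simp
      have := hle.mul ((hmul hvO hE₂O).sub (hc (s * μ)))
      exact this.trans (isBigO_of_le _ fun v => by simp)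
    have h5 := (h4.trans_tendsto hv0).const_add 1
    rw [add_zero] at h5
    refine h5.congr' ?_
    filter_upwards [self_mem_nhdsWithin] with v (hv : 0 < v)
    rw [hpeq v hv]
    ring
  have hDO : (fun v => (1 - p v * q)⁻¹) =O[𝓝[>] 0] fun _ => (1 : ℝ) := by
    have h4 : Tendsto (fun v => 1 - p v * q) (𝓝[>] 0) (𝓝 (1 - q)) := by
      simpa using (hp1.mul_const q).const_sub 1
    exact (h4.inv₀ ha).isBigO_one ℝ
  set δ : ℂ := (μ : ℂ) - μr
  set k : ℂ := -(((m : ℂ) - mr) / 2) with hk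
  have hG : (fun v : ℝ => -(1 / s ^ 2) * (E₁ v
      + ((1 - q) * q * E₂ v + (s * μ * q) ^ 2 - s * v * μ * q ^ 2 * E₂ v)
          * (1 - q)⁻¹ * (1 - p v * q)⁻¹ * (s * δ + v * (s ^ 2 * k) + v ^ 2 * E₁ v)
        - s * μ * q / (1 - q) * (s ^ 2 * k + v * E₁ v))) =O[𝓝[>] 0] fun _ => (1 : ℝ) := by
    have hv2 : (fun v : ℝ => (v : ℂ) ^ 2) =O[𝓝[>] 0] fun _ => (1 : ℝ) := by
      simpa [sq] using hmul hvO hvO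
    refine hmul (hc _) ((hE₁O.add (hmul (hmul (hmul (((hmul (hc _) hE₂O).add (hc _)).sub
      (hmul (hmul (hmul (hmul (hc s) hvO) (hc _)) (hc _)) hE₂O)) (hc _)) hDO)
      (((hc _).add (hmul hvO (hc _))).add (hmul hv2 hE₁O)))).sub
      (hmul (hc _) ((hc _).add (hmul hvO hE₁O))))
  have hle : (fun v : ℝ => (v : ℂ) ^ 2) =O[𝓝[>] 0] fun v : ℝ => v ^ 2 :=
    isBigO_of_le _ fun v => by simp
  have hfin := hle.mul hG
  refine (hfin.congr' ?_ EventuallyEq.rfl).trans (isBigO_of_le _ fun v => by simp)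
  filter_upwards [self_mem_nhdsWithin] with v (hv : 0 < v)
  have hvc : (v : ℂ) ≠ 0 := by exact_mod_cast hv.ne'
  rw [← small_drift_identity hs0 hvc ha (hw.one_sub_laplace_mul_ne_zero hv hs) (hpeq v hv)
    (hAeq v hv), hw.laplace_passageMeanLaw' hv hκ hs, hk]
  ring

end IsWalk

/-! ### Transfer to J(·|r) and assembly of the theorem -/

namespace IsWalk

variable {Ω : Type*} [MeasurableSpace Ω] {P : Measure Ω} [IsProbabilityMeasure P]
  {τ J : ℕ → Ω → ℝ} {ψ h : ℝ → ℝ}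

lemma isProbabilityMeasure_map_excess (hw : IsWalk P τ J ψ h) (r : ℝ) :
    IsProbabilityMeasure (P.map (excessLife τ r)) :=
  Measure.isProbabilityMeasure_map (hw.measurable_excess r).aemeasurable

lemma ae_map_excess_nonneg (hw : IsWalk P τ J ψ h) {r : ℝ} (hr : 0 ≤ r) :
    ∀ᵐ e ∂P.map (excessLife τ r), 0 ≤ e := by
  rw [← hw.halfLaw_excessPdf]
  exact (hw.ae_excess_pos hr).mono fun _ => le_of_lt

/-- On the half-line a lower power is at most one plus the higher power. -/
lemma integrable_pow_of_le (hw : IsWalk P τ J ψ h) {p k : ℕ} (hk : k ≤ p)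
    (hi : Integrable (fun ω => τ 0 ω ^ p) P) : Integrable (fun ω => τ 0 ω ^ k) P := by
  refine ((integrable_const (1 : ℝ)).add hi).mono'
    ((hw.measurable_wait 0).pow_const k).aestronglyMeasurable ?_
  filter_upwards [hw.ae_wait_pos] with ω hω
  have h0 := (hω 0).le
  rw [Real.norm_of_nonneg (pow_nonneg h0 k), Pi.add_apply]
  rcases le_total (τ 0 ω) 1 with h1 | h1
  · linarith [pow_le_one₀ (n := k) h0 h1, pow_nonneg h0 p]
  · linarith [pow_le_pow_right₀ h1 hk]

omit [IsProbabilityMeasure P] in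
lemma integrable_pow_halfLaw (hw : IsWalk P τ J ψ h) {p : ℕ}
    (hi : Integrable (fun ω => τ 0 ω ^ p) P) : Integrable (fun e => e ^ p) (halfLaw ψ) := by
  rw [halfLaw, ← hw.law_wait 0]
  exact (integrable_map_measure (by fun_prop) (hw.measurable_wait 0).aemeasurable).2 hi

omit [IsProbabilityMeasure P] in
lemma integral_pow_halfLaw (hw : IsWalk P τ J ψ h) (p : ℕ) :
    ∫ e, e ^ p ∂halfLaw ψ = ∫ ω, τ 0 ω ^ p ∂P := by
  rw [halfLaw, ← hw.law_wait 0]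
  exact integral_map (hw.measurable_wait 0).aemeasurable (by fun_prop)

lemma integrable_pow_map_excess (hw : IsWalk P τ J ψ h) {p : ℕ}
    (hi : Integrable (fun ω => τ 0 ω ^ p) P) {r : ℝ} (hr : 0 ≤ r) :
    Integrable (fun e => e ^ p) (P.map (excessLife τ r)) :=
  (integrable_map_measure (by fun_prop) (hw.measurable_excess r).aemeasurable).2
    (hw.integrable_excessLife_pow hi hr)

omit [IsProbabilityMeasure P] in
lemma integral_pow_map_excess (hw : IsWalk P τ J ψ h) (p : ℕ) (r : ℝ) :
    ∫ e, e ^ p ∂P.map (excessLife τ r) = ∫ ω, excessLife τ r ω ^ p ∂P :=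
  integral_map (hw.measurable_excess r).aemeasurable (by fun_prop)

lemma laplace_meanExitFrom_congr (hw : IsWalk P τ J ψ h) {v r : ℝ} (hv : 0 < v) (hr : 0 ≤ r)
    (s : ℂ) : laplace (meanExitFrom P τ h v (passageMean P τ J v) r) s
      = laplace (passageMeanLaw P τ J v (P.map (excessLife τ r))) s :=
  setIntegral_congr_fun measurableSet_Ioi fun y hy => by
    simp only [hw.meanExitFrom_eq hv hr (le_of_lt (mem_Ioi.1 hy))]

lemma laplaceConverges_meanExitFrom (hw : IsWalk P τ J ψ h) {v r : ℝ} (hv : 0 < v) (hr : 0 ≤ r)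
    {s : ℂ} (hs : 0 < s.re) :
    LaplaceConverges (meanExitFrom P τ h v (passageMean P τ J v) r) s := by
  have := hw.isProbabilityMeasure_map_excess r
  have h1 := hw.laplaceConverges_passageMeanLaw hv (hw.ae_map_excess_nonneg hr) hs
  refine IntegrableOn.congr_fun h1 (fun y hy => ?_) measurableSet_Ioi
  simp only [hw.meanExitFrom_eq hv hr (le_of_lt (mem_Ioi.1 hy))]

lemma laplace_meanExitFrom (hw : IsWalk P τ J ψ h) {v r : ℝ} (hv : 0 < v) (hr : 0 ≤ r)
    {s : ℂ} (hs : 0 < s.re) :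
    laplace (meanExitFrom P τ h v (passageMean P τ J v) r) s
      = laplace (passageMean P τ J v) s
        - (1 - laplace h s) / (v * s ^ 2 * (1 - laplace ψ (s * v) * laplace h s))
          * (laplace (excessPdf P τ r) (s * v) - laplace ψ (s * v)) := by
  have := hw.isProbabilityMeasure_map_excess r
  rw [hw.laplace_meanExitFrom_congr hv hr,
    hw.laplace_passageMeanLaw' hv (hw.ae_map_excess_nonneg hr) hs, hw.laplace_excessPdf hr]

lemma tendsto_laplace_excessPdf (hw : IsWalk P τ J ψ h) (hi : Integrable (τ 0) P) {s : ℂ}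
    (hs : 0 ≤ s.re) (hs0 : s ≠ 0) :
    Tendsto (fun r : ℝ => laplace (excessPdf P τ r) s) atTop
      (𝓝 ((1 - laplace ψ s) / (s * ((∫ ω, τ 0 ω ∂P : ℝ) : ℂ)))) := by
  rw [← hw.lawLaplace_statDensity hi hs hs0]
  refine (hw.tendsto_lawLaplace_excess hi hs).congr' ?_
  filter_upwards [eventually_ge_atTop 0] with r hr
  exact (hw.laplace_excessPdf hr s).symm

end IsWalk

end CTRW

end

open CTRW in
theorem mainTheorem2 {Ω : Type*} [MeasurableSpace Ω] (P : Measure Ω) [IsProbabilityMeasure P]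
    (τ J : ℕ → Ω → ℝ) (ψ h : ℝ → ℝ) (hw : IsWalk P τ J ψ h) :
    -- the excess life has a density, which is the derivative of its distribution function
    (∀ r : ℝ, 0 ≤ r → HasPDF (excessLife τ r) P volume ∧
      ∀ᵐ t : ℝ, HasDerivAt (excessCdf P τ r) (excessPdf P τ r t) t) ∧
    ∃ F : ℝ → ℝ → ℝ,
      -- for every drift `v`, `F v` is the unique solution of the integral equation
      (∀ v : ℝ, 0 < v → SolvesRenewal ψ h v (F v) ∧
        ∀ G : ℝ → ℝ, SolvesRenewal ψ h v G → EqOn G (F v) (Ici 0)) ∧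
      -- mean exit times after a jump and after an arbitrary time `r`
      (∀ v b x : ℝ, 0 < v → 0 < x → x < b →
        (∀ n : ℕ, Integrable (fun ω => exitTime τ J v b x (jumpTime τ n ω) ω) P ∧
          meanExitAfterJump P τ J v b x n = F v (b - x)) ∧
        (∀ r : ℝ, 0 ≤ r → Integrable (exitTime τ J v b x r) P ∧
          meanExit P τ J v b x r = meanExitFrom P τ h v (F v) r (b - x))) ∧
      -- the Laplace transforms
      (∀ v : ℝ, 0 < v → ∀ s : ℂ, 0 < s.re →
        1 - laplace ψ (s * v) * laplace h s ≠ 0 ∧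
        LaplaceConverges (F v) s ∧
        laplace (F v) s
          = 1 / (v * s ^ 2) *
            ((1 - laplace ψ (s * v)) / (1 - laplace ψ (s * v) * laplace h s)) ∧
        ∀ r : ℝ, 0 ≤ r →
          LaplaceConverges (meanExitFrom P τ h v (F v) r) s ∧
          laplace (meanExitFrom P τ h v (F v) r) s
            = laplace (F v) s
              - (1 - laplace h s) / (v * s ^ 2 * (1 - laplace ψ (s * v) * laplace h s))
                * (laplace (excessPdf P τ r) (s * v) - laplace ψ (s * v))) ∧
      -- small drift, leading order
      (Integrable (τ 0) P → ∀ r : ℝ, 0 ≤ r → Integrable (excessLife τ r) P ∧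
        ∀ s : ℂ, 0 < s.re →
          Tendsto (fun v : ℝ => laplace (meanExitFrom P τ h v (F v) r) s - laplace (F v) s)
            (𝓝[>] 0)
            (𝓝 (-(((∫ ω, τ 0 ω ∂P) - ∫ ω, excessLife τ r ω ∂P : ℝ) : ℂ) / s))) ∧
      -- small drift, up to `O(v ^ 2)`
      (Integrable (fun ω => τ 0 ω ^ 3) P → ∀ r : ℝ, 0 ≤ r →
        Integrable (fun ω => excessLife τ r ω ^ 3) P ∧
        ∀ s : ℂ, 0 < s.re → 1 - laplace h s ≠ 0 ∧
          ∀ μ μr m mr : ℝ, μ = ∫ ω, τ 0 ω ∂P → μr = ∫ ω, excessLife τ r ω ∂P →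
            m = ∫ ω, τ 0 ω ^ 2 ∂P → mr = ∫ ω, excessLife τ r ω ^ 2 ∂P →
            (fun v : ℝ => laplace (meanExitFrom P τ h v (F v) r) s
                - (laplace (F v) s - ((μ : ℂ) - μr) / s
                  + (laplace h s / (1 - laplace h s) * ((μ : ℂ) - μr) * μ
                      + ((m : ℂ) - mr) / 2) * v))
              =O[𝓝[>] 0] fun v : ℝ => v ^ 2) ∧
      -- the stationary limit `r → ∞`
      (Integrable (τ 0) P → ∀ μ : ℝ, μ = ∫ ω, τ 0 ω ∂P →
        0 < μ ∧
        (∀ s : ℂ, 0 ≤ s.re → s ≠ 0 →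
          Tendsto (fun r : ℝ => laplace (excessPdf P τ r) s) atTop
            (𝓝 ((1 - laplace ψ s) / (s * μ)))) ∧
        ∀ v : ℝ, 0 < v → ∃ Jinf : ℝ → ℝ,
          (∀ y : ℝ, 0 ≤ y →
            Tendsto (fun r : ℝ => meanExitFrom P τ h v (F v) r y) atTop (𝓝 (Jinf y))) ∧
          ∀ s : ℂ, 0 < s.re →
            LaplaceConverges Jinf s ∧
            Tendsto (fun r : ℝ => laplace (meanExitFrom P τ h v (F v) r) s) atTop
              (𝓝 (laplace Jinf s)) ∧
            laplace Jinf s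
              = laplace (F v) s
                - (1 - laplace h s) / (v ^ 2 * s ^ 3 * μ)
                  * ((1 - (1 + s * v * μ) * laplace ψ (s * v))
                      / (1 - laplace ψ (s * v) * laplace h s))) := by
  -- The solution is the mean passage time itself, so existence and the probabilistic meaning of `F`
  -- come together.
  refine ⟨fun r _ => ⟨hw.hasPDF_excessLife r, hw.ae_hasDerivAt_excessCdf r⟩,
    fun v => passageMean P τ J v, ?_, ?_, ?_, ?_, ?_, ?_⟩
  · intro v hv
    have hF := hw.solvesRenewal_passageMean hv
    exact ⟨hF, fun G hG => hF.eqOn hw.density_wait hw.density_jump hv hG⟩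
  · intro v b x hv hx hxb
    refine ⟨fun n => hw.integral_exitTime_jumpTime hv hx hxb n, fun r hr => ?_⟩
    obtain ⟨h1, h2⟩ := hw.integral_exitTime hv hx hxb hr
    refine ⟨h1, ?_⟩
    have hpos : ∀ᵐ e ∂P.map (excessLife τ r), 0 ≤ e := hw.ae_map_excess_nonneg hr
    have := hw.isProbabilityMeasure_map_excess r
    rw [hw.meanExitFrom_eq hv hr (sub_nonneg.2 hxb.le), ← hw.toReal_lintegral_meanPassageFrom hv
      hpos, meanExit, h2, lintegral_map (f := fun e => meanPassageFrom P τ J v e (b - x))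
        ((hw.measurable_meanPassageFrom v).comp
          (by fun_prop : Measurable fun e : ℝ => (e, b - x))) (hw.measurable_excess r)]
  · intro v hv s hs
    exact ⟨hw.one_sub_laplace_mul_ne_zero hv hs, (hw.laplace_passageMean hv hs).1,
      (hw.laplace_passageMean hv hs).2, fun r hr =>
      ⟨hw.laplaceConverges_meanExitFrom hv hr hs, hw.laplace_meanExitFrom hv hr hs⟩⟩
  · intro hi r hr
    -- The mean is treated as the moment of order one, so that the moment bound for the excess life
    -- applies.
    have hi1 : Integrable (fun ω => τ 0 ω ^ 1) P := by simpa using hi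
    have hE := hw.integrable_excessLife_pow hi1 hr
    have hE' := hw.integrable_pow_map_excess hi1 hr
    have hm := hw.integral_pow_map_excess 1 r
    simp only [pow_one] at hE hE' hm
    have := hw.isProbabilityMeasure_map_excess r
    refine ⟨hE, fun s hs => ?_⟩
    have h1 := hw.tendsto_laplace_small_drift (hw.ae_map_excess_nonneg hr) hi hE' hs
    rw [hm] at h1
    refine h1.congr' ?_
    filter_upwards [self_mem_nhdsWithin] with v hv
    rw [hw.laplace_meanExitFrom_congr hv hr]
  · intro hi r hr
    refine ⟨hw.integrable_excessLife_pow hi hr, fun s hs => ⟨hw.one_sub_laplace_ne_zero hs, ?_⟩⟩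
    intro μ μr m mr hμ hμr hm hmr
    have := hw.isProbabilityMeasure_map_excess r
    have hi1 := hw.integrable_pow_of_le (show 1 ≤ 3 by norm_num) hi
    have hi2 := hw.integrable_pow_of_le (show 2 ≤ 3 by norm_num) hi
    have h1 := hw.laplace_small_drift_isBigO (hw.ae_map_excess_nonneg hr)
      (by simpa using hw.integrable_pow_halfLaw hi1) (hw.integrable_pow_halfLaw hi2)
      (hw.integrable_pow_halfLaw hi) (by simpa using hw.integrable_pow_map_excess hi1 hr)
      (hw.integrable_pow_map_excess hi2 hr) (hw.integrable_pow_map_excess hi hr) hs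
      (hμ.trans hw.integral_id_halfLaw.symm)
      (hμr.trans (by simpa using (hw.integral_pow_map_excess 1 r).symm))
      (hm.trans (hw.integral_pow_halfLaw 2).symm) (hmr.trans (hw.integral_pow_map_excess 2 r).symm)
    refine h1.congr' ?_ EventuallyEq.rfl
    filter_upwards [self_mem_nhdsWithin] with v hv
    rw [hw.laplace_meanExitFrom_congr hv hr]
  · rintro hi μ rfl
    have hμ := hw.integral_wait_pos hi
    refine ⟨hμ, fun s hs hs0 => hw.tendsto_laplace_excessPdf hi hs hs0, fun v hv => ?_⟩
    have hd := hw.isHalfLineDensity_statDensity hi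
    have := hd.isProbabilityMeasure
    have hnn : ∀ᵐ e ∂halfLaw (IsWalk.statDensity ψ (∫ ω, τ 0 ω ∂P)), 0 ≤ e :=
      hd.ae_pos.mono fun _ => le_of_lt
    -- The limit function is the mean passage time whose residual time has the stationary law; it
    -- thus obeys the same Laplace formula, with the stationary transform inserted.
    refine ⟨passageMeanLaw P τ J v (halfLaw (IsWalk.statDensity ψ (∫ ω, τ 0 ω ∂P))), fun y hy => ?_,
      fun s hs => ⟨hw.laplaceConverges_passageMeanLaw hv hnn hs, ?_⟩⟩
    · refine (hw.tendsto_passageMeanLaw_excess hi hv hy).congr' ?_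
      filter_upwards [eventually_ge_atTop 0] with r hr
      rw [hw.meanExitFrom_eq hv hr hy]
    have hs0 : s ≠ 0 := by rintro rfl; simp at hs
    have hvc : (v : ℂ) ≠ 0 := by exact_mod_cast hv.ne'
    have hre : 0 ≤ (s * v).re := by
      rw [Complex.re_mul_ofReal]; exact mul_nonneg hs.le hv.le
    have hL := hw.lawLaplace_statDensity hi hre (mul_ne_zero hs0 hvc)
    have hJ := hw.laplace_passageMeanLaw' hv hnn hs
    rw [hL] at hJ
    constructor
    · rw [hJ]
      have h1 := (((hw.tendsto_laplace_excessPdf hi hre (mul_ne_zero hs0 hvc)).sub_const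
        (laplace ψ (s * v))).const_mul ((1 - laplace h s)
          / (v * s ^ 2 * (1 - laplace ψ (s * v) * laplace h s)))).const_sub
        (laplace (passageMean P τ J v) s)
      refine h1.congr' ?_
      filter_upwards [eventually_ge_atTop 0] with r hr
      rw [hw.laplace_meanExitFrom hv hr hs]
    · rw [hJ]
      have hD := hw.one_sub_laplace_mul_ne_zero hv hs
      have hμc : ((∫ ω, τ 0 ω ∂P : ℝ) : ℂ) ≠ 0 := by exact_mod_cast hμ.ne'
      generalize 1 - laplace ψ (s * v) * laplace h s = D at hD ⊢
      field_simp
      ring
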